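/- Let $V=\bigoplus_{n\ge 0}V_n$ be a vertex operator algebra over $\mathbb{C}$ (with $\dim V_n<\infty$) of strong CFT type ($V_0=\mathbb{C}\mathbf{1}$, $L(1)V_1=0$), simple, and isomorphic as a $V$-module to its contragredient $V'$; let $\langle\cdot,\cdot\rangle$ be its unique invariant bilinear form with $\langle\mathbf{1},\mathbf{1}\rangle=1$. Let $W_\alpha=\bigoplus_{n\ge 0}W_{\alpha,n+h}$ be an irreducible ordinary $V$-module of conformal weight $h\in\mathbb{C}$, with $W_{\alpha,n+h}$ the finite-dimensional $L(0)$-eigenspace of eigenvalue $n+h$, and let $W_{\alpha'}=\bigoplus_n W_{\alpha,n+h}^*$ be its contragredient module, with vertex operators $Y_{\alpha'}$. Fix a logarithm $\ell$ of $-1$ and write $(-1)^x=e^{\ell x}$. Let $\mathcal{Y}^{\alpha}_{\alpha 0}(w,z)u=e^{zL(-1)}Y_\alpha(u,-z)w$, $\mathcal{Y}^{\alpha'}_{\alpha' 0}(w',z)u=e^{zL(-1)}Y_{\alpha'}(u,-z)w'$ and let $\mathcal{Y}^{0}_{\alpha\alpha'}$ be defined by $$\langle u,\mathcal{Y}^{0}_{\alpha\alpha'}(w,z)w'\rangle=\langle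 \mathcal{Y}^{\alpha}_{\alpha 0}(e^{zL(1)}(-z^{-2})^{L(0)}w,z^{-1})u,\,w'\rangle ,$$ where $(-z^{-2})^{L(0)}w=(-1)^{n+h}z^{-2(n+h)}w$ for $w\in W_{\alpha,n+h}$. Let $v_1,\dots,v_N\in V$ be homogeneous quasiprimary vectors ($L(1)v_i=0$) of weights $\mathrm{wt}(v_i)$. For $w\in W_\alpha$, $w'\in W_{\alpha'}$ consider the formal series $$Z^{(0)}(w,y_1;v_1,z_1;\dots;v_N,z_N;w',y_2)=\langle\mathbf{1},\mathcal{Y}^{0}_{\alpha\alpha'}(w,y_1)Y_{\alpha'}(v_1,z_1)\cdots Y_{\alpha'}(v_N,z_N)\mathcal{Y}^{\alpha'}_{\alpha' 0}(w',y_2)\mathbf{1}\rangle .$$ Let $\{b\}$ be bases of the spaces $W_{\alpha,n+h}$ and let $\{b'\}$ be the dual bases. (i) For all basis vectors $b$, $(y_1-y_2)^{2h}Z^{(0)}(b,y_1;\boldsymbol{v},\boldsymbol{z};b',y_2)$ converges absolutely in the domain $|y_1|>|z_1|>\dots>|z_N|>|y_2|$ to a rational function with poles only where two of the variables $y_1,z_1,\dots,z_N,y_2$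 coincide; here the factor $(y_1-y_2)^{2h}$ is expanded in non-negative powers of $y_2$. For each $m\ge0$ the formal trace $\mathrm{tr}_{W_{\alpha',m+h}}Y_{\alpha'}(v_1,x_1)\cdots Y_{\alpha'}(v_N,x_N)$ converges absolutely in the domain $|x_1|>\dots>|x_N|>0$ to a rational function with poles only at $x_i=0$ and $x_i=x_j$. The same symbols are used for these rational extensions. (ii) Let $W_1\ne W_{-1}$ be complex numbers, let $q$ be a formal variable, and put $$w_{\pm1}=\frac{W_{\pm1}-qW_{\mp1}}{1-q},\qquad \rho=-\frac{q(W_{-1}-W_1)^2}{(1-q)^2}=-\frac{q(w_{-1}-w_1)^2}{(1+q)^2},$$ with the power $\rho^{h}$ understood by $\rho^{h}(w_1-w_{-1})^{-2h}=(-1)^{-h}q^h(1+q)^{-2h}$. Define $$Z^{(1)}_\alpha(\boldsymbol{v},\boldsymbol{z})=\sum_{n\ge0}\rho^{n+h}\sum_{b\in W_{\alpha,n+h}}Z^{(0)}(b,w_1;\boldsymbol{v},\boldsymbol{z};b',w_{-1}),\qquad \mathcal{F}^{(1)}_\alpha(\boldsymbol{v},\boldsymbol{z})=Z^{(1)}_\alpha(\boldsymbol{v},\boldsymbol{z})\prod_i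 dz_i^{\mathrm{wt}(v_i)},$$ an element of $q^h\mathbb{C}[[q]]$ for pairwise distinct complex numbers $z_1,\dots,z_N\notin\{W_1,W_{-1}\}$, and $$Z^{\mathrm{Zhu}}_{\alpha'}(\boldsymbol{v},\boldsymbol{\zeta};q)=\mathrm{tr}_{W_{\alpha'}}\,Y_{\alpha'}(e^{\mathrm{wt}(v_1)\zeta_1}v_1,e^{\zeta_1})\cdots Y_{\alpha'}(e^{\mathrm{wt}(v_N)\zeta_N}v_N,e^{\zeta_N})\,q^{L(0)} .$$ Then, as formal series in $q$, $$\mathcal{F}^{(1)}_\alpha(\boldsymbol{v},\boldsymbol{z})=Z^{\mathrm{Zhu}}_{\alpha'}(\boldsymbol{v},\boldsymbol{\zeta};q)\prod_i d\zeta_i^{\mathrm{wt}(v_i)},\qquad \zeta_i=\log\frac{z_i-W_{-1}}{z_i-W_1},$$ for every choice of the logarithms. -/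

import Mathlib

open scoped PowerSeries

noncomputable section

/-! ### Vertex operator algebras and modules

A field map sends `u` to `Y(u,z) = ∑ u(n) z^(-n-1)`, a Mathlib `VertexOperator`, so that lower
truncation is built in. -/

namespace VOA

/-- The mode `u(n)` of `Y(u,z) = ∑ u(n) z^(-n-1)`. -/
def mode {V W : Type*} [AddCommGroup V] [Module ℂ V] [AddCommGroup W] [Module ℂ W]
    (Y : V →ₗ[ℂ] VertexOperator ℂ W) (u : V) (n : ℤ) : Module.End ℂ W :=
  VertexOperator.ncoeff (Y u) n

/-- The coefficient of `z^k` in `Y(u,z)`, that is `u(-k-1)`, as a linear function of `u`. -/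
def coeffZ {V W : Type*} [AddCommGroup V] [Module ℂ V] [AddCommGroup W] [Module ℂ W]
    (Y : V →ₗ[ℂ] VertexOperator ℂ W) (k : ℤ) : V →ₗ[ℂ] Module.End ℂ W where
  toFun u := HVertexOperator.coeff (Y u) k
  map_add' u v := by simp
  map_smul' a u := by simp

/-- The Jacobi identity in components, for a field map `YV` of `V` on itself and a field map `Y` of
`V` on `W`. All the sums are finite, by lower truncation. -/
def JacobiIdentity {V W : Type*} [AddCommGroup V] [Module ℂ V] [AddCommGroup W] [Module ℂ W]
    (YV : V →ₗ[ℂ] VertexOperator ℂ V) (Y : V →ₗ[ℂ] VertexOperator ℂ W) : Prop :=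
  ∀ (u v : V) (w : W) (l m n : ℤ),
    ∑ᶠ i : ℕ, ((Ring.choose m i : ℤ) : ℂ) • mode Y (mode YV u (l + i) v) (m + n - i) w =
      ∑ᶠ i : ℕ, ((-1 : ℂ) ^ i * ((Ring.choose l i : ℤ) : ℂ)) •
        (mode Y u (m + l - i) (mode Y v (n + i) w)
          - (-1 : ℂ) ^ l • mode Y v (n + l - i) (mode Y u (m + i) w))

end VOA

open VOA in
/-- A vertex operator algebra `V = ⨁_{n ≥ 0} V_n` with finite-dimensional weight spaces. -/
structure VOA (V : Type*) [AddCommGroup V] [Module ℂ V] where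
  Y : V →ₗ[ℂ] VertexOperator ℂ V
  /-- the vacuum vector -/
  vac : V
  /-- the conformal vector -/
  ω : V
  /-- the central charge -/
  c : ℂ
  vacuum : ∀ (n : ℤ) (v : V), mode Y vac n v = if n = -1 then v else 0
  creation : ∀ u : V, mode Y u (-1) vac = u ∧ ∀ n : ℤ, 0 ≤ n → mode Y u n vac = 0
  jacobi : JacobiIdentity Y Y
  /-- the modes `L(n) = ω(n+1)` satisfy the Virasoro relations of central charge `c` -/
  virasoro : ∀ (m n : ℤ) (v : V),
    mode Y ω (m + 1) (mode Y ω (n + 1) v) - mode Y ω (n + 1) (mode Y ω (m + 1) v) =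
      ((m : ℂ) - n) • mode Y ω (m + n + 1) v
        + (if m + n = 0 then (c / 12) * ((m : ℂ) ^ 3 - m) else 0) • v
  /-- `Y(L(-1)u,z) = ∂ Y(u,z)` -/
  translation : ∀ (u : V) (n : ℤ) (v : V),
    mode Y (mode Y ω 0 u) n v = (-(n : ℂ)) • mode Y u (n - 1) v
  /-- `V` is the direct sum of the spaces `V_n = {v | L(0) v = n v}`, `n ≥ 0` -/
  grading : DirectSum.IsInternal
    (fun n : ℕ => Module.End.eigenspace (mode Y ω 1) (n : ℂ))
  finite : ∀ n : ℕ, FiniteDimensional ℂ (Module.End.eigenspace (mode Y ω 1) (n : ℂ))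
  vac_mem : vac ∈ Module.End.eigenspace (mode Y ω 1) (0 : ℂ)
  ω_mem : ω ∈ Module.End.eigenspace (mode Y ω 1) (2 : ℂ)

namespace VOA

variable {V : Type*} [AddCommGroup V] [Module ℂ V]

/-- The Virasoro mode `L(n) = ω(n+1)` on `V`. -/
def L (𝒱 : VOA V) (n : ℤ) : Module.End ℂ V := mode 𝒱.Y 𝒱.ω (n + 1)

/-- The space `V_n` of vectors of conformal weight `n`. -/
def gr (𝒱 : VOA V) (n : ℕ) : Submodule ℂ V :=
  Module.End.eigenspace (mode 𝒱.Y 𝒱.ω 1) (n : ℂ)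

theorem gr_bijective (𝒱 : VOA V) : Function.Bijective (DirectSum.coeLinearMap 𝒱.gr) := 𝒱.grading

/-- The decomposition of a vector of `V` into its homogeneous components. -/
def decompose (𝒱 : VOA V) : V ≃ₗ[ℂ] DirectSum ℕ (fun n => 𝒱.gr n) :=
  (LinearEquiv.ofBijective (DirectSum.coeLinearMap 𝒱.gr) 𝒱.gr_bijective).symm

theorem decompose_of_mem (𝒱 : VOA V) {n : ℕ} {v : V} (hv : v ∈ 𝒱.gr n) :
    𝒱.decompose v = DirectSum.lof ℂ ℕ (fun n => 𝒱.gr n) n ⟨v, hv⟩ := by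
  rw [decompose, LinearEquiv.symm_apply_eq, LinearEquiv.ofBijective_apply,
    DirectSum.lof_eq_of, DirectSum.coeLinearMap_of]

/-- An ordinary `V`-module `W = ⨁_{n ≥ 0} W_{h+n}` with finite-dimensional weight spaces. -/
structure OrdinaryModule (𝒱 : VOA V) (W : Type*) [AddCommGroup W] [Module ℂ W] where
  Y : V →ₗ[ℂ] VertexOperator ℂ W
  /-- the conformal weight -/
  h : ℂ
  vacuum : ∀ (n : ℤ) (w : W), mode Y 𝒱.vac n w = if n = -1 then w else 0
  jacobi : JacobiIdentity 𝒱.Y Y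
  translation : ∀ (u : V) (n : ℤ) (w : W),
    mode Y (mode 𝒱.Y 𝒱.ω 0 u) n w = (-(n : ℂ)) • mode Y u (n - 1) w
  /-- `W` is the direct sum of the spaces `W_{h+n} = {w | L(0) w = (h + n) w}`, `n ≥ 0` -/
  grading : DirectSum.IsInternal
    (fun n : ℕ => Module.End.eigenspace (mode Y 𝒱.ω 1) (h + n))
  finite : ∀ n : ℕ, FiniteDimensional ℂ (Module.End.eigenspace (mode Y 𝒱.ω 1) (h + n))

/-- `V` as a module over itself. -/
def adjoint (𝒱 : VOA V) : 𝒱.OrdinaryModule V where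
  Y := 𝒱.Y
  h := 0
  vacuum := 𝒱.vacuum
  jacobi := 𝒱.jacobi
  translation := 𝒱.translation
  grading := by simpa using 𝒱.grading
  finite n := by rw [zero_add]; exact 𝒱.finite n

namespace OrdinaryModule

variable {𝒱 : VOA V} {W : Type*} [AddCommGroup W] [Module ℂ W]

/-- The space `W_{h+n}` of vectors of conformal weight `h + n`. -/
def gr (M : 𝒱.OrdinaryModule W) (n : ℕ) : Submodule ℂ W :=
  Module.End.eigenspace (mode M.Y 𝒱.ω 1) (M.h + n)

theorem gr_bijective (M : 𝒱.OrdinaryModule W) :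
    Function.Bijective (DirectSum.coeLinearMap M.gr) := M.grading

/-- The decomposition of a vector of `W` into its homogeneous components. -/
def decompose (M : 𝒱.OrdinaryModule W) : W ≃ₗ[ℂ] DirectSum ℕ (fun n => M.gr n) :=
  (LinearEquiv.ofBijective (DirectSum.coeLinearMap M.gr) M.gr_bijective).symm

theorem decompose_of_mem (M : 𝒱.OrdinaryModule W) {n : ℕ} {w : W} (hw : w ∈ M.gr n) :
    M.decompose w = DirectSum.lof ℂ ℕ (fun n => M.gr n) n ⟨w, hw⟩ := by
  rw [decompose, LinearEquiv.symm_apply_eq, LinearEquiv.ofBijective_apply,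
    DirectSum.lof_eq_of, DirectSum.coeLinearMap_of]

/-- The projection of `W` onto `W_{h+n}`. -/
def proj (M : 𝒱.OrdinaryModule W) (n : ℕ) : W →ₗ[ℂ] M.gr n :=
  DirectSum.component ℂ ℕ (fun n => M.gr n) n ∘ₗ M.decompose.toLinearMap

/-- `W` is nonzero and has no submodules besides `0` and `W`. -/
def IsIrreducible (M : 𝒱.OrdinaryModule W) : Prop :=
  Nontrivial W ∧ ∀ S : Submodule ℂ W,
    (∀ (u : V) (n : ℤ), ∀ w ∈ S, mode M.Y u n w ∈ S) → S = ⊥ ∨ S = ⊤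

/-- The coefficient of `z^k` in the adjoint field
`Y†(u,z) = Y(e^{zL(1)} (-z^{-2})^{L(0)} u, z^{-1})`; for `u ∈ V_N` this is the sum over `j` of
`(-1)^N / j!` times the coefficient of `z^(j-2N-k)` in `Y(L(1)^j u, z)`, and `L(1)^j u = 0` for
`j > N`. -/
def dagger (M : 𝒱.OrdinaryModule W) (k : ℤ) : V →ₗ[ℂ] Module.End ℂ W :=
  (DirectSum.toModule ℂ ℕ (Module.End ℂ W) fun N =>
    (∑ j ∈ Finset.range (N + 1), ((-1 : ℂ) ^ N / (j.factorial : ℂ)) •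
      (coeffZ M.Y ((j : ℤ) - 2 * N - k) ∘ₗ (𝒱.L 1) ^ j)) ∘ₗ (𝒱.gr N).subtype)
  ∘ₗ 𝒱.decompose.toLinearMap

/-! ### The contragredient module -/

/-- The graded dual `W' = ⨁ (W_{h+n})^*`: the linear forms on `W` which vanish on almost all
weight spaces. -/
def restrictedDual (M : 𝒱.OrdinaryModule W) : Submodule ℂ (Module.Dual ℂ W) where
  carrier := {f | ∃ B : ℕ, ∀ n, B ≤ n → ∀ w ∈ M.gr n, f w = 0}
  zero_mem' := ⟨0, fun _ _ _ _ => rfl⟩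
  add_mem' := by
    rintro f g ⟨B, hB⟩ ⟨C, hC⟩
    refine ⟨max B C, fun n hn w hw => ?_⟩
    rw [LinearMap.add_apply, hB n (le_trans (le_max_left _ _) hn) w hw,
      hC n (le_trans (le_max_right _ _) hn) w hw, add_zero]
  smul_mem' := by
    rintro a f ⟨B, hB⟩
    exact ⟨B, fun n hn w hw => by rw [LinearMap.smul_apply, hB n hn w hw, smul_zero]⟩

theorem L0_bracket (M : 𝒱.OrdinaryModule W) (u : V) (n : ℤ) (w : W) :
    mode M.Y 𝒱.ω 1 (mode M.Y u n w) - mode M.Y u n (mode M.Y 𝒱.ω 1 w) =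
      mode M.Y (mode 𝒱.Y 𝒱.ω 1 u) n w - ((n : ℂ) + 1) • mode M.Y u n w := by
  have h := M.jacobi 𝒱.ω u w 0 1 n
  rw [finsum_eq_sum_of_support_subset (s := Finset.range 2),
    finsum_eq_sum_of_support_subset (s := Finset.range 1)] at h
  · have ht := M.translation u (1 + n) w
    simp [Finset.sum_range_succ] at h ht
    rw [← h, ht]
    module
  · intro i hi
    by_contra hc
    have : 0 < i := by simp at hc; omega
    exact hi (by simp [Ring.choose_zero_pos ℤ this])
  · intro i hi
    by_contra hc
    have : 1 < i := by simp at hc; omega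
    refine hi ?_
    have h1 : Ring.choose (1 : ℤ) i = 0 := by
      have := Ring.choose_natCast (R := ℤ) 1 i
      rw [Nat.cast_one] at this
      rw [this, Nat.choose_eq_zero_of_lt ‹_›, Nat.cast_zero]
    simp [h1]

theorem mode_mem_eigenspace (M : 𝒱.OrdinaryModule W) {u : V} {w : W} {r s : ℂ} (n : ℤ)
    (hu : u ∈ Module.End.eigenspace (mode 𝒱.Y 𝒱.ω 1) s)
    (hw : w ∈ Module.End.eigenspace (mode M.Y 𝒱.ω 1) r) :
    mode M.Y u n w ∈ Module.End.eigenspace (mode M.Y 𝒱.ω 1) (r + s - n - 1) := by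
  rw [Module.End.mem_eigenspace_iff] at hu hw ⊢
  have h := M.L0_bracket u n w
  rw [hu, hw, map_smul, sub_eq_iff_eq_add] at h
  rw [h]
  have : mode M.Y (s • u) n w = s • mode M.Y u n w := by simp [mode]
  rw [this]
  module

theorem L1_pow_mem (𝒱 : VOA V) {u : V} {s : ℂ} (j : ℕ)
    (hu : u ∈ Module.End.eigenspace (mode 𝒱.Y 𝒱.ω 1) s) :
    ((𝒱.L 1) ^ j) u ∈ Module.End.eigenspace (mode 𝒱.Y 𝒱.ω 1) (s - j) := by
  induction j with
  | zero => simpa using hu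
  | succ j ih =>
    rw [pow_succ', Module.End.mul_apply]
    have := 𝒱.adjoint.mode_mem_eigenspace (1 + 1) 𝒱.ω_mem ih
    have e : s - (j : ℂ) + 2 - ((1 + 1 : ℤ) : ℂ) - 1 = s - ((j + 1 : ℕ) : ℂ) := by
      push_cast; ring
    rw [e] at this
    exact this

theorem dagger_mem (M : 𝒱.OrdinaryModule W) {u : V} {N : ℕ} (hu : u ∈ 𝒱.gr N) (k : ℤ) {w : W}
    {r : ℂ} (hw : w ∈ Module.End.eigenspace (mode M.Y 𝒱.ω 1) r) :
    M.dagger k u w ∈ Module.End.eigenspace (mode M.Y 𝒱.ω 1) (r - N - k) := by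
  simp only [dagger, LinearMap.comp_apply, LinearEquiv.coe_coe, 𝒱.decompose_of_mem hu, DirectSum.toModule_lof,
    Submodule.subtype_apply, LinearMap.sum_apply, LinearMap.smul_apply]
  refine Submodule.sum_mem _ fun j _ => Submodule.smul_mem _ _ ?_
  have := M.mode_mem_eigenspace (-((j : ℤ) - 2 * N - k) - 1) (L1_pow_mem 𝒱 j hu) hw
  have e : r + ((N : ℂ) - j) - ((-((j : ℤ) - 2 * N - k) - 1 : ℤ) : ℂ) - 1 = r - N - k := by
    push_cast; ring
  rw [e] at this
  simpa [mode, coeffZ] using this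

theorem dagger_restrictedDual (M : 𝒱.OrdinaryModule W) (u : V) {f : Module.Dual ℂ W}
    (hf : f ∈ M.restrictedDual) :
    (∀ k : ℤ, f ∘ₗ M.dagger k u ∈ M.restrictedDual) ∧
      ∃ K : ℤ, ∀ k, k < K → f ∘ₗ M.dagger k u = 0 := by
  have htop : u ∈ ⨆ n, 𝒱.gr n := by
    have : (⨆ n, 𝒱.gr n) = ⊤ := 𝒱.grading.submodule_iSup_eq_top
    rw [this]; trivial
  induction htop using Submodule.iSup_induction' with
  | mem N u hu =>
    obtain ⟨B, hB⟩ := hf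
    have key : ∀ (k : ℤ) (m : ℕ), (B : ℤ) ≤ m - N - k → ∀ w ∈ M.gr m, f (M.dagger k u w) = 0 := by
      intro k m hm w hw
      obtain ⟨p, hp⟩ := Int.eq_ofNat_of_zero_le (le_trans (Int.natCast_nonneg B) hm)
      refine hB p (by omega) _ ?_
      have := M.dagger_mem hu k hw
      have e : M.h + (m : ℂ) - N - k = M.h + p := by
        have : ((m - N - k : ℤ) : ℂ) = ((p : ℤ) : ℂ) := by rw [hp]
        push_cast at this
        rw [← this]; ring
      rwa [e] at this
    refine ⟨fun k => ⟨(B + N + k).toNat, fun m hm w hw => key k m (by omega) w hw⟩,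
      -(N : ℤ) - B, fun k hk => ?_⟩
    have : (⊤ : Submodule ℂ W) ≤ LinearMap.ker (f ∘ₗ M.dagger k u) := by
      have h2 : (⨆ n, M.gr n) = ⊤ := M.grading.submodule_iSup_eq_top
      rw [← h2]
      exact iSup_le fun m w hw => key k m (by omega) w hw
    exact LinearMap.ker_eq_top.mp (top_le_iff.mp this)
  | zero => exact ⟨fun k => by simp, 0, fun k _ => by simp⟩
  | add u v _ _ ihu ihv =>
    obtain ⟨h1, K1, hK1⟩ := ihu
    obtain ⟨h2, K2, hK2⟩ := ihv
    refine ⟨fun k => ?_, min K1 K2, fun k hk => ?_⟩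
    · rw [map_add, LinearMap.comp_add]
      exact Submodule.add_mem _ (h1 k) (h2 k)
    · rw [map_add, LinearMap.comp_add, hK1 k (by omega), hK2 k (by omega), add_zero]

/-- The coefficient of `z^k` in the contragredient field `Y'(u,z)`, defined by
`⟨Y'(u,z) f, w⟩ = ⟨f, Y†(u,z) w⟩`. -/
def contraCoeff (M : 𝒱.OrdinaryModule W) (u : V) (k : ℤ) : Module.End ℂ M.restrictedDual where
  toFun f := ⟨(f : Module.Dual ℂ W) ∘ₗ M.dagger k u, (M.dagger_restrictedDual u f.2).1 k⟩
  map_add' f g := by ext; simp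
  map_smul' a f := by ext; simp

/-- The field map `Y'` of the contragredient module `W'`. -/
def contraY (M : 𝒱.OrdinaryModule W) : V →ₗ[ℂ] VertexOperator ℂ M.restrictedDual where
  toFun u := VertexOperator.of_coeff (M.contraCoeff u) (by
    intro f
    obtain ⟨K, hK⟩ := (M.dagger_restrictedDual u f.2).2
    refine ⟨K, fun k hk => ?_⟩
    by_contra hc
    exact hk (Subtype.ext (hK k (not_le.mp hc))))
  map_add' u v := by
    apply HVertexOperator.coeff_inj
    funext k
    rw [map_add]
    simp only [VertexOperator.of_coeff, HVertexOperator.coeff_of_coeff, Pi.add_apply]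
    ext f w
    simp [contraCoeff]
  map_smul' a u := by
    apply HVertexOperator.coeff_inj
    funext k
    rw [map_smul]
    simp only [VertexOperator.of_coeff, HVertexOperator.coeff_of_coeff, Pi.smul_apply]
    ext f w
    simp [contraCoeff]

theorem proj_of_mem_ne (M : 𝒱.OrdinaryModule W) {m n : ℕ} (hmn : m ≠ n) {w : W}
    (hw : w ∈ M.gr m) : M.proj n w = 0 := by
  simp only [proj, LinearMap.comp_apply, LinearEquiv.coe_coe, M.decompose_of_mem hw, DirectSum.lof_eq_of]
  rw [← DirectSum.apply_eq_component]
  exact DirectSum.of_eq_of_ne _ _ _ hmn.symm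

/-- The inclusion of `(W_{h+n})^*` in `W'`, extending a form by zero. -/
def extend (M : 𝒱.OrdinaryModule W) (n : ℕ) :
    Module.Dual ℂ (M.gr n) →ₗ[ℂ] M.restrictedDual where
  toFun φ := ⟨φ ∘ₗ M.proj n, n + 1, fun m hm w hw => by
    rw [LinearMap.comp_apply, M.proj_of_mem_ne (by omega) hw, map_zero]⟩
  map_add' φ ψ := by ext; simp
  map_smul' a φ := by ext; simp

/-- The projection of `W'` onto `(W_{h+n})^*`, restricting a form to `W_{h+n}`. -/
def restrict (M : 𝒱.OrdinaryModule W) (n : ℕ) :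
    M.restrictedDual →ₗ[ℂ] Module.Dual ℂ (M.gr n) where
  toFun f := (f : Module.Dual ℂ W) ∘ₗ (M.gr n).subtype
  map_add' f g := by ext; simp
  map_smul' a f := by ext; simp

end OrdinaryModule

/-! ### Strong CFT type, simplicity, self-duality and the Li-Zamolodchikov metric -/

/-- `V_0 = ℂ𝟙` and `L(1) V_1 = 0`. -/
def IsStrongCFTType (𝒱 : VOA V) : Prop :=
  𝒱.gr 0 = Submodule.span ℂ {𝒱.vac} ∧ ∀ v ∈ 𝒱.gr 1, 𝒱.L 1 v = 0

/-- `V` is irreducible as a module over itself. -/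
def IsSimple (𝒱 : VOA V) : Prop := 𝒱.adjoint.IsIrreducible

/-- `V` is isomorphic, as a `V`-module, to its contragredient module `V'`. -/
def IsSelfDual (𝒱 : VOA V) : Prop :=
  ∃ e : V ≃ₗ[ℂ] 𝒱.adjoint.restrictedDual, ∀ (u : V) (n : ℤ) (v : V),
    e (mode 𝒱.Y u n v) = mode 𝒱.adjoint.contraY u n (e v)

/-- `B` is an invariant bilinear form, `B(Y(u,z)v, w) = B(v, Y†(u,z)w)`, with `B(𝟙,𝟙) = 1`. -/
def IsLiZMetric (𝒱 : VOA V) (B : LinearMap.BilinForm ℂ V) : Prop :=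
  B 𝒱.vac 𝒱.vac = 1 ∧ ∀ (u v w : V) (k : ℤ),
    B (coeffZ 𝒱.Y k u v) w = B v (𝒱.adjoint.dagger k u w)

/-- The Li-Zamolodchikov metric: the invariant bilinear form on `V` with `⟨𝟙,𝟙⟩ = 1`, which is
unique. -/
def liZ (𝒱 : VOA V) : LinearMap.BilinForm ℂ V := Classical.epsilon 𝒱.IsLiZMetric

/-! ### Intertwiners between `V`, `W` and `W'` -/

/-- The coefficient of `z^k` in the creative intertwiner
`𝒴(w,z)u = e^{zL(-1)} Y(u,-z) w`, for a module with field map `Y`. The sum is finite. -/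
def creative (𝒱 : VOA V) {W : Type*} [AddCommGroup W] [Module ℂ W]
    (Y : V →ₗ[ℂ] VertexOperator ℂ W) (w : W) (u : V) (k : ℤ) : W :=
  ∑ᶠ j : ℕ, ((-1 : ℂ) ^ (k - j) / (j.factorial : ℂ)) •
    ((mode Y 𝒱.ω 0) ^ j) (coeffZ Y (k - j) u w)

namespace OrdinaryModule

variable {𝒱 : VOA V} {W : Type*} [AddCommGroup W] [Module ℂ W]

/-- The coefficient of `z^k` in
`z^{2h} ⟨𝒴(e^{zL(1)} (-z^{-2})^{L(0)} w, z^{-1}) u, f⟩`, where `𝒴` is the creative intertwiner of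
type `W ⊗ V → W`. Here `(-1)^x` means `exp (ℓ x)`, `ℓ` being a logarithm of `-1`; for
`w ∈ W_{h+n}` one has `z^{2h} (-z^{-2})^{L(0)} w = exp (ℓ (h+n)) z^{-2n} w`. -/
def adjointPairing (M : 𝒱.OrdinaryModule W) (ℓ : ℂ) (w : W) (f : M.restrictedDual) (k : ℤ)
    (u : V) : ℂ :=
  ∑ᶠ n : ℕ, ∑ j ∈ Finset.range (n + 1),
    (Complex.exp (ℓ * (M.h + n)) / (j.factorial : ℂ)) *
      (f : Module.Dual ℂ W)
        (𝒱.creative M.Y (((mode M.Y 𝒱.ω 2) ^ j) (M.proj n w : W)) u ((j : ℤ) - 2 * n - k))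

/-- The coefficient of `z^k` in `z^{2h} 𝒴(w,z) f`, where `𝒴` is the intertwiner of type
`W ⊗ W' → V` which is adjoint to the creative intertwiner: it is the vector `a` of `V` such that
`⟨u, a⟩` is the coefficient of `z^k` in
`z^{2h} ⟨𝒴(e^{zL(1)} (-z^{-2})^{L(0)} w, z^{-1}) u, f⟩` for all `u ∈ V`. -/
def annihilating (M : 𝒱.OrdinaryModule W) (ℓ : ℂ) (w : W) (f : M.restrictedDual) (k : ℤ) : V :=
  haveI : Nonempty V := ⟨0⟩
  Classical.epsilon fun a => ∀ u, 𝒱.liZ u a = M.adjointPairing ℓ w f k u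

/-- The coefficient of `∏ z_i^{k_i}` in `Y'(v_1,z_1) ⋯ Y'(v_n,z_n)` on `W'`. -/
def prodCoeff (M : 𝒱.OrdinaryModule W) {n : ℕ} (v : Fin n → V) (k : Fin n → ℤ) :
    Module.End ℂ M.restrictedDual :=
  (List.ofFn fun i => coeffZ M.contraY (k i) (v i)).prod

/-- The coefficient of `y₁^{k_0} z_1^{k_1} ⋯ z_n^{k_n} y₂^{k_{n+1}}` in
`y₁^{2h} Z⁽⁰⁾(w,y₁; v,z; f,y₂)`, where
`Z⁽⁰⁾(w,y₁; v,z; f,y₂) = ⟨𝟙, 𝒴(w,y₁) Y'(v_1,z_1) ⋯ Y'(v_n,z_n) 𝒴(f,y₂) 𝟙⟩` is the genus zero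
intertwining correlation function. -/
def genusZeroCoeff (M : 𝒱.OrdinaryModule W) (ℓ : ℂ) {n : ℕ} (v : Fin n → V) (w : W)
    (f : M.restrictedDual) (k : Fin (n + 2) → ℤ) : ℂ :=
  𝒱.liZ 𝒱.vac (M.annihilating ℓ w
    (M.prodCoeff v (fun i => k i.castSucc.succ)
      (𝒱.creative M.contraY f 𝒱.vac (k (Fin.last (n + 1)))))
    (k 0))

/-- The coefficient of `q^{h+m} ∏ x_i^{k_i}` in
`tr_{W'} (Y'(v_1,x_1) ⋯ Y'(v_n,x_n) q^{L(0)})`. -/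
def traceCoeff (M : 𝒱.OrdinaryModule W) {n : ℕ} (v : Fin n → V) (m : ℕ) (k : Fin n → ℤ) : ℂ :=
  LinearMap.trace ℂ (Module.Dual ℂ (M.gr m)) (M.restrict m ∘ₗ M.prodCoeff v k ∘ₗ M.extend m)

end OrdinaryModule
end VOA

/-! ### Rational functions and their expansions -/

/-- A rational function (given as a fraction) in `m` variables which is regular on `S`. -/
structure RegularRational {m : ℕ} (S : Set (Fin m → ℂ)) where
  num : MvPolynomial (Fin m) ℂ
  den : MvPolynomial (Fin m) ℂ
  den_ne : ∀ x ∈ S, MvPolynomial.aeval x den ≠ 0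

/-- The value of a rational function at a point with coordinates in `A` (below `ℂ` or `ℂ⟦X⟧`). -/
def RegularRational.eval {m : ℕ} {S : Set (Fin m → ℂ)} (R : RegularRational S) {A : Type*}
    [CommRing A] [Algebra ℂ A] [Inv A] (x : Fin m → A) : A :=
  MvPolynomial.aeval x R.num * (MvPolynomial.aeval x R.den)⁻¹

/-- The formal series `∑ c(k) x^k` converges absolutely to `F x` at all points `x` of `S` in the
domain `|x_0| > |x_1| > ⋯`. -/
def ConvergesTo {m : ℕ} (S : Set (Fin m → ℂ)) (c : (Fin m → ℤ) → ℂ)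
    (F : (Fin m → ℂ) → ℂ) : Prop :=
  ∀ x ∈ S, StrictAnti (fun i => ‖x i‖) → HasSum (fun k : Fin m → ℤ => c k * ∏ i, x i ^ k i) (F x)

/-- The tuple `(a, z_1, …, z_n, b)`. -/
def bracketed {A : Type*} {n : ℕ} (a : A) (z : Fin n → A) (b : A) : Fin (n + 2) → A :=
  Fin.cons (α := fun _ => A) a (Fin.snoc (α := fun _ => A) z b)

/-! ### Sewing at genus one, formally in `q` -/

/-- The sewing point `w = (W - q W') / (1 - q)` attached to the fixed point `W`, as a power series
in `q`; here `W'` is the other fixed point. -/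
def sewingPoint (W W' : ℂ) : ℂ⟦X⟧ :=
  (PowerSeries.C W - PowerSeries.X * PowerSeries.C W') * (1 - PowerSeries.X)⁻¹

/-- The sewing parameter `ρ = -q (W₋ - W₊)² / (1 - q)²`, as a power series in `q`. -/
def sewingRho (Wp Wm : ℂ) : ℂ⟦X⟧ :=
  -PowerSeries.X * PowerSeries.C ((Wm - Wp) ^ 2) * ((1 - PowerSeries.X) ^ 2)⁻¹

/-- `q^{-h}` times the sewn function `∑_{n ≥ 0} ρ^{n+h} ∑_b Z⁽⁰⁾(b,w₊; v,z; b',w₋)`, as a power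
series in `q`, where `b` runs over a basis of `W_{h+n}` indexed by `ι n` and
`R n i = (y₁ - y₂)^{2h} Z⁽⁰⁾(b,y₁; v,z; b',y₂)` for the basis vector `b` with index `i`. Here
`ρ^h (w₊ - w₋)^{-2h} = (-q / (1+q)²)^h = q^h exp (-ℓ h) (1+q)^{-2h}`, and as `ρ^n` is divisible
by `q^n`, only the terms with `n ≤ m` contribute to the coefficient of `q^m`. -/
def genusOneSewn {N : ℕ} {S : Set (Fin (N + 2) → ℂ)} (ℓ h : ℂ) {ι : ℕ → Type*}
    [∀ n, Fintype (ι n)] (R : ∀ n, ι n → RegularRational S) (Wp Wm : ℂ) (z : Fin N → ℂ) : ℂ⟦X⟧ :=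
  PowerSeries.C (Complex.exp (-ℓ * h)) * PowerSeries.binomialSeries ℂ (-2 * h) *
    PowerSeries.mk fun m => PowerSeries.coeff m
      (∑ n ∈ Finset.range (m + 1), sewingRho Wp Wm ^ n * ∑ i, (R n i).eval
        (bracketed (sewingPoint Wp Wm) (fun k => PowerSeries.C (z k)) (sewingPoint Wm Wp)))

end

/-!
The correlation functions on the sphere and the traces are treated by one formal scheme, which uses
only that `L(-1)`, `L(0)`, `L(1)` span `sl₂`, and that the fields are quasiprimary and mutually
local (`QuasiprimaryFields`).

*Rationality.* Multiplied by the discriminant `∏ (x_i - x_j)^K`, a product of fields does not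
depend on the order of the fields. As each field may then be moved to either end of the product,
matrix coefficients become Laurent polynomials (`IsLocal.finite_support`,
`QuasiprimaryFields.poly`), and they inherit the Ward identities of `sl₂` with weights shifted by
the discriminant (`ward_E`, `ward_H`, `ward_F`). Convergence of the series is recovered by dividing
the differences `x_i - x_j` out again, each division being the summation of a geometric series
(`dividesAt_discr`).

*Genus zero.* On the vacuum the intertwiners are exponentials of `L(-1)`, and the Li-Zamolodchikov
metric is nondegenerate, so that the coefficients of `⟨𝟏, 𝒴(w,y₁) Y'(v₁,z₁) ⋯ 𝒴(w',y₂) 𝟏⟩` are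
matrix coefficients of descendants of `w` and `w'` (`genusZeroCoeff_eq`). By the Ward identities
their generating series satisfies a first order differential equation, and so does an explicit
expression in the Laurent polynomials of the vectors `L(1)^a w'` and `L(1)^c w`, taken at the
points `(z_i - y₂) / (1 - z_i / y₁)`. The two agree (`serTY_eq_flowTY`), and each factor of the
explicit expression is a convergent binomial series. This gives `convergesTo_genusZero`.

*Sewing.* In the coordinate `ξ = (z - W₋) / (z - W₊) = e^ζ`, the sewing points `w₊` and `w₋` are
`1 / q` and `q`. So at genus one the sum over `m` and over dual bases of `W_m` is
`(1 + q)^(-2h) ∑ κ^m ⟨… exp(-E) Ω_m⟩` with `κ = q / (1 + q)²`, the canonical tensor `Ω_m` of the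
`m`-th weight space, and the points `ξ_i` moved to `(ξ_i - q) / (1 - q ξ_i)`; here `E`, `F`, `H`
act diagonally on tensors. The claim is that this is `∑ q^m ⟨… Ω_m⟩` at the points `ξ_i`. The
movement of the points by `ξ ↦ (ξ - s) / (1 - s ξ)` is generated by `F - E`, and
`F Ω_m = E Ω_{m+1}` (`FT_canonical`). With `s = σ q`, the exponential `exp(-E)` replaced by
`exp(a E)`, and suitable functions `a` and `κ` and a suitable prefactor, all depending on `σ` and
`q`, the sum is therefore independent of `σ`, as its derivative telescopes
(`Sewing.System.coeff_sum`). Its values at `σ = 1` and at `σ = 0` are the two sides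
(`Sewing.System.sewing`). The prefactors are compared in `genusOneSewn_eq`: the Jacobian of `z ↦ ξ`
accounts for the differentials, and the Jacobian of the movement of the points is part of the flow.
-/

open scoped PowerSeries

noncomputable section

/-! ### Laurent polynomials acting on formal Laurent series -/

/-- Laurent polynomials over `ℂ` in `n` variables. -/
abbrev LaurentPoly (n : ℕ) := AddMonoidAlgebra ℂ (Fin n → ℤ)

namespace LaurentPoly

variable {n : ℕ}

/-- The monomial `x^a`. -/
def mono (a : Fin n → ℤ) : LaurentPoly n := AddMonoidAlgebra.single a 1

/-- The variable `x_i`. -/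
def var (i : Fin n) : LaurentPoly n := mono (Pi.single i 1)

theorem mono_mul_mono (a b : Fin n → ℤ) : mono a * mono b = mono (a + b) := by
  simp [mono, AddMonoidAlgebra.single_mul_single]

theorem mono_zero : mono (0 : Fin n → ℤ) = 1 := rfl

theorem mono_nsmul (a : Fin n → ℤ) (r : ℕ) : mono (r • a) = mono a ^ r := by
  simp [mono, AddMonoidAlgebra.single_pow]

theorem single_eq_smul_mono (a : Fin n → ℤ) (r : ℂ) :
    AddMonoidAlgebra.single a r = r • mono a := by
  simp [mono]

theorem X_mul_mono_neg (i : Fin n) : var i * mono (-Pi.single i 1) = 1 := by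
  rw [var, mono_mul_mono, add_neg_cancel, mono_zero]

/-- A Laurent polynomial is determined by linearity from its monomials. -/
theorem induction_mono {motive : LaurentPoly n → Prop} (p : LaurentPoly n) (zero : motive 0)
    (add : ∀ p q, motive p → motive q → motive (p + q))
    (mono : ∀ a (r : ℂ), motive (r • mono a)) : motive p := by
  induction p using AddMonoidAlgebra.induction_linear with
  | zero => exact zero
  | add p q hp hq => exact add p q hp hq
  | single a r => rw [single_eq_smul_mono]; exact mono a r

/-- The coefficientwise multiplication by `k ↦ k_i`. -/
def eulerLin (i : Fin n) : LaurentPoly n →ₗ[ℂ] LaurentPoly n where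
  toFun p := .ofCoeff (Finsupp.onFinset p.coeff.support (fun k => (k i : ℂ) * p.coeff k)
    fun k hk => by
      rw [Finsupp.mem_support_iff]; rintro h; simp [h] at hk)
  map_add' p q := by ext k; simp [mul_add]
  map_smul' r p := by ext k; simp; ring

theorem coeff_eulerLin (i : Fin n) (p : LaurentPoly n) (k : Fin n → ℤ) :
    (eulerLin i p).coeff k = (k i : ℂ) * p.coeff k := rfl

theorem eulerLin_mono (i : Fin n) (a : Fin n → ℤ) : eulerLin i (mono a) = (a i : ℂ) • mono a := by
  ext k
  rw [coeff_eulerLin]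
  by_cases h : a = k
  · subst h; simp [mono]
  · simp [mono, h]

/-- The Euler derivation `x_i ∂/∂x_i`. -/
def euler (i : Fin n) : Derivation ℂ (LaurentPoly n) (LaurentPoly n) :=
  Derivation.mk' (eulerLin i) fun p q => by
    induction p using induction_mono with
    | zero => simp
    | add p p' hp hp' => rw [add_mul, map_add, hp, hp', map_add, smul_add, add_smul]; abel
    | mono a r =>
      induction q using induction_mono with
      | zero => simp
      | add q q' hq hq' => rw [mul_add, map_add, hq, hq', map_add, smul_add, add_smul]; abel
      | mono b s =>
        simp only [mono_mul_mono, map_smul, eulerLin_mono, smul_eq_mul, smul_smul,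
          Algebra.mul_smul_comm, Algebra.smul_mul_assoc, Pi.add_apply, Int.cast_add]
        rw [add_comm b a, ← add_smul]
        congr 1
        ring

theorem coeff_euler (i : Fin n) (p : LaurentPoly n) (k : Fin n → ℤ) :
    (euler i p).coeff k = (k i : ℂ) * p.coeff k := rfl

theorem euler_mono (i : Fin n) (a : Fin n → ℤ) : euler i (mono a) = (a i : ℂ) • mono a :=
  eulerLin_mono i a

theorem euler_X (i j : Fin n) : euler i (var j) = if i = j then var j else 0 := by
  rw [var, euler_mono]
  by_cases h : i = j <;> simp [h]

/-- The monomial operators `f ↦ x^a f` on formal Laurent series. -/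
def shiftHom : Multiplicative (Fin n → ℤ) →* Module.End ℂ ((Fin n → ℤ) → ℂ) where
  toFun a := LinearMap.funLeft ℂ ℂ fun k => k - a.toAdd
  map_one' := by ext; simp [LinearMap.funLeft_apply]
  map_mul' a b := by
    refine LinearMap.ext fun f => funext fun k => ?_
    simp [LinearMap.funLeft_apply, sub_sub]

/-- The multiplication of formal Laurent series by Laurent polynomials. -/
def act : LaurentPoly n →ₐ[ℂ] Module.End ℂ ((Fin n → ℤ) → ℂ) :=
  AddMonoidAlgebra.lift ℂ _ _ shiftHom

theorem act_mono (a : Fin n → ℤ) (f : (Fin n → ℤ) → ℂ) (k : Fin n → ℤ) :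
    act (mono a) f k = f (k - a) := by
  simp [act, mono, shiftHom, LinearMap.funLeft_apply]

theorem act_X (i : Fin n) (f : (Fin n → ℤ) → ℂ) (k : Fin n → ℤ) :
    act (var i) f k = f (k - Pi.single i 1) := act_mono _ _ _

theorem act_apply (p : LaurentPoly n) (f : (Fin n → ℤ) → ℂ) (k : Fin n → ℤ) :
    act p f k = ∑ a ∈ p.coeff.support, p.coeff a * f (k - a) := by
  rw [act, AddMonoidAlgebra.lift_apply, Finsupp.sum, LinearMap.sum_apply, Finset.sum_apply]
  rfl

/-- The coefficients of a product are given by the action on the coefficients of a factor. -/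
theorem act_coeff (p q : LaurentPoly n) : act p (q.coeff : (Fin n → ℤ) → ℂ) = (p * q).coeff := by
  induction p using induction_mono with
  | zero => ext; simp
  | add p p' hp hp' => rw [map_add, LinearMap.add_apply, hp, hp', add_mul]; rfl
  | mono a r =>
    ext k
    rw [map_smul, LinearMap.smul_apply, Pi.smul_apply, act_mono, Algebra.smul_mul_assoc,
      AddMonoidAlgebra.coeff_smul_apply, mono]
    congr 1
    rw [AddMonoidAlgebra.coeff_single_mul_eq_mul_coeff (k - a), one_mul]
    intro m _
    rw [add_comm, eq_sub_iff_add_eq]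

/-- The Euler operator `x_i ∂/∂x_i` on formal Laurent series. -/
def eulerF (i : Fin n) : Module.End ℂ ((Fin n → ℤ) → ℂ) where
  toFun f k := (k i : ℂ) * f k
  map_add' f g := by ext; simp [mul_add]
  map_smul' r f := by ext; simp; ring

/-- The Leibniz rule for the Euler operator. -/
theorem eulerF_act (i : Fin n) (p : LaurentPoly n) (f : (Fin n → ℤ) → ℂ) :
    eulerF i (act p f) = act (euler i p) f + act p (eulerF i f) := by
  induction p using induction_mono with
  | zero => simp
  | add p p' hp hp' => simp only [map_add, LinearMap.add_apply, hp, hp']; abel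
  | mono a r =>
    ext k
    simp only [map_smul, Derivation.map_smul, LinearMap.smul_apply, euler_mono, Pi.add_apply,
      Pi.smul_apply, act_mono,
      eulerF, LinearMap.coe_mk, AddHom.coe_mk, Pi.sub_apply, Int.cast_sub, smul_eq_mul]
    ring

variable {A : Type*} [CommRing A] [Algebra ℂ A]

/-- Powers of units, as a homomorphism in the exponents. -/
def unitsPow (u : Fin n → Aˣ) : Multiplicative (Fin n → ℤ) →* A where
  toFun a := ((∏ i, u i ^ (a.toAdd i) : Aˣ) : A)
  map_one' := by simp
  map_mul' a b := by simp [zpow_add, Finset.prod_mul_distrib]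

/-- The evaluation of Laurent polynomials at units. -/
def ev (u : Fin n → Aˣ) : LaurentPoly n →ₐ[ℂ] A :=
  AddMonoidAlgebra.lift ℂ _ _ (unitsPow u)

theorem ev_mono (u : Fin n → Aˣ) (a : Fin n → ℤ) :
    ev u (mono a) = ((∏ i, u i ^ a i : Aˣ) : A) := by
  simp [ev, mono, unitsPow]

theorem ev_X (u : Fin n → Aˣ) (i : Fin n) : ev u (var i) = u i := by
  rw [var, ev_mono, Finset.prod_eq_single i] <;> simp +contextual

theorem ev_apply (u : Fin n → Aˣ) (p : LaurentPoly n) :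
    ev u p = ∑ k ∈ p.coeff.support, p.coeff k • ((∏ i, u i ^ k i : Aˣ) : A) := by
  rw [ev, AddMonoidAlgebra.lift_apply, Finsupp.sum]
  rfl

theorem map_ev {B : Type*} [CommRing B] [Algebra ℂ B] (φ : A →ₐ[ℂ] B) (u : Fin n → Aˣ)
    (p : LaurentPoly n) :
    φ (ev u p) = ev (fun i => Units.map (φ : A →* B) (u i)) p := by
  simp only [ev_apply, map_sum, map_smul]
  refine Finset.sum_congr rfl fun k _ => ?_
  congr 1
  push_cast
  simp [map_prod, ← map_zpow]

/-- The chain rule for the evaluation of Laurent polynomials. -/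
theorem derivation_ev (d : Derivation ℂ A A) (u : Fin n → Aˣ) (p : LaurentPoly n) :
    d (ev u p) = ∑ i, ev u (euler i p) * (((u i)⁻¹ : Aˣ) : A) * d (u i) := by
  have hz : ∀ (x : Aˣ) (m : ℤ), d ((x ^ m : Aˣ) : A) =
      (m : A) * ((x ^ m : Aˣ) : A) * ((x⁻¹ : Aˣ) : A) * d x := by
    have hnat : ∀ (x : Aˣ) (m : ℕ), d ((x ^ m : Aˣ) : A) =
        (m : A) * ((x ^ m : Aˣ) : A) * ((x⁻¹ : Aˣ) : A) * d x := by
      intro x m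
      induction m with
      | zero => simp
      | succ m ih =>
        rw [pow_succ, Units.val_mul, d.leibniz, ih]
        push_cast
        simp only [smul_eq_mul]
        linear_combination (-(x : A) ^ m * d x) * x.mul_inv
    have hinv : ∀ x : Aˣ, d ((x⁻¹ : Aˣ) : A) = -((x⁻¹ : Aˣ) : A) ^ 2 * d x := by
      intro x
      have h := congrArg d x.mul_inv
      rw [d.leibniz, d.map_one_eq_zero] at h
      simp only [smul_eq_mul] at h
      linear_combination ((x⁻¹ : Aˣ) : A) * h - d ((x⁻¹ : Aˣ) : A) * x.mul_inv
    intro x m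
    obtain ⟨m, rfl | rfl⟩ := m.eq_nat_or_neg
    · simpa using hnat x m
    · have h1 := hnat x⁻¹ m
      rw [inv_inv, hinv] at h1
      rw [zpow_neg, ← inv_zpow, zpow_natCast, h1]
      push_cast
      linear_combination (-(m : A) * ((x⁻¹ : Aˣ) : A) ^ m * ((x⁻¹ : Aˣ) : A) * d x) * x.mul_inv
  have hprod : ∀ (a : Fin n → ℤ) (s : Finset (Fin n)), d ((∏ i ∈ s, u i ^ a i : Aˣ) : A) =
      ∑ i ∈ s, (a i : A) * ((∏ i ∈ s, u i ^ a i : Aˣ) : A) * (((u i)⁻¹ : Aˣ) : A) * d (u i) := by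
    intro a s
    induction s using Finset.induction_on with
    | empty => simp
    | insert i s hi ih =>
      rw [Finset.prod_insert hi, Units.val_mul, d.leibniz, ih, hz, Finset.sum_insert hi]
      simp only [smul_eq_mul, Finset.mul_sum]
      rw [add_comm]
      congr 1
      · ring
      · exact Finset.sum_congr rfl fun j _ => by ring
  induction p using induction_mono with
  | zero => simp
  | add p p' hp hp' => simp only [map_add, hp, hp', add_mul, Finset.sum_add_distrib]
  | mono a r =>
    simp only [map_smul, Derivation.map_smul, euler_mono, ev_mono, hprod]
    rw [Finset.smul_sum]
    refine Finset.sum_congr rfl fun i _ => ?_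
    simp only [Algebra.smul_def, map_intCast]
    ring

/-- The variable `x_i`, as a unit. -/
def varU (i : Fin n) : (LaurentPoly n)ˣ where
  val := var i
  inv := mono (-Pi.single i 1)
  val_inv := X_mul_mono_neg i
  inv_val := by rw [mul_comm, X_mul_mono_neg]

theorem coe_varU_zpow (i : Fin n) (m : ℤ) :
    ((varU i ^ m : (LaurentPoly n)ˣ) : LaurentPoly n) = mono (Pi.single i m) := by
  have hnat : ∀ (m : ℕ) (e : ℤ) (x : (LaurentPoly n)ˣ), (x : LaurentPoly n) = mono (Pi.single i e) →
      ((x ^ m : (LaurentPoly n)ˣ) : LaurentPoly n) = mono (Pi.single i (m * e)) := by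
    intro m e x hx
    rw [Units.val_pow_eq_pow_val, hx, ← mono_nsmul, ← Pi.single_smul, nsmul_eq_mul]
  obtain ⟨m, rfl | rfl⟩ := m.eq_nat_or_neg
  · rw [zpow_natCast, hnat m 1 _ rfl, mul_one]
  · rw [zpow_neg, ← inv_zpow, zpow_natCast, hnat m (-1) _ (by rw [Pi.single_neg]; rfl)]
    simp

theorem ev_varU (p : LaurentPoly n) : ev varU p = p := by
  induction p using induction_mono with
  | zero => exact map_zero _
  | add p q hp hq => rw [map_add, hp, hq]
  | mono a r =>
    rw [map_smul, ev_mono, Units.coe_prod]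
    simp only [coe_varU_zpow]
    congr 1
    have : ∀ s : Finset (Fin n), ∏ i ∈ s, mono (Pi.single i (a i)) =
        mono (∑ i ∈ s, Pi.single i (a i)) := by
      intro s
      induction s using Finset.induction_on with
      | empty => simp [mono_zero]
      | insert i s hi ih => rw [Finset.prod_insert hi, Finset.sum_insert hi, ih, mono_mul_mono]
    rw [this, Finset.univ_sum_single]

end LaurentPoly

/-! ### Division of formal series by products of differences -/

theorem hasSum_congr' {I : Type*} {f g : I → ℂ} {a : ℂ} (h : HasSum f a) (e : ∀ k, g k = f k) :
    HasSum g a := by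
  rwa [funext e]

theorem hasSum_mul_prod {I J : Type*} {f : I → ℂ} {g : J → ℂ} {a b : ℂ} (hf : HasSum f a)
    (hg : HasSum g b) : HasSum (fun p : I × J => f p.1 * g p.2) (a * b) :=
  hf.mul hg (summable_mul_of_summable_norm hf.summable.norm hg.summable.norm)

/-- If `c - c ∘ τ = d` and the weights satisfy `m = u • m ∘ τ`, then summing a geometric series
recovers `∑ c m` from `∑ d m`. -/
theorem hasSum_of_sub_shift {I : Type*} (τ : Equiv.Perm I) {c d m : I → ℂ} {u S : ℂ} (hu : ‖u‖ < 1)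
    (hd : ∀ k, d k = c k - c (τ k)) (hm : ∀ k, m k = m (τ k) * u)
    (hc : ∀ k, ∃ r₀ : ℕ, ∀ r ≥ r₀, c ((τ ^ r) k) = 0) (h : HasSum (fun k => d k * m k) S) :
    HasSum (fun k => c k * m k) (S * (1 - u)⁻¹) := by
  have hgeo := hasSum_geometric_of_norm_lt_one hu
  have hprod : HasSum (fun p : ℕ × I => u ^ p.1 * (d p.2 * m p.2)) ((1 - u)⁻¹ * S) :=
    hasSum_mul_prod (f := fun r => u ^ r) (g := fun k => d k * m k) hgeo h
  have hpow : ∀ (r : ℕ) k, m k = m ((τ ^ r) k) * u ^ r := by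
    intro r
    induction r with
    | zero => simp
    | succ r ih =>
      intro k
      rw [pow_succ', Equiv.Perm.mul_apply, ih k, hm ((τ ^ r) k)]
      ring
  -- sum over the pairs `(k, r)`, reindexed so that the sum over `r` telescopes for fixed `k`
  have hsw : HasSum (fun z : I × ℕ => u ^ z.2 * (d ((τ ^ z.2) z.1) * m ((τ ^ z.2) z.1)))
      ((1 - u)⁻¹ * S) := by
    refine hasSum_congr' (((Equiv.prodComm I ℕ).trans
      (Equiv.prodShear (Equiv.refl ℕ) fun r => τ ^ r)).hasSum_iff.mpr hprod) ?_
    rintro ⟨k, r⟩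
    simp
  rw [mul_comm S]
  refine hsw.prod_fiberwise fun k => ?_
  obtain ⟨r₀, hr₀⟩ := hc k
  have htel : ∀ r : ℕ, ∑ s ∈ Finset.range r, d ((τ ^ s) k) = c k - c ((τ ^ r) k) := by
    intro r
    induction r with
    | zero => simp
    | succ r ih =>
      rw [Finset.sum_range_succ, ih, hd, pow_succ', Equiv.Perm.mul_apply]
      ring
  have hfin : HasSum (fun r : ℕ => d ((τ ^ r) k) * m k) (∑ r ∈ Finset.range r₀, d ((τ ^ r) k) * m k) := by
    refine hasSum_sum_of_ne_finset_zero fun r hr => ?_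
    have hr' : r₀ ≤ r := by simpa using hr
    rw [hd, ← Equiv.Perm.mul_apply τ, ← pow_succ', hr₀ r hr', hr₀ (r + 1) (by omega)]
    simp
  rw [← Finset.sum_mul, htel, hr₀ r₀ le_rfl, sub_zero] at hfin
  refine hasSum_congr' hfin fun r => ?_
  rw [hpow r k]
  ring

namespace LaurentPoly

variable {n : ℕ}

/-- Formal series whose coefficients vanish eventually in the directions `x_i / x_j` with `i < j`.
Such a series is determined by its product with `x_i - x_j`, the quotient being expanded in powers
of `x_j / x_i`. -/
def Truncated (c : (Fin n → ℤ) → ℂ) : Prop :=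
  ∀ i j : Fin n, i < j → ∀ k, ∃ r₀ : ℕ, ∀ r : ℕ, r₀ ≤ r →
    c (k + r • (Pi.single i 1 - Pi.single j 1)) = 0

theorem Truncated.act {c : (Fin n → ℤ) → ℂ} (hc : Truncated c) (p : LaurentPoly n) :
    Truncated (act p c) := by
  intro i j hij k
  choose r₀ hr₀ using fun a => hc i j hij (k - a)
  refine ⟨p.coeff.support.sup r₀, fun r hr => ?_⟩
  rw [act_apply]
  refine Finset.sum_eq_zero fun a ha => ?_
  rw [add_sub_right_comm, hr₀ a r ((Finset.le_sup ha).trans hr), mul_zero]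

/-- `p`, with the value `e` at `x`, can be divided out of convergent series in the monomials `x^k`
and in further variables, whose monomials have the values `g`: if `p c` converges, so does `c`. -/
def DividesAt {κ : Type*} (g : κ → ℂ) (x : Fin n → ℂ) (p : LaurentPoly n) (e : ℂ) : Prop :=
  ∀ (c : κ → (Fin n → ℤ) → ℂ), (∀ q, Truncated (c q)) → ∀ S,
    HasSum (fun z : (Fin n → ℤ) × κ => act p (c z.2) z.1 * ((∏ i, x i ^ z.1 i) * g z.2)) S →
    HasSum (fun z : (Fin n → ℤ) × κ => c z.2 z.1 * ((∏ i, x i ^ z.1 i) * g z.2)) (S * e⁻¹)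

theorem DividesAt.one {κ : Type*} (g : κ → ℂ) (x : Fin n → ℂ) : DividesAt g x 1 1 := by
  intro c _ S h
  simpa using h

theorem DividesAt.mul {κ : Type*} {g : κ → ℂ} {x : Fin n → ℂ} {p q : LaurentPoly n} {e f : ℂ}
    (hp : DividesAt g x p e) (hq : DividesAt g x q f) : DividesAt g x (p * q) (e * f) := by
  intro c hc S h
  rw [mul_inv, ← mul_assoc]
  refine hq c hc _ (hp (fun r => act q (c r)) (fun r => (hc r).act q) S ?_)
  simpa using h

theorem DividesAt.pow {κ : Type*} {g : κ → ℂ} {x : Fin n → ℂ} {p : LaurentPoly n} {e : ℂ}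
    (hp : DividesAt g x p e) (K : ℕ) : DividesAt g x (p ^ K) (e ^ K) := by
  induction K with
  | zero => simpa using DividesAt.one g x
  | succ K ih => rw [pow_succ, pow_succ]; exact ih.mul hp

theorem DividesAt.neg {κ : Type*} {g : κ → ℂ} {x : Fin n → ℂ} {p : LaurentPoly n} {e : ℂ}
    (hp : DividesAt g x p e) : DividesAt g x (-p) (-e) := by
  intro c hc S h
  have := hp c hc (-S) (by simpa using h.neg)
  simpa [inv_neg] using this

theorem DividesAt.prod {κ ι : Type*} {g : κ → ℂ} {x : Fin n → ℂ} {s : Finset ι}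
    {p : ι → LaurentPoly n} {e : ι → ℂ} (hp : ∀ i ∈ s, DividesAt g x (p i) (e i)) :
    DividesAt g x (∏ i ∈ s, p i) (∏ i ∈ s, e i) := by
  classical
  induction s using Finset.induction_on with
  | empty => simpa using DividesAt.one g x
  | insert i s hi ih =>
    rw [Finset.prod_insert hi, Finset.prod_insert hi]
    exact (hp i (by simp)).mul (ih fun j hj => hp j (by simp [hj]))

theorem prod_zpow_add_single {x : Fin n → ℂ} {i : Fin n} (hx : x i ≠ 0) (k : Fin n → ℤ) (m : ℤ) :
    ∏ l, x l ^ (k + Pi.single i m : Fin n → ℤ) l = (∏ l, x l ^ k l) * x i ^ m := by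
  have : ∀ l, x l ^ (k + Pi.single i m : Fin n → ℤ) l = x l ^ k l * (if l = i then x i ^ m else 1) := by
    intro l
    by_cases h : l = i
    · subst h; simp [zpow_add₀ hx]
    · simp [h]
  rw [Finset.prod_congr rfl fun l _ => this l, Finset.prod_mul_distrib]
  simp

theorem dividesAt_sub {κ : Type*} (g : κ → ℂ) {x : Fin n → ℂ} (hx : ∀ i, x i ≠ 0)
    (hanti : StrictAnti fun i => ‖x i‖) {i j : Fin n} (hij : i < j) :
    DividesAt g x (var i - var j) (x i - x j) := by
  intro c hc S h
  have hu : ‖x j / x i‖ < 1 := by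
    rw [norm_div, div_lt_one (norm_pos_iff.mpr (hx i))]
    exact hanti hij
  -- the weights of the shifted series
  have h1 := ((Equiv.prodCongr (Equiv.addRight (Pi.single i 1 : Fin n → ℤ))
    (Equiv.refl κ)).hasSum_iff.mpr h).mul_left (x i)⁻¹
  have h2 := hasSum_of_sub_shift
    (Equiv.prodCongr (Equiv.addRight (Pi.single i 1 - Pi.single j 1 : Fin n → ℤ)) (Equiv.refl κ))
    (c := fun z => c z.2 z.1) (m := fun z => (∏ l, x l ^ z.1 l) * g z.2)
    (d := fun z => act (var i - var j) (c z.2) (z.1 + Pi.single i 1)) hu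
    ?_ ?_ ?_ (S := (x i)⁻¹ * S) ?_
  · convert h2 using 1
    have : x i - x j ≠ 0 := sub_ne_zero.mpr fun h => by
      have := hanti hij; simp [h] at this
    have h3 : 1 - x j / x i ≠ 0 := by
      rw [← div_self (hx i), ← sub_div]; exact div_ne_zero this (hx i)
    have e : (x i - x j)⁻¹ = (x i)⁻¹ * (1 - x j / x i)⁻¹ := by
      rw [← mul_inv, mul_sub, mul_one, mul_div_cancel₀ _ (hx i)]
    rw [e]; ring
  · rintro ⟨k, q⟩
    simp only [map_sub, LinearMap.sub_apply, Pi.sub_apply, act_X, Equiv.prodCongr_apply,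
      Equiv.coe_addRight, Equiv.refl_apply, Prod.map_apply]
    congr 2 <;> abel
  · rintro ⟨k, q⟩
    simp only [Equiv.prodCongr_apply, Equiv.coe_addRight, Equiv.refl_apply, Prod.map_apply]
    rw [show k + (Pi.single i 1 - Pi.single j 1) = (k + Pi.single i 1) + Pi.single j (-1) by
      rw [Pi.single_neg]; abel]
    rw [prod_zpow_add_single (hx j), prod_zpow_add_single (hx i), zpow_one, zpow_neg_one]
    have := hx i
    have := hx j
    field_simp
  · rintro ⟨k, q⟩
    obtain ⟨r₀, hr₀⟩ := hc q i j hij k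
    refine ⟨r₀, fun r hr => ?_⟩
    have : ∀ r : ℕ, ((Equiv.prodCongr (Equiv.addRight (Pi.single i 1 - Pi.single j 1 : Fin n → ℤ))
        (Equiv.refl κ)) ^ r) (k, q) = (k + r • (Pi.single i 1 - Pi.single j 1), q) := by
      intro r
      induction r with
      | zero => simp
      | succ r ih =>
        rw [pow_succ', Equiv.Perm.mul_apply, ih]
        simp [add_smul, add_assoc]
    rw [this]
    exact hr₀ r hr
  · rw [mul_comm]
    rw [mul_comm] at h1
    refine hasSum_congr' h1 ?_
    rintro ⟨k, q⟩
    simp only [Function.comp_apply, Equiv.prodCongr_apply, Equiv.coe_addRight, Equiv.refl_apply,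
      Prod.map_apply]
    rw [prod_zpow_add_single (hx i), zpow_one]
    have := hx i
    field_simp

/-! ### The discriminant -/

/-- The product of the `(x_i - x_j)^K` over all ordered pairs `i ≠ j`. -/
def discr (n K : ℕ) : LaurentPoly n := ∏ i, ∏ j ∈ Finset.univ.erase i, (var i - var j) ^ K

/-- The value of the discriminant at a point. -/
def discrAt {A : Type*} [CommRing A] (K : ℕ) (x : Fin n → A) : A :=
  ∏ i, ∏ j ∈ Finset.univ.erase i, (x i - x j) ^ K

theorem discrAt_ne_zero (K : ℕ) {x : Fin n → ℂ} (hx : Function.Injective x) :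
    discrAt K x ≠ 0 := by
  refine Finset.prod_ne_zero_iff.mpr fun i _ => Finset.prod_ne_zero_iff.mpr fun j hj => ?_
  exact pow_ne_zero _ (sub_ne_zero.mpr fun h => (Finset.ne_of_mem_erase hj) (hx h).symm)

theorem dividesAt_discr {κ : Type*} (g : κ → ℂ) {x : Fin n → ℂ} (hx : ∀ i, x i ≠ 0)
    (hanti : StrictAnti fun i => ‖x i‖) (K : ℕ) :
    DividesAt g x (discr n K) (discrAt K x) := by
  refine DividesAt.prod fun i _ => DividesAt.prod fun j hj => DividesAt.pow ?_ K
  rcases lt_or_gt_of_ne (Finset.ne_of_mem_erase hj) with h | h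
  · rw [← neg_sub (var j), ← neg_sub (x j)]
    exact (dividesAt_sub g hx hanti h).neg
  · exact dividesAt_sub g hx hanti h

theorem derivation_prod_eigen {R ι : Type*} [CommRing R] [Algebra ℂ R] (D : Derivation ℂ R R)
    (s : Finset ι) {f c : ι → R} (h : ∀ i ∈ s, D (f i) = c i * f i) :
    D (∏ i ∈ s, f i) = (∑ i ∈ s, c i) * ∏ i ∈ s, f i := by
  classical
  induction s using Finset.induction_on with
  | empty => simp
  | insert i s hi ih =>
    rw [Finset.prod_insert hi, D.leibniz, ih fun j hj => h j (by simp [hj]), h i (by simp),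
      Finset.sum_insert hi]
    simp only [smul_eq_mul]
    ring

theorem derivation_pow_eigen {R : Type*} [CommRing R] [Algebra ℂ R] (D : Derivation ℂ R R)
    {f c : R} (h : D f = c * f) (K : ℕ) : D (f ^ K) = ((K : R) * c) * f ^ K := by
  have := derivation_prod_eigen D (Finset.range K) (f := fun _ => f) (c := fun _ => c) fun _ _ => h
  simpa using this

/-- A derivation acting on the differences by scalars acts on the discriminant by a scalar. -/
theorem derivation_discr (D : Derivation ℂ (LaurentPoly n) (LaurentPoly n)) (K : ℕ)
    {c : Fin n → Fin n → LaurentPoly n} (h : ∀ i j, D (var i - var j) = c i j * (var i - var j)) :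
    D (discr n K) = (∑ i, ∑ j ∈ Finset.univ.erase i, (K : LaurentPoly n) * c i j) * discr n K :=
  derivation_prod_eigen D _ fun i _ => derivation_prod_eigen D _ fun j _ =>
    derivation_pow_eigen D (h i j) K

/-- The vector field `∑ x_i^m (x_i ∂/∂x_i)`. -/
def field (m : ℤ) : Derivation ℂ (LaurentPoly n) (LaurentPoly n) :=
  ∑ i, mono (Pi.single i m) • euler i

theorem field_apply (m : ℤ) (p : LaurentPoly n) :
    field m p = ∑ i, mono (Pi.single i m) * euler i p := by
  have : ∀ s : Finset (Fin n), (∑ i ∈ s, mono (Pi.single i m) • euler i) p =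
      ∑ i ∈ s, mono (Pi.single i m) * euler i p := by
    intro s
    induction s using Finset.induction_on with
    | empty => simp
    | insert i s hi ih => rw [Finset.sum_insert hi, Finset.sum_insert hi, ← ih]; rfl
  exact this _

theorem field_X (m : ℤ) (j : Fin n) : field m (var j) = mono (Pi.single j m) * var j := by
  simp [field_apply, euler_X]

/-- The discriminant is relatively invariant under the vector fields of the projective group of
the line: `∑ x_i² ∂/∂x_i` in this lemma, `∑ x_i ∂/∂x_i` and `∑ ∂/∂x_i` in the next two. -/
theorem field_discr_one (K : ℕ) :
    field 1 (discr n K) = (2 * K * ((n : ℂ) - 1)) • ((∑ i, var i) * discr n K) := by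
  rw [derivation_discr (field 1) K (c := fun i j => var i + var j)]
  · have h1 : ∀ i : Fin n, ∑ j ∈ Finset.univ.erase i, (K : LaurentPoly n) * (var i + var j) =
        (K : LaurentPoly n) * (((n : LaurentPoly n) - 2) * var i + ∑ j, var j) := by
      intro i
      rw [← Finset.mul_sum, Finset.sum_erase_eq_sub (Finset.mem_univ i), Finset.sum_add_distrib,
        Finset.sum_const, Finset.card_univ, Fintype.card_fin, nsmul_eq_mul]
      ring
    rw [Finset.sum_congr rfl fun i _ => h1 i, ← Finset.mul_sum, Finset.sum_add_distrib,
      ← Finset.mul_sum, Finset.sum_const, Finset.card_univ, Fintype.card_fin, nsmul_eq_mul]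
    simp only [Algebra.smul_def, map_mul, map_sub, map_natCast, map_one, map_ofNat]
    ring
  · intro i j
    rw [map_sub, field_X, field_X, ← var, ← var]
    ring

theorem field_discr_zero (K : ℕ) :
    field 0 (discr n K) = (n * K * ((n : ℂ) - 1)) • discr n K := by
  rw [derivation_discr (field 0) K (c := fun i j => 1)]
  · have h1 : ∀ i : Fin n, ∑ j ∈ Finset.univ.erase i, (K : LaurentPoly n) * 1 =
        (K : LaurentPoly n) * ((n : LaurentPoly n) - 1) := by
      intro i
      rw [← Finset.mul_sum, Finset.sum_erase_eq_sub (Finset.mem_univ i), Finset.sum_const,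
        Finset.card_univ, Fintype.card_fin, nsmul_eq_mul, mul_one]
    rw [Finset.sum_congr rfl fun i _ => h1 i, Finset.sum_const, Finset.card_univ, Fintype.card_fin,
      nsmul_eq_mul]
    simp only [Algebra.smul_def, map_mul, map_sub, map_natCast, map_one]
    ring
  · intro i j
    rw [map_sub, field_X, field_X]
    simp [mono_zero]

theorem field_discr_neg_one (K : ℕ) : field (-1) (discr n K) = 0 := by
  rw [derivation_discr (field (-1)) K (c := fun i j => 0)]
  · simp
  · intro i j
    rw [map_sub, field_X, field_X]
    have : ∀ i : Fin n, mono (Pi.single i (-1)) * var i = 1 := fun i => by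
      rw [mul_comm, Pi.single_neg, X_mul_mono_neg]
    simp [this]

end LaurentPoly

/-! ### Rationality of products of mutually local fields -/

namespace LaurentPoly

variable {n : ℕ} {U : Type*} [AddCommGroup U] [Module ℂ U]

/-- The coefficient of `x^k` in the product of the fields `A_i(x_i)`, in the order of the list. -/
def opList (A : Fin n → ℤ → Module.End ℂ U) (l : List (Fin n)) (k : Fin n → ℤ) : Module.End ℂ U :=
  (l.map fun i => A i (k i)).prod

/-- The formal series `φ(A_{i_1}(x_{i_1}) ⋯ A_{i_r}(x_{i_r}) g)`. -/
def corr (A : Fin n → ℤ → Module.End ℂ U) (φ : U →ₗ[ℂ] ℂ) (g : U) (l : List (Fin n))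
    (k : Fin n → ℤ) : ℂ := φ (opList A l k g)

/-- Mutual locality: `(x - y)^K [A_i(x), A_j(y)] = 0` for `i ≠ j`, in components. -/
def IsLocal (A : Fin n → ℤ → Module.End ℂ U) (K : ℕ) : Prop :=
  ∀ i j, i ≠ j → ∀ p q : ℤ,
    ∑ m ∈ Finset.range (K + 1), ((-1 : ℂ) ^ (K - m) * (K.choose m : ℂ)) •
        (A i (p - m) * A j (q - (K - m : ℕ))) =
      ∑ m ∈ Finset.range (K + 1), ((-1 : ℂ) ^ (K - m) * (K.choose m : ℂ)) •
        (A j (q - (K - m : ℕ)) * A i (p - m))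

theorem opList_congr (A : Fin n → ℤ → Module.End ℂ U) {l : List (Fin n)} {k k' : Fin n → ℤ}
    (h : ∀ i ∈ l, k i = k' i) : opList A l k = opList A l k' := by
  rw [opList, opList]
  congr 1
  exact List.map_congr_left fun i hi => by rw [h i hi]

theorem act_X_sub_X_pow {i j : Fin n} (K : ℕ) (f : (Fin n → ℤ) → ℂ) (k : Fin n → ℤ) :
    act ((var i - var j) ^ K) f k = ∑ m ∈ Finset.range (K + 1),
      ((-1 : ℂ) ^ (K - m) * (K.choose m : ℂ)) *
        f (k - (Pi.single i (m : ℤ) + Pi.single j ((K - m : ℕ) : ℤ))) := by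
  have h : (var i - var j) ^ K = ∑ m ∈ Finset.range (K + 1), ((-1 : ℂ) ^ (K - m) * (K.choose m : ℂ)) •
      mono (Pi.single i (m : ℤ) + Pi.single j ((K - m : ℕ) : ℤ)) := by
    rw [sub_eq_add_neg, add_pow]
    refine Finset.sum_congr rfl fun m _ => ?_
    rw [neg_pow, ← mono_mul_mono]
    have e : ∀ (i : Fin n) (m : ℕ), mono (Pi.single i (m : ℤ)) = var i ^ m := fun i m => by
      rw [var, ← mono_nsmul, ← Pi.single_smul]; simp
    rw [e, e, Algebra.smul_def]
    simp only [map_mul, map_pow, map_neg, map_one, map_natCast]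
    ring
  simp [h, act_mono]

/-- After multiplication by the discriminant, neighbouring fields may be exchanged. -/
theorem IsLocal.swap {A : Fin n → ℤ → Module.End ℂ U} {K : ℕ} (hA : IsLocal A K) (φ : U →ₗ[ℂ] ℂ)
    (g : U) (l₁ l₂ : List (Fin n)) {i j : Fin n} (hn : (l₁ ++ i :: j :: l₂).Nodup) :
    act (discr n K) (corr A φ g (l₁ ++ i :: j :: l₂)) =
      act (discr n K) (corr A φ g (l₁ ++ j :: i :: l₂)) := by
  rw [List.nodup_append'] at hn
  obtain ⟨_, h2, h3⟩ := hn
  rw [List.nodup_cons, List.nodup_cons] at h2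
  have hij : i ≠ j := fun h => h2.1 (by simp [h])
  have hi1 : i ∉ l₁ := fun h => h3 h (by simp)
  have hj1 : j ∉ l₁ := fun h => h3 h (by simp)
  have hi2 : i ∉ l₂ := fun h => h2.1 (by simp [h])
  have hj2 : j ∉ l₂ := h2.2.1
  have hdvd : (var i - var j) ^ K ∣ discr n K :=
    (Finset.dvd_prod_of_mem (fun j => (var i - var j : LaurentPoly n) ^ K) (show j ∈ Finset.univ.erase i
      by simp [hij.symm])).trans
      (Finset.dvd_prod_of_mem (fun i => ∏ j ∈ Finset.univ.erase i, (var i - var j : LaurentPoly n) ^ K)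
        (Finset.mem_univ i))
  obtain ⟨q, hq⟩ := hdvd
  rw [hq, mul_comm, map_mul, Module.End.mul_apply, Module.End.mul_apply]
  congr 1
  funext k
  rw [act_X_sub_X_pow, act_X_sub_X_pow]
  have key : ∀ (l : List (Fin n)) (m : ℕ), i ∉ l → j ∉ l → opList A l
      (k - (Pi.single i (m : ℤ) + Pi.single j ((K - m : ℕ) : ℤ))) = opList A l k := by
    intro l m hi hj
    refine opList_congr A fun r hr => ?_
    have h1 : r ≠ i := fun h => hi (h ▸ hr)
    have h2 : r ≠ j := fun h => hj (h ▸ hr)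
    simp [h1, h2]
  have hloc := congrArg (fun T => φ ((opList A l₁ k * T * opList A l₂ k) g)) (hA i j hij (k i) (k j))
  simp only [Finset.mul_sum, Finset.sum_mul, LinearMap.sum_apply, map_sum, mul_smul_comm,
    smul_mul_assoc, LinearMap.smul_apply, map_smul, smul_eq_mul] at hloc
  convert hloc using 3 with m _ m _
  · rw [corr, opList, List.map_append, List.prod_append, List.map_cons, List.map_cons,
      List.prod_cons, List.prod_cons, ← opList, ← opList, key l₁ m hi1 hj1, key l₂ m hi2 hj2]
    simp [hij, hij.symm, mul_assoc]
  · rw [corr, opList, List.map_append, List.prod_append, List.map_cons, List.map_cons,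
      List.prod_cons, List.prod_cons, ← opList, ← opList, key l₁ m hi1 hj1, key l₂ m hi2 hj2]
    simp [hij, hij.symm, mul_assoc]

theorem IsLocal.perm {A : Fin n → ℤ → Module.End ℂ U} {K : ℕ} (hA : IsLocal A K) (φ : U →ₗ[ℂ] ℂ)
    (g : U) {l l' : List (Fin n)} (h : l.Perm l') : ∀ l₁ : List (Fin n), (l₁ ++ l).Nodup →
    act (discr n K) (corr A φ g (l₁ ++ l)) = act (discr n K) (corr A φ g (l₁ ++ l')) := by
  induction h with
  | nil => intros; rfl
  | cons a h ih =>
    intro l₁ hn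
    have := ih (l₁ ++ [a]) (by simpa using hn)
    simpa using this
  | swap a b l => exact fun l₁ hn => hA.swap φ g l₁ l hn
  | trans h1 h2 ih1 ih2 =>
    intro l₁ hn
    rw [ih1 l₁ hn]
    exact ih2 l₁ ((List.Perm.append_left l₁ h1).nodup_iff.mp hn)

/-- The lowest and highest exponents which occur in a Laurent polynomial are bounded. -/
theorem exists_exponent_bound (p : LaurentPoly n) :
    ∃ B : ℕ, ∀ a ∈ p.coeff.support, ∀ i, |a i| ≤ B := by
  refine ⟨p.coeff.support.sup fun a => Finset.univ.sup fun i => (a i).natAbs, fun a ha i => ?_⟩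
  have h1 : (a i).natAbs ≤ Finset.univ.sup fun i => (a i).natAbs :=
    Finset.le_sup (f := fun i => (a i).natAbs) (Finset.mem_univ i)
  have h2 := Finset.le_sup (f := fun a : Fin n → ℤ => Finset.univ.sup fun i => (a i).natAbs) ha
  have h3 := h1.trans h2
  rw [Int.abs_eq_natAbs]
  exact_mod_cast h3

theorem exists_of_act_ne_zero {p : LaurentPoly n} {f : (Fin n → ℤ) → ℂ} {k : Fin n → ℤ}
    (h : act p f k ≠ 0) : ∃ a ∈ p.coeff.support, f (k - a) ≠ 0 := by
  rw [act_apply] at h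
  obtain ⟨a, ha, h'⟩ := Finset.exists_ne_zero_of_sum_ne_zero h
  exact ⟨a, ha, right_ne_zero_of_mul h'⟩

/-- Rationality: as the fields can be brought into any order after multiplication by the
discriminant, every variable can be compared with both ends of the product, so that only finitely
many exponents occur. -/
theorem IsLocal.finite_support {A : Fin n → ℤ → Module.End ℂ U} {K : ℕ} (hA : IsLocal A K)
    (φ : U →ₗ[ℂ] ℂ) (g : U) (hlow : ∀ i, ∃ B : ℤ, ∀ k, k < B → A i k g = 0)
    (hup : ∀ i, ∃ B : ℤ, ∀ k, B < k → ∀ x, φ (A i k x) = 0) :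
    ∃ Q : LaurentPoly n, act (discr n K) (corr A φ g (List.finRange n)) = Q.coeff := by
  choose B hB using hlow
  choose B' hB' using hup
  obtain ⟨M, hM⟩ := exists_exponent_bound (discr n K)
  have hfin : (Function.support (act (discr n K) (corr A φ g (List.finRange n)))).Finite := by
    refine Set.Finite.subset (Set.finite_Icc (fun i => B i - M) fun i => B' i + M) fun k hk => ?_
    rw [Function.mem_support] at hk
    have hnd : (List.finRange n).Nodup := List.nodup_finRange n
    have hperm : ∀ i, (List.finRange n).Perm (i :: (List.finRange n).erase i) := fun i =>
      List.perm_cons_erase (List.mem_finRange i)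
    rw [Set.mem_Icc, Pi.le_def, Pi.le_def]
    refine ⟨fun i => ?_, fun i => ?_⟩
    -- with `A_i` at the right end, next to `g`, the exponent of `x_i` is bounded below
    · have h1 := hA.perm φ g ((hperm i).trans (List.perm_append_singleton i _).symm) [] (by simpa)
      rw [List.nil_append, List.nil_append] at h1
      rw [h1] at hk
      obtain ⟨a, ha, h2⟩ := exists_of_act_ne_zero hk
      by_contra hc
      refine h2 ?_
      have h3 := abs_le.mp (hM a ha i)
      rw [corr, opList, List.map_append, List.prod_append, List.map_singleton, List.prod_singleton,
        Module.End.mul_apply, hB i _ (by simp only [Pi.sub_apply]; omega), map_zero, map_zero]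
    -- with `A_i` at the left end, next to `φ`, the exponent of `x_i` is bounded above
    · have h1 := hA.perm φ g (hperm i) [] (by simpa)
      rw [List.nil_append, List.nil_append] at h1
      rw [h1] at hk
      obtain ⟨a, ha, h2⟩ := exists_of_act_ne_zero hk
      by_contra hc
      refine h2 ?_
      have h3 := abs_le.mp (hM a ha i)
      rw [corr, opList, List.map_cons, List.prod_cons, Module.End.mul_apply,
        hB' i _ (by simp only [Pi.sub_apply]; omega)]
  exact ⟨.ofCoeff (Finsupp.ofSupportFinite _ hfin), by ext; rfl⟩

end LaurentPoly

/-! ### Ward identities -/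

namespace LaurentPoly

variable {n : ℕ} {U : Type*} [AddCommGroup U] [Module ℂ U]

theorem field_apply_add (m : ℤ) (c : Fin n → ℂ) (q : LaurentPoly n) :
    ∑ i, mono (Pi.single i m) * (euler i q + c i • q) =
      field m q + (∑ i, c i • mono (Pi.single i m)) * q := by
  rw [field_apply, Finset.sum_mul, ← Finset.sum_add_distrib]
  refine Finset.sum_congr rfl fun i _ => ?_
  simp only [Algebra.smul_def]
  ring

/-- The multiplication by a Laurent polynomial `P`, which is an eigenvector of a vector field up
to the divergence, shifts the weights in the operator attached to the vector field. -/
theorem act_ward {P q : LaurentPoly n} {f : (Fin n → ℤ) → ℂ} (hq : act P f = q.coeff) (m : ℤ)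
    (c : Fin n → ℂ) {s : ℂ} (hP : field m P = s • ((∑ i, mono (Pi.single i m)) * P)) :
    act P (∑ i, act (mono (Pi.single i m)) (eulerF i f + c i • f)) =
      (∑ i, mono (Pi.single i m) * (euler i q + (c i - s) • q) : LaurentPoly n).coeff := by
  have h1 : ∀ i, act P (eulerF i f) = eulerF i (act P f) - act (euler i P) f := fun i => by
    rw [eulerF_act]; abel
  have h2 : ∀ i, act P (act (mono (Pi.single i m)) (eulerF i f + c i • f)) =
      act (mono (Pi.single i m)) (eulerF i (act P f) + c i • act P f)
        - act (mono (Pi.single i m) * euler i P) f := by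
    intro i
    rw [← Module.End.mul_apply, ← map_mul, mul_comm P, map_mul, Module.End.mul_apply, map_add, h1,
      map_smul, map_mul, Module.End.mul_apply, ← map_sub]
    congr 1
    abel
  have h3 : act (field m P) f = (s • ((∑ i, mono (Pi.single i m)) * q)).coeff := by
    rw [hP, map_smul, map_mul, LinearMap.smul_apply, Module.End.mul_apply, hq, act_coeff]
    rfl
  rw [map_sum, Finset.sum_congr rfl fun i _ => h2 i, Finset.sum_sub_distrib,
    ← LinearMap.sum_apply, ← map_sum, ← field_apply, h3]
  have h4 : ∀ i, act (mono (Pi.single i m)) (eulerF i (act P f) + c i • act P f) =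
      (mono (Pi.single i m) * (euler i q + c i • q)).coeff := by
    intro i
    rw [← act_coeff, hq]
    rfl
  rw [Finset.sum_congr rfl fun i _ => h4 i]
  have h5 : ∀ s : Finset (Fin n), ∑ i ∈ s, ((mono (Pi.single i m) * (euler i q + c i • q) :
      LaurentPoly n).coeff : (Fin n → ℤ) → ℂ) =
      ((∑ i ∈ s, mono (Pi.single i m) * (euler i q + c i • q) : LaurentPoly n).coeff :
        (Fin n → ℤ) → ℂ) := by
    intro s
    induction s using Finset.induction_on with
    | empty => ext; simp
    | insert i s hi ih => rw [Finset.sum_insert hi, Finset.sum_insert hi, ih]; rfl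
  have h6 : ∑ i, mono (Pi.single i m) * (euler i q + (c i - s) • q) =
      ∑ i, mono (Pi.single i m) * (euler i q + c i • q) - s • ((∑ i, mono (Pi.single i m)) * q) := by
    rw [Finset.sum_mul, Finset.smul_sum, ← Finset.sum_sub_distrib]
    refine Finset.sum_congr rfl fun i _ => ?_
    simp only [Algebra.smul_def, map_sub]
    ring
  rw [h5, h6]
  rfl

/-- The commutator of an operator with a product of fields, if its commutator with each field is
given by a vector field. -/
theorem commutator_opList {A : Fin n → ℤ → Module.End ℂ U} {D : Module.End ℂ U} (m : ℤ)
    {c : Fin n → ℂ} (h : ∀ i k, D * A i k - A i k * D = ((k - m : ℂ) + c i) • A i (k - m))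
    {l : List (Fin n)} (hl : l.Nodup) (k : Fin n → ℤ) :
    D * opList A l k - opList A l k * D =
      ∑ i ∈ l.toFinset, ((k i - m : ℂ) + c i) • opList A l (k - Pi.single i m) := by
  induction l with
  | nil => simp [opList]
  | cons a l ih =>
    rw [List.nodup_cons] at hl
    have ha : a ∉ l.toFinset := by simpa using hl.1
    rw [List.toFinset_cons, Finset.sum_insert ha]
    have e : ∀ k, opList A (a :: l) k = A a (k a) * opList A l k := fun k => by
      simp [opList]
    have e1 : opList A l (k - Pi.single a m) = opList A l k :=
      opList_congr A fun i hi => by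
        have : i ≠ a := fun h => hl.1 (h ▸ hi)
        simp [this]
    have e2 : ∀ i ∈ l.toFinset, ((k i - m : ℂ) + c i) • opList A (a :: l) (k - Pi.single i m) =
        A a (k a) * (((k i - m : ℂ) + c i) • opList A l (k - Pi.single i m)) := by
      intro i hi
      have : a ≠ i := fun h => ha (h ▸ hi)
      rw [e, mul_smul_comm]
      simp [this]
    rw [Finset.sum_congr rfl e2, ← Finset.mul_sum, ← ih hl.2, e, e, e1]
    have h1 := h a (k a)
    have : (k - Pi.single a m : Fin n → ℤ) a = k a - m := by simp
    rw [this, ← smul_mul_assoc, ← h1]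
    noncomm_ring

end LaurentPoly

open LaurentPoly

/-- Two modules of the Lie algebra `sl₂` (spanned by `E = L(1)`, `F = L(-1)` and `H = L(0)`) which
are paired in a contragredient way, with mutually local fields `A_i(x) = ∑ A_i(k) x^k` on the first
one which are quasiprimary of weight `wt i`. The fields are truncated below on each vector of the
first module, and above on its pairing with each vector of the second one. -/
structure QuasiprimaryFields (n : ℕ) (U W : Type*) [AddCommGroup U] [Module ℂ U] [AddCommGroup W]
    [Module ℂ W] where
  /-- the contragredient pairing -/
  pair : U →ₗ[ℂ] W →ₗ[ℂ] ℂ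
  EU : Module.End ℂ U
  FU : Module.End ℂ U
  HU : Module.End ℂ U
  EW : Module.End ℂ W
  FW : Module.End ℂ W
  HW : Module.End ℂ W
  pair_E : ∀ g w, pair (EU g) w = pair g (FW w)
  pair_F : ∀ g w, pair (FU g) w = pair g (EW w)
  pair_H : ∀ g w, pair (HU g) w = pair g (HW w)
  EFU : EU * FU - FU * EU = (2 : ℂ) • HU
  HEU : HU * EU - EU * HU = -EU
  HFU : HU * FU - FU * HU = FU
  EFW : EW * FW - FW * EW = (2 : ℂ) • HW
  HEW : HW * EW - EW * HW = -EW
  HFW : HW * FW - FW * HW = FW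
  /-- the coefficients of the fields -/
  A : Fin n → ℤ → Module.End ℂ U
  /-- the conformal weights -/
  wt : Fin n → ℕ
  EA : ∀ i k, EU * A i k - A i k * EU = ((k : ℂ) - 1 + 2 * wt i) • A i (k - 1)
  HA : ∀ i k, HU * A i k - A i k * HU = ((k : ℂ) + wt i) • A i k
  FA : ∀ i k, FU * A i k - A i k * FU = ((k : ℂ) + 1) • A i (k + 1)
  /-- the order of locality -/
  K : ℕ
  locality : IsLocal A K
  lower : ∀ i g, ∃ B : ℤ, ∀ k, k < B → A i k g = 0
  upper : ∀ i w, ∃ B : ℤ, ∀ k, B < k → ∀ g, pair (A i k g) w = 0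

namespace QuasiprimaryFields

variable {n : ℕ} {U W : Type*} [AddCommGroup U] [Module ℂ U] [AddCommGroup W] [Module ℂ W]
  (S : QuasiprimaryFields n U W)

/-- The formal series `⟨A_1(x_1) ⋯ A_n(x_n) g, w⟩`. -/
def corr (g : U) (w : W) (k : Fin n → ℤ) : ℂ :=
  S.pair (opList S.A (List.finRange n) k g) w

theorem corr_eq (g : U) (w : W) :
    S.corr g w = LaurentPoly.corr S.A (S.pair.flip w) g (List.finRange n) := rfl

theorem exists_poly (g : U) (w : W) :
    ∃ Q : LaurentPoly n, act (discr n S.K) (S.corr g w) = Q.coeff := by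
  rw [corr_eq]
  exact S.locality.finite_support _ _ (fun i => S.lower i g) fun i => S.upper i w

/-- The Laurent polynomial which is the product of the discriminant and of the correlation
function `⟨A_1(x_1) ⋯ A_n(x_n) g, w⟩`. -/
def poly : U →ₗ[ℂ] W →ₗ[ℂ] LaurentPoly n :=
  have inj : ∀ p q : LaurentPoly n, (p.coeff : (Fin n → ℤ) → ℂ) = q.coeff → p = q := fun p q h => by
    ext k; exact congrFun h k
  LinearMap.mk₂ ℂ (fun g w => (S.exists_poly g w).choose)
    (fun g g' w => inj _ _ (by
      rw [← (S.exists_poly (g + g') w).choose_spec]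
      have : S.corr (g + g') w = S.corr g w + S.corr g' w := by ext; simp [corr]
      rw [this, map_add]
      exact congrArg₂ (· + ·) (S.exists_poly g w).choose_spec (S.exists_poly g' w).choose_spec))
    (fun a g w => inj _ _ (by
      rw [← (S.exists_poly (a • g) w).choose_spec]
      have : S.corr (a • g) w = a • S.corr g w := by ext; simp [corr]
      rw [this, map_smul]
      exact congrArg (a • ·) (S.exists_poly g w).choose_spec))
    (fun g w w' => inj _ _ (by
      rw [← (S.exists_poly g (w + w')).choose_spec]
      have : S.corr g (w + w') = S.corr g w + S.corr g w' := by ext; simp [corr]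
      rw [this, map_add]
      exact congrArg₂ (· + ·) (S.exists_poly g w).choose_spec (S.exists_poly g w').choose_spec))
    (fun a g w => inj _ _ (by
      rw [← (S.exists_poly g (a • w)).choose_spec]
      have : S.corr g (a • w) = a • S.corr g w := by ext; simp [corr]
      rw [this, map_smul]
      exact congrArg (a • ·) (S.exists_poly g w).choose_spec))

theorem act_corr (g : U) (w : W) : act (discr n S.K) (S.corr g w) = (S.poly g w).coeff :=
  (S.exists_poly g w).choose_spec

/-- The weights `wt i - K (n - 1)` of the numerators: the discriminant, with which the correlation
function is multiplied, contributes `-K (n - 1)` to the weight in each variable. -/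
def lam (i : Fin n) : ℤ := S.wt i - S.K * ((n : ℤ) - 1)

/-- The general form of the Ward identities, for an operator `D` on `U` with adjoint `D'`. -/
theorem ward {D : Module.End ℂ U} {D' : Module.End ℂ W} (hD : ∀ g w, S.pair (D g) w = S.pair g (D' w))
    (m : ℤ) {c : Fin n → ℂ}
    (h : ∀ i k, D * S.A i k - S.A i k * D = ((k - m : ℂ) + c i) • S.A i (k - m)) {s : ℂ}
    (hP : field m (discr n S.K) = s • ((∑ i, mono (Pi.single i m)) * discr n S.K)) (g : U) (w : W) :
    S.poly g (D' w) - S.poly (D g) w =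
      ∑ i, mono (Pi.single i m) * (euler i (S.poly g w) + (c i - s) • S.poly g w) := by
  have h1 : S.corr g (D' w) - S.corr (D g) w =
      ∑ i, act (mono (Pi.single i m)) (eulerF i (S.corr g w) + c i • S.corr g w) := by
    funext k
    have h2 := congrArg (fun T => S.pair (T g) w) (commutator_opList m h (List.nodup_finRange n) k)
    simp only [LinearMap.sub_apply, Module.End.mul_apply, map_sub, hD, LinearMap.sum_apply, map_sum,
      LinearMap.smul_apply, map_smul, List.toFinset_finRange] at h2
    rw [Pi.sub_apply, corr, corr, h2, Finset.sum_apply]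
    refine Finset.sum_congr rfl fun i _ => ?_
    rw [act_mono]
    simp [eulerF, corr]
    ring
  have h3 := congrArg (act (discr n S.K)) h1
  rw [act_ward (S.act_corr g w) m c hP, map_sub, act_corr, act_corr] at h3
  ext k
  exact congrFun h3 k

theorem lam_cast (i : Fin n) : (S.lam i : ℂ) = S.wt i - S.K * ((n : ℂ) - 1) := by
  simp [lam]

/-- The Ward identity of `L(1)` on the first module, which is `L(-1)` on the second one. -/
theorem ward_E (g : U) (w : W) : S.poly g (S.FW w) - S.poly (S.EU g) w =
    ∑ i, var i * (euler i (S.poly g w) + (2 * S.lam i : ℂ) • S.poly g w) := by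
  rw [S.ward S.pair_E 1 (c := fun i => 2 * S.wt i) (s := 2 * S.K * ((n : ℂ) - 1))]
  · refine Finset.sum_congr rfl fun i _ => ?_
    rw [lam_cast, var]
    congr 3
    ring
  · intro i k
    simpa using S.EA i k
  · rw [field_discr_one]; rfl

/-- The Ward identity of `L(0)`. -/
theorem ward_H (g : U) (w : W) : S.poly g (S.HW w) - S.poly (S.HU g) w =
    ∑ i, (euler i (S.poly g w) + (S.lam i : ℂ) • S.poly g w) := by
  rw [S.ward S.pair_H 0 (c := fun i => S.wt i) (s := S.K * ((n : ℂ) - 1))]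
  · refine Finset.sum_congr rfl fun i _ => ?_
    rw [lam_cast, Pi.single_zero, mono_zero, one_mul]
  · intro i k
    simpa using S.HA i k
  · rw [field_discr_zero]
    simp only [Pi.single_zero, mono_zero, Finset.sum_const, Finset.card_univ, Fintype.card_fin,
      nsmul_eq_mul, mul_one]
    simp only [Algebra.smul_def, map_mul, map_sub, map_natCast, map_one]
    ring

/-- The Ward identity of `L(-1)` on the first module, which is `L(1)` on the second one. -/
theorem ward_F (g : U) (w : W) : S.poly g (S.EW w) - S.poly (S.FU g) w =
    ∑ i, mono (-Pi.single i 1) * euler i (S.poly g w) := by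
  rw [S.ward S.pair_F (-1) (c := fun i => 0) (s := 0)]
  · refine Finset.sum_congr rfl fun i _ => ?_
    rw [Pi.single_neg]
    simp
  · intro i k
    simpa using S.FA i k
  · rw [field_discr_neg_one, zero_smul]

/-- Homogeneity of the correlation functions. -/
theorem coeff_poly_eq_zero {g : U} {w : W} {a c : ℂ} (hg : S.HU g = a • g) (hw : S.HW w = c • w)
    {k : Fin n → ℤ} (hk : c - a ≠ ∑ i, ((k i : ℂ) + S.lam i)) : (S.poly g w).coeff k = 0 := by
  have h := congrArg (fun p : LaurentPoly n => p.coeff k) (S.ward_H g w)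
  rw [hg, hw] at h
  simp only [map_smul, LinearMap.smul_apply] at h
  have h2 : ∀ s : Finset (Fin n),
      (∑ i ∈ s, (euler i (S.poly g w) + (S.lam i : ℂ) • S.poly g w) : LaurentPoly n).coeff k =
      (∑ i ∈ s, ((k i : ℂ) + S.lam i)) * (S.poly g w).coeff k := by
    intro s
    induction s using Finset.induction_on with
    | empty => simp
    | insert i s hi ih =>
      rw [Finset.sum_insert hi, Finset.sum_insert hi, AddMonoidAlgebra.coeff_add, Finsupp.add_apply,
        ih, AddMonoidAlgebra.coeff_add, Finsupp.add_apply, coeff_euler]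
      simp
      ring
  rw [h2] at h
  by_contra hc
  refine hk (mul_right_cancel₀ hc ?_)
  rw [← h]
  simp
  ring

/-- The correlation function can be divided by differences of the variables. -/
theorem truncated_corr (g : U) (w : W) : Truncated (S.corr g w) := by
  intro i j hij k
  obtain ⟨l₁, l₂, hl⟩ := List.append_of_mem (List.mem_finRange j)
  have hsort := List.pairwise_lt_finRange n
  rw [hl, List.pairwise_append, List.pairwise_cons] at hsort
  have hi : i ∉ l₂ := fun h => absurd (hsort.2.1.1 i h) (not_lt.mpr hij.le)
  have hj : j ∉ l₂ := fun h => lt_irrefl _ (hsort.2.1.1 j h)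
  obtain ⟨B, hB⟩ := S.lower j (opList S.A l₂ k g)
  refine ⟨(k j - B + 1).toNat, fun r hr => ?_⟩
  have h1 : opList S.A l₂ (k + r • (Pi.single i 1 - Pi.single j 1)) = opList S.A l₂ k := by
    refine opList_congr S.A fun a ha => ?_
    have h1 : a ≠ i := fun h => hi (h ▸ ha)
    have h2 : a ≠ j := fun h => hj (h ▸ ha)
    simp [h1, h2]
  rw [corr, hl, opList, List.map_append, List.prod_append, List.map_cons, List.prod_cons, ← opList,
    ← opList, h1, Module.End.mul_apply, Module.End.mul_apply, hB, map_zero, map_zero,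
    LinearMap.zero_apply]
  simp [hij.ne']
  omega

end QuasiprimaryFields

/-! ### Derivations and binomial powers in rings of formal power series -/

namespace PowerSeries

variable {R : Type*} [CommRing R] [Algebra ℂ R]

/-- The coefficientwise extension of a derivation to power series. -/
def mapDeriv (d : Derivation ℂ R R) : Derivation ℂ R⟦X⟧ R⟦X⟧ :=
  Derivation.mk'
    { toFun := fun f => mk fun k => d (coeff k f)
      map_add' := fun f g => by ext; simp
      map_smul' := fun a f => by ext; simp }
    fun f g => by
      ext k
      simp only [LinearMap.coe_mk, AddHom.coe_mk, coeff_mk, map_add, smul_eq_mul, coeff_mul,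
        map_sum, Derivation.leibniz, Finset.sum_add_distrib]
      congr 1
      rw [← Finset.Nat.sum_antidiagonal_swap]
      rfl

@[simp] theorem coeff_mapDeriv (d : Derivation ℂ R R) (f : R⟦X⟧) (k : ℕ) :
    coeff k (mapDeriv d f) = d (coeff k f) :=
  coeff_mk k fun k => d (coeff k f)

theorem mapDeriv_C (d : Derivation ℂ R R) (r : R) : mapDeriv d (C r) = C (d r) := by
  ext k
  rw [coeff_mapDeriv, coeff_C, coeff_C]
  split_ifs <;> simp

theorem mapDeriv_X (d : Derivation ℂ R R) : mapDeriv d (X : R⟦X⟧) = 0 := by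
  ext k
  rw [coeff_mapDeriv, coeff_X]
  split_ifs <;> simp

variable (R) in
/-- The formal derivative, as a derivation over `ℂ`. -/
def der : Derivation ℂ R⟦X⟧ R⟦X⟧ := (derivative R).restrictScalars ℂ

theorem coeff_der (f : R⟦X⟧) (k : ℕ) : coeff k (der R f) = coeff (k + 1) f * (k + 1) :=
  coeff_derivative f k

/-- Recursion for the coefficients from the derivative. -/
theorem smul_coeff_succ (f : R⟦X⟧) (k : ℕ) : ((k : ℂ) + 1) • coeff (k + 1) f = coeff k (der R f) := by
  rw [coeff_der, Algebra.smul_def, map_add, map_natCast, map_one, mul_comm]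

theorem C_smul (a : ℂ) (r : R) : C (a • r) = a • (C r : R⟦X⟧) := by
  rw [Algebra.smul_def, Algebra.smul_def, map_mul, algebraMap_apply]

theorem der_C (r : R) : der R (C r) = 0 := derivative_C

theorem der_X : der R X = 1 := derivative_X

variable (R) in
/-- The constant coefficient, as a homomorphism of algebras over `ℂ`. -/
def constHom : R⟦X⟧ →ₐ[ℂ] R where
  __ := constantCoeff (R := R)
  commutes' r := by
    rw [algebraMap_apply]
    exact constantCoeff_C _

theorem constHom_apply (f : R⟦X⟧) : constHom R f = coeff 0 f :=
  (coeff_zero_eq_constantCoeff_apply f).symm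

theorem constHom_C (r : R) : constHom R (C r) = r := constantCoeff_C r

theorem constHom_smul_mul (a : ℂ) (r : R) {f g : R⟦X⟧} (hf : constHom R f = 1) :
    constHom R (a • (C r * f * g)) = a • (r * constHom R g) := by
  rw [map_smul, map_mul, map_mul, constHom_C, hf, mul_one]

theorem constHom_X : constHom R X = 0 := constantCoeff_X

/-- The binomial power `(1 - c X)^ν`. -/
def pw (ν : ℂ) (c : R) : R⟦X⟧ := rescale (-c) (binomialSeries R ν)

theorem coeff_pw (ν : ℂ) (c : R) (k : ℕ) :
    coeff k (pw ν c) = algebraMap ℂ R (Ring.choose ν k) * (-c) ^ k := by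
  rw [pw, coeff_rescale, binomialSeries_coeff, Algebra.smul_def, mul_one, mul_comm]

theorem pw_add (ν μ : ℂ) (c : R) : pw (ν + μ) c = pw ν c * pw μ c := by
  rw [pw, binomialSeries_add, map_mul]; rfl

theorem pw_zero (c : R) : pw 0 c = 1 := by
  rw [pw, binomialSeries_zero, map_one]

theorem pw_one (c : R) : pw 1 c = 1 - C c * X := by
  have := binomialSeries_nat (R := ℂ) (A := R) 1
  rw [Nat.cast_one] at this
  rw [pw, this, pow_one, map_add, map_one, rescale_X, map_neg]
  ring

theorem map_pw {S : Type*} [CommRing S] [Algebra ℂ S] (φ : R →ₐ[ℂ] S) (ν : ℂ) (c : R) :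
    map (φ : R →+* S) (pw ν c) = pw ν (φ c) := by
  ext k
  rw [coeff_map, coeff_pw, coeff_pw]
  simp

theorem pw_zero_right (ν : ℂ) : pw ν (0 : R) = 1 := by
  ext k
  rw [coeff_pw, coeff_one]
  rcases k with _ | k <;> simp

/-- The unit `1 - c X`. -/
def oneSub (c : R) : R⟦X⟧ˣ where
  val := pw 1 c
  inv := pw (-1) c
  val_inv := by rw [← pw_add, add_neg_cancel, pw_zero]
  inv_val := by rw [← pw_add, neg_add_cancel, pw_zero]

theorem coe_oneSub (c : R) : (oneSub c : R⟦X⟧) = 1 - C c * X := pw_one c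

theorem constHom_oneSub (c : R) : Units.map (constHom R : R⟦X⟧ →* R) (oneSub c) = 1 := by
  ext
  change constHom R (oneSub c : R⟦X⟧) = 1
  rw [coe_oneSub, map_sub, map_mul, constHom_X, mul_zero, sub_zero, map_one]

theorem succ_mul_choose (ν : ℂ) (k : ℕ) :
    ((k : ℂ) + 1) * Ring.choose ν (k + 1) = (ν - k) * Ring.choose ν k := by
  have h : ((k : ℂ) + 1) ≠ 0 := Nat.cast_add_one_ne_zero k
  rw [Ring.choose_eq_smul, Ring.choose_eq_smul, descPochhammer_succ_right, Nat.factorial_succ]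
  rw [Polynomial.smeval_mul, Polynomial.smeval_sub, Polynomial.smeval_X, Polynomial.smeval_natCast]
  push_cast
  simp only [smul_eq_mul, pow_one, pow_zero, nsmul_eq_mul, mul_one]
  field_simp

/-- The differential equation of a binomial power. -/
theorem oneSub_mul_der_pw (ν : ℂ) (c : R) :
    (1 - C c * X) * der R (pw ν c) = algebraMap ℂ _ ν * (der R (1 - C c * X) * pw ν c) := by
  have e : der R (1 - C c * X) = -C c := by
    rw [map_sub, Derivation.map_one_eq_zero, Derivation.leibniz, der_C, der_X]
    simp
  have key : ∀ k : ℕ, ((k : R) + 1) * algebraMap ℂ R (Ring.choose ν (k + 1)) =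
      (algebraMap ℂ R ν - k) * algebraMap ℂ R (Ring.choose ν k) := fun k => by
    simpa using congrArg (algebraMap ℂ R) (succ_mul_choose ν k)
  rw [e, sub_mul, one_mul, mul_assoc (C c)]
  rw [algebraMap_apply]
  ext k
  rw [neg_mul, mul_neg, map_sub, map_neg, coeff_C_mul, coeff_C_mul, coeff_C_mul, coeff_der,
    coeff_pw,
    coeff_pw]
  rcases k with _ | k
  · rw [coeff_zero_X_mul]
    linear_combination (-c) * key 0
  · rw [coeff_succ_X_mul, coeff_der, coeff_pw, pow_succ (-c) (k + 1)]
    have := key (k + 1)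
    push_cast at this ⊢
    linear_combination (-c) * (-c) ^ (k + 1) * this

theorem oneSub_mul_mapDeriv_pw (d : Derivation ℂ R R) (ν : ℂ) (c : R) :
    (1 - C c * X) * mapDeriv d (pw ν c) =
      algebraMap ℂ _ ν * (mapDeriv d (1 - C c * X) * pw ν c) := by
  have e : mapDeriv d (1 - C c * X) = -(C (d c) * X) := by
    rw [map_sub, Derivation.map_one_eq_zero, Derivation.leibniz, mapDeriv_C, mapDeriv_X]
    simp [mul_comm]
  have key : ∀ k : ℕ, ((k : R) + 1) * algebraMap ℂ R (Ring.choose ν (k + 1)) =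
      (algebraMap ℂ R ν - k) * algebraMap ℂ R (Ring.choose ν k) := fun k => by
    simpa using congrArg (algebraMap ℂ R) (succ_mul_choose ν k)
  have hd : ∀ k : ℕ, coeff (k + 1) (mapDeriv d (pw ν c)) =
      -((k : R) + 1) * algebraMap ℂ R (Ring.choose ν (k + 1)) * ((-c) ^ k * d c) := by
    intro k
    rw [coeff_mapDeriv, coeff_pw, ← Algebra.smul_def, Derivation.map_smul, Derivation.leibniz_pow,
      map_neg, Algebra.smul_def]
    simp
    ring
  rw [e, sub_mul, one_mul, mul_assoc (C c)]
  rw [algebraMap_apply]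
  ext k
  rw [neg_mul, mul_neg, map_sub, map_neg, mul_assoc, coeff_C_mul, coeff_C_mul, coeff_C_mul]
  rcases k with _ | k
  · rw [coeff_zero_X_mul, coeff_zero_X_mul, coeff_mapDeriv, coeff_pw]
    simp
  · rw [coeff_succ_X_mul, coeff_succ_X_mul, hd, coeff_pw]
    rcases k with _ | k
    · rw [coeff_mapDeriv, coeff_pw]
      simp
    · rw [hd]
      have := key (k + 1)
      push_cast at this ⊢
      linear_combination (-(-c) ^ (k + 1) * d c) * this

end PowerSeries

/-! ### Logarithmic derivatives of units -/

section dlog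

variable {A : Type*} [CommRing A] [Algebra ℂ A]

/-- The logarithmic derivative of a unit. -/
def dlog (d : Derivation ℂ A A) (x : Aˣ) : A := ((x⁻¹ : Aˣ) : A) * d x

theorem dlog_eq_of {d : Derivation ℂ A A} {x : Aˣ} {c : A} (h : d x = c * x) : dlog d x = c := by
  rw [dlog, h, mul_left_comm, Units.inv_mul, mul_one]

theorem apply_eq_dlog_mul (d : Derivation ℂ A A) (x : Aˣ) : d x = dlog d x * x := by
  rw [dlog, mul_right_comm, Units.inv_mul, one_mul]

theorem dlog_mul (d : Derivation ℂ A A) (x y : Aˣ) : dlog d (x * y) = dlog d x + dlog d y := by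
  refine dlog_eq_of ?_
  rw [Units.val_mul, d.leibniz, apply_eq_dlog_mul d x, apply_eq_dlog_mul d y]
  simp only [smul_eq_mul]
  ring

theorem dlog_one (d : Derivation ℂ A A) : dlog d 1 = 0 := dlog_eq_of (by simp)

theorem dlog_inv (d : Derivation ℂ A A) (x : Aˣ) : dlog d x⁻¹ = -dlog d x := by
  rw [eq_neg_iff_add_eq_zero, ← dlog_mul, inv_mul_cancel, dlog_one]

theorem dlog_zpow (d : Derivation ℂ A A) (x : Aˣ) (k : ℤ) : dlog d (x ^ k) = k * dlog d x := by
  let f : Multiplicative A →* Multiplicative A := MonoidHom.id _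
  let g : Aˣ →* Multiplicative A :=
    { toFun := fun x => Multiplicative.ofAdd (dlog d x)
      map_one' := by rw [dlog_one]; rfl
      map_mul' := fun x y => by rw [dlog_mul]; rfl }
  have h := congrArg Multiplicative.toAdd (map_zpow g x k)
  rw [toAdd_zpow] at h
  simpa [g] using h

theorem dlog_prod {ι : Type*} (d : Derivation ℂ A A) (s : Finset ι) (x : ι → Aˣ) :
    dlog d (∏ i ∈ s, x i) = ∑ i ∈ s, dlog d (x i) := by
  classical
  induction s using Finset.induction_on with
  | empty => simpa using dlog_one d
  | insert i s hi ih => rw [Finset.prod_insert hi, Finset.sum_insert hi, dlog_mul, ih]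

theorem derivation_ev_dlog {n : ℕ} (d : Derivation ℂ A A) (u : Fin n → Aˣ) (p : LaurentPoly n) :
    d (LaurentPoly.ev u p) = ∑ i, LaurentPoly.ev u (LaurentPoly.euler i p) * dlog d (u i) := by
  rw [LaurentPoly.derivation_ev]
  exact Finset.sum_congr rfl fun i _ => by rw [dlog, mul_assoc]

end dlog

/-! ### Expansion of correlation functions with descendants -/

open LaurentPoly PowerSeries

namespace QuasiprimaryFields

variable {n : ℕ} {U W : Type*} [AddCommGroup U] [Module ℂ U] [AddCommGroup W] [Module ℂ W]
  (S : QuasiprimaryFields n U W)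

/-- The series `∑ t^p / p! ⟨… g, F^p w⟩`, that is `⟨… g, exp(t F) w⟩`, multiplied by the
discriminant. -/
def expF (g : U) (w : W) : (LaurentPoly n)⟦X⟧ :=
  PowerSeries.mk fun p => (p.factorial : ℂ)⁻¹ • S.poly g ((S.FW ^ p) w)

theorem inv_factorial_succ (p : ℕ) :
    ((p : ℂ) + 1) * ((p + 1).factorial : ℂ)⁻¹ = (p.factorial : ℂ)⁻¹ := by
  rw [Nat.factorial_succ, Nat.cast_mul, mul_inv, ← mul_assoc, Nat.cast_succ,
    mul_inv_cancel₀ (Nat.cast_add_one_ne_zero p), one_mul]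

theorem der_expF (g : U) (w : W) : der _ (S.expF g w) =
    PowerSeries.mk fun p => (p.factorial : ℂ)⁻¹ • S.poly g ((S.FW ^ (p + 1)) w) := by
  ext p : 1
  rw [coeff_der, expF, coeff_mk, coeff_mk, ← inv_factorial_succ p]
  simp only [Algebra.smul_def, map_mul, map_add, map_natCast, map_one]
  ring

/-- The differential equation of `expF` in the variable of the exponential. -/
theorem der_expF_eq (g : U) (w : W) : der _ (S.expF g w) =
    S.expF (S.EU g) w + mapDeriv (field 1) (S.expF g w)
      + (∑ i, (2 * S.lam i : ℂ) • C (var i)) * S.expF g w := by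
  rw [der_expF]
  ext p : 1
  rw [map_add, map_add, coeff_mapDeriv, coeff_mk]
  have e : (∑ i, (2 * S.lam i : ℂ) • C (var i) : (LaurentPoly n)⟦X⟧) =
      C (∑ i, (2 * S.lam i : ℂ) • var i) := by
    rw [map_sum]
    exact Finset.sum_congr rfl fun i _ => (C_smul _ _).symm
  rw [e, coeff_C_mul, expF, expF, coeff_mk, coeff_mk, Derivation.map_smul, mul_smul_comm,
    ← smul_add,
    ← smul_add]
  congr 1
  have h := S.ward_E g ((S.FW ^ p) w)
  rw [pow_succ', Module.End.mul_apply, add_assoc, ← sub_eq_iff_eq_add', h]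
  have h2 := field_apply_add 1 (fun i => (2 * S.lam i : ℂ)) (S.poly g ((S.FW ^ p) w))
  exact h2

/-- The units `x_i / (1 - t x_i)`. -/
def unitT (i : Fin n) : ((LaurentPoly n)⟦X⟧)ˣ :=
  Units.map (C : LaurentPoly n →+* (LaurentPoly n)⟦X⟧).toMonoidHom (varU i) * (oneSub (var i))⁻¹

/-- The unit `∏ (1 - t x_i)^(-2 λ_i)`. -/
def jacT : ((LaurentPoly n)⟦X⟧)ˣ := ∏ i, oneSub (var i) ^ (-2 * S.lam i)

/-- The vector field `∂/∂t - ∑ x_i² ∂/∂x_i`. -/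
def fieldT (n : ℕ) : Derivation ℂ (LaurentPoly n)⟦X⟧ (LaurentPoly n)⟦X⟧ :=
  der _ - mapDeriv (field 1)

theorem dlog_fieldT_oneSub (i : Fin n) : dlog (fieldT n) (oneSub (var i)) = -C (var i) := by
  refine dlog_eq_of ?_
  rw [coe_oneSub, fieldT, Derivation.sub_apply, map_sub, map_sub, Derivation.leibniz,
    Derivation.leibniz, der_C, der_X, mapDeriv_C, mapDeriv_X, field_X, ← var, Derivation.map_one_eq_zero,
    Derivation.map_one_eq_zero, map_mul]
  simp only [smul_eq_mul]
  ring

theorem dlog_fieldT_X (i : Fin n) : dlog (fieldT n)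
    (Units.map (C : LaurentPoly n →+* (LaurentPoly n)⟦X⟧).toMonoidHom (varU i)) = -C (var i) := by
  refine dlog_eq_of ?_
  change fieldT n (C (var i)) = _ * C (var i)
  rw [fieldT, Derivation.sub_apply, der_C, mapDeriv_C, field_X, ← var, map_mul]
  ring

theorem dlog_fieldT_unitT (i : Fin n) : dlog (fieldT n) (unitT i) = 0 := by
  rw [unitT, dlog_mul, dlog_inv, dlog_fieldT_oneSub, dlog_fieldT_X, add_neg_cancel]

theorem fieldT_jacT : fieldT n (S.jacT : (LaurentPoly n)⟦X⟧) =
    (∑ i, (2 * S.lam i : ℂ) • C (var i)) * S.jacT := by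
  rw [apply_eq_dlog_mul, jacT, dlog_prod]
  congr 1
  refine Finset.sum_congr rfl fun i _ => ?_
  rw [dlog_zpow, dlog_fieldT_oneSub, Algebra.smul_def]
  simp only [map_mul, map_ofNat, map_intCast]
  push_cast
  ring

theorem fieldT_ev_unitT (p : LaurentPoly n) : fieldT n (ev unitT p) = 0 := by
  rw [derivation_ev_dlog]
  exact Finset.sum_eq_zero fun i _ => by rw [dlog_fieldT_unitT, mul_zero]

/-- The explicit form of `expF`, by the flow `x ↦ x / (1 - t x)` of the vector field
`∑ x_i² ∂/∂x_i`. The sum is the exponential series of `t E` on `g`, which has to be finite. -/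
def flowT (N : ℕ) (g : U) (w : W) : (LaurentPoly n)⟦X⟧ :=
  ∑ i ∈ Finset.range N, (i.factorial : ℂ)⁻¹ •
    (PowerSeries.X ^ i * ((S.jacT : (LaurentPoly n)⟦X⟧) * ev unitT (S.poly ((S.EU ^ i) g) w)))

theorem fieldT_flowT {N : ℕ} {g : U} (hg : (S.EU ^ N) g = 0) (w : W) :
    fieldT n (S.flowT N g w) = S.flowT N (S.EU g) w
      + (∑ i, (2 * S.lam i : ℂ) • C (var i)) * S.flowT N g w := by
  have hX : ∀ i : ℕ, fieldT n (PowerSeries.X ^ i) = (i : ℂ) • PowerSeries.X ^ (i - 1) := by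
    intro i
    rw [Derivation.leibniz_pow, fieldT, Derivation.sub_apply, der_X, mapDeriv_X, sub_zero,
      smul_eq_mul, mul_one, Nat.cast_smul_eq_nsmul]
  have h1 : ∀ i : ℕ, fieldT n (PowerSeries.X ^ i *
      ((S.jacT : (LaurentPoly n)⟦X⟧) * ev unitT (S.poly ((S.EU ^ i) g) w))) =
      (i : ℂ) • (PowerSeries.X ^ (i - 1) *
        ((S.jacT : (LaurentPoly n)⟦X⟧) * ev unitT (S.poly ((S.EU ^ i) g) w))) +
      (∑ i, (2 * S.lam i : ℂ) • C (var i)) * (PowerSeries.X ^ i *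
        ((S.jacT : (LaurentPoly n)⟦X⟧) * ev unitT (S.poly ((S.EU ^ i) g) w))) := by
    intro i
    rw [Derivation.leibniz, Derivation.leibniz, fieldT_ev_unitT, hX, fieldT_jacT]
    simp only [smul_eq_mul, Algebra.smul_def]
    ring
  rw [flowT, map_sum, flowT, Finset.mul_sum]
  simp only [Derivation.map_smul, h1, smul_add, Finset.sum_add_distrib]
  congr 1
  · cases N with
    | zero => simp
    | succ N =>
      rw [Finset.sum_range_succ', Finset.sum_range_succ, ← Module.End.mul_apply _ S.EU,
        ← pow_succ, hg]
      simp only [Nat.cast_zero, zero_smul, smul_zero, add_zero, map_zero, LinearMap.zero_apply,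
        mul_zero]
      refine Finset.sum_congr rfl fun i _ => ?_
      rw [smul_smul, mul_comm, Nat.cast_succ, inv_factorial_succ, pow_succ, Module.End.mul_apply,
        Nat.add_sub_cancel]
  · exact Finset.sum_congr rfl fun i _ => by rw [mul_smul_comm]

/-- Both sides satisfy the differential equation which expresses `∂f_g/∂t` by `f_g`, its
derivatives in the `x_i`, and `f_{E g}`. The equation determines the coefficients recursively, as
`E` is nilpotent on `g`. -/
theorem expF_eq_flowT {N : ℕ} {g : U} (hg : (S.EU ^ N) g = 0) (w : W) :
    S.expF g w = S.flowT N g w := by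
  ext p : 1
  induction p using Nat.strong_induction_on generalizing g with
  | _ p ih =>
    rcases p with _ | p
    · have hev : ∀ q : LaurentPoly n, constantCoeff (ev unitT q) = q := fun q => by
        refine (map_ev (constHom (LaurentPoly n)) unitT q).trans ?_
        have h2 : (fun i => Units.map (constHom (LaurentPoly n) : (LaurentPoly n)⟦X⟧ →* LaurentPoly n) (unitT i)) =
            varU (n := n) := by
          funext i
          rw [unitT, map_mul, map_inv, constHom_oneSub, inv_one, mul_one]
          ext1
          exact constHom_C _
        rw [h2, ev_varU]
      have hj : constantCoeff (S.jacT : (LaurentPoly n)⟦X⟧) = 1 := by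
        have : Units.map (constHom (LaurentPoly n) : (LaurentPoly n)⟦X⟧ →* LaurentPoly n) S.jacT = 1 := by
          simp [jacT, constHom_oneSub]
        exact congrArg Units.val this
      cases N with
      | zero =>
        rw [pow_zero, Module.End.one_apply] at hg
        simp [flowT, expF, hg]
      | succ N =>
        rw [flowT, Finset.sum_range_succ']
        simp [expF, hev, hj]
    · have hE : (S.EU ^ N) (S.EU g) = 0 := by
        rw [← Module.End.mul_apply, ← pow_succ, pow_succ', Module.End.mul_apply, hg, map_zero]
      have h1 := ih p (Nat.lt_succ_self p) hg
      have h2 := ih p (Nat.lt_succ_self p) hE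
      have h3 := S.fieldT_flowT hg w
      rw [fieldT, Derivation.sub_apply, sub_eq_iff_eq_add] at h3
      have h4 : ((p : ℂ) + 1) • coeff (p + 1) (S.expF g w) =
          ((p : ℂ) + 1) • coeff (p + 1) (S.flowT N g w) := by
        rw [smul_coeff_succ, smul_coeff_succ, h3, der_expF_eq]
        have e : (∑ i, (2 * S.lam i : ℂ) • C (var i) : (LaurentPoly n)⟦X⟧) =
            C (∑ i, (2 * S.lam i : ℂ) • var i) := by
          rw [map_sum]
          exact Finset.sum_congr rfl fun i _ => (C_smul _ _).symm
        rw [e]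
        simp only [map_add, coeff_mapDeriv, coeff_C_mul, h1, h2]
        abel
      exact smul_right_injective _ (Nat.cast_add_one_ne_zero p : ((p : ℂ) + 1) ≠ 0) h4

end QuasiprimaryFields

namespace QuasiprimaryFields

variable {n : ℕ} {U W : Type*} [AddCommGroup U] [Module ℂ U] [AddCommGroup W] [Module ℂ W]
  (S : QuasiprimaryFields n U W)

theorem HW_EW_pow {w : W} {η : ℂ} (hw : S.HW w = η • w) (j : ℕ) :
    S.HW ((S.EW ^ j) w) = (η - j) • (S.EW ^ j) w := by
  induction j with
  | zero => simpa using hw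
  | succ j ih =>
    have h := congrArg (fun T => T ((S.EW ^ j) w)) S.HEW
    simp only [LinearMap.sub_apply, Module.End.mul_apply, LinearMap.neg_apply, ih, map_smul] at h
    rw [pow_succ', Module.End.mul_apply, sub_eq_iff_eq_add.mp h]
    push_cast
    module

theorem HW_FW_pow {w : W} {η : ℂ} (hw : S.HW w = η • w) (p : ℕ) :
    S.HW ((S.FW ^ p) w) = (η + p) • (S.FW ^ p) w := by
  induction p with
  | zero => simpa using hw
  | succ p ih =>
    have h := congrArg (fun T => T ((S.FW ^ p) w)) S.HFW
    simp only [LinearMap.sub_apply, Module.End.mul_apply, ih, map_smul] at h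
    rw [pow_succ', Module.End.mul_apply, sub_eq_iff_eq_add.mp h]
    push_cast
    module

theorem HU_EU_pow {g : U} {η : ℂ} (hg : S.HU g = η • g) (j : ℕ) :
    S.HU ((S.EU ^ j) g) = (η - j) • (S.EU ^ j) g := by
  induction j with
  | zero => simpa using hg
  | succ j ih =>
    have h := congrArg (fun T => T ((S.EU ^ j) g)) S.HEU
    simp only [LinearMap.sub_apply, Module.End.mul_apply, LinearMap.neg_apply, ih, map_smul] at h
    rw [pow_succ', Module.End.mul_apply, sub_eq_iff_eq_add.mp h]
    push_cast
    module

/-- The commutator of `E` with a power of `F` on an eigenvector of `H`. -/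
theorem EW_FW_pow {w : W} {η : ℂ} (hw : S.HW w = η • w) (p : ℕ) :
    S.EW ((S.FW ^ (p + 1)) w) = (S.FW ^ (p + 1)) (S.EW w)
      + (((p : ℂ) + 1) * (2 * η + p)) • (S.FW ^ p) w := by
  induction p with
  | zero =>
    have h := congrArg (fun T => T w) S.EFW
    simp only [LinearMap.sub_apply, Module.End.mul_apply, LinearMap.smul_apply, hw] at h
    rw [zero_add, pow_one, sub_eq_iff_eq_add'.mp h]
    simp
    module
  | succ p ih =>
    have h := congrArg (fun T => T ((S.FW ^ (p + 1)) w)) S.EFW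
    simp only [LinearMap.sub_apply, Module.End.mul_apply, LinearMap.smul_apply,
      S.HW_FW_pow hw, ih] at h
    have e1 : ∀ (p : ℕ) (v : W), S.FW ((S.FW ^ p) v) = (S.FW ^ (p + 1)) v := fun p v => by
      rw [pow_succ', Module.End.mul_apply]
    rw [← e1, sub_eq_iff_eq_add'.mp h, map_add, map_smul, e1, e1]
    push_cast
    module

/-- The vector field `-t² ∂/∂t + ∑ ∂/∂x_i`. -/
def fieldX (n : ℕ) : Derivation ℂ (LaurentPoly n)⟦X⟧ (LaurentPoly n)⟦X⟧ :=
  mapDeriv (field (-1)) - (PowerSeries.X ^ 2 : (LaurentPoly n)⟦X⟧) • der _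

theorem fieldX_apply (f : (LaurentPoly n)⟦X⟧) :
    fieldX n f = mapDeriv (field (-1)) f - PowerSeries.X ^ 2 * der _ f := rfl

theorem fieldX_X : fieldX n PowerSeries.X = -PowerSeries.X ^ 2 := by
  rw [fieldX_apply, mapDeriv_X, der_X, zero_sub, mul_one]

/-- The Ward identity of `F` for `expF`, in which the commutator of `E` with `exp(t F)` gives the
terms with `t² ∂/∂t` and `t`. -/
theorem expF_FU {w : W} {η : ℂ} (hw : S.HW w = η • w) (g : U) :
    S.expF (S.FU g) w + fieldX n (S.expF g w) = S.expF g (S.EW w)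
      + (2 * η) • (PowerSeries.X * S.expF g w) := by
  have h1 : S.expF (S.FU g) w + mapDeriv (field (-1)) (S.expF g w) =
      PowerSeries.mk fun p => (p.factorial : ℂ)⁻¹ • S.poly g (S.EW ((S.FW ^ p) w)) := by
    ext p : 1
    rw [map_add, coeff_mapDeriv, expF, expF, coeff_mk, coeff_mk, coeff_mk, Derivation.map_smul,
      ← smul_add]
    have h := S.ward_F g ((S.FW ^ p) w)
    rw [sub_eq_iff_eq_add'.mp h, field_apply]
    simp only [Pi.single_neg]
  rw [fieldX_apply, ← add_sub_assoc, h1, sub_eq_iff_eq_add]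
  ext p : 1
  rw [map_add, map_add, coeff_mk, ← mul_smul_comm, pow_succ, mul_assoc, pow_one]
  rcases p with _ | p
  · rw [coeff_zero_X_mul, coeff_zero_X_mul]
    simp [expF]
  · have h2 : coeff p (PowerSeries.X * der _ (S.expF g w)) =
        (p * (p.factorial : ℂ)⁻¹) • S.poly g ((S.FW ^ p) w) := by
      rcases p with _ | p
      · rw [coeff_zero_X_mul]; simp
      · rw [coeff_succ_X_mul, der_expF, coeff_mk, ← inv_factorial_succ p]
        push_cast
        rw [inv_factorial_succ]
    have h3 : coeff p ((2 * η) • S.expF g w) =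
        (2 * η) • (p.factorial : ℂ)⁻¹ • S.poly g ((S.FW ^ p) w) := by
      rw [Algebra.smul_def, PowerSeries.algebraMap_apply, coeff_C_mul, ← Algebra.smul_def, expF,
        coeff_mk]
    rw [coeff_succ_X_mul, coeff_succ_X_mul, h2, h3, S.EW_FW_pow hw, expF, coeff_mk, map_add,
      map_smul, ← inv_factorial_succ p]
    module

/-- The series `∑ t^(2m-j) / j! ⟨… g, exp(t F) E^j w⟩`. It is multiplied by the discriminant. For
`w` of degree `m` and `t = y₁⁻¹` it is, up to a constant, the correlation function with the adjoint
intertwiner at `y₁` of the vector `w`. -/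
def serT (m : ℕ) (w : W) (g : U) : (LaurentPoly n)⟦X⟧ :=
  ∑ j ∈ Finset.range (m + 1), (j.factorial : ℂ)⁻¹ •
    (PowerSeries.X ^ (2 * m - j) * S.expF g ((S.EW ^ j) w))

/-- The terms with `E^(j+1) w` which the Ward identity of the `j`-th summand yields cancel against
terms of the next summand, and `E^(m+1) w = 0`. -/
theorem serT_FU {m : ℕ} {w : W} {h : ℂ} (hw : S.HW w = (h + m) • w) (hE : (S.EW ^ (m + 1)) w = 0)
    (g : U) : S.serT m w (S.FU g) + fieldX n (S.serT m w g) =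
      (2 * h) • (PowerSeries.X * S.serT m w g) := by
  have key : ∀ j ∈ Finset.range (m + 1), (j.factorial : ℂ)⁻¹ •
      (PowerSeries.X ^ (2 * m - j) * S.expF (S.FU g) ((S.EW ^ j) w)) +
      fieldX n ((j.factorial : ℂ)⁻¹ • (PowerSeries.X ^ (2 * m - j) * S.expF g ((S.EW ^ j) w))) =
      (2 * h) • (PowerSeries.X * ((j.factorial : ℂ)⁻¹ •
        (PowerSeries.X ^ (2 * m - j) * S.expF g ((S.EW ^ j) w)))) +
      ((j.factorial : ℂ)⁻¹ • (PowerSeries.X ^ (2 * m - j) * S.expF g ((S.EW ^ (j + 1)) w)) -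
       (j * (j.factorial : ℂ)⁻¹) • (PowerSeries.X ^ (2 * m - j + 1) * S.expF g ((S.EW ^ j) w))) := by
    intro j hj
    have hj' : j ≤ 2 * m := by rw [Finset.mem_range] at hj; omega
    have h1 := S.expF_FU (S.HW_EW_pow hw j) g
    rw [← Module.End.mul_apply S.EW, ← pow_succ'] at h1
    have hpow : ∀ a : ℕ, fieldX n (PowerSeries.X ^ a) =
        -(algebraMap ℂ _ (a : ℂ)) * PowerSeries.X ^ (a + 1) := by
      intro a
      rw [Derivation.leibniz_pow, fieldX_X, map_natCast]
      cases a with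
      | zero => simp
      | succ a =>
        simp only [nsmul_eq_mul, smul_eq_mul, Nat.add_sub_cancel]
        ring
    rw [Derivation.map_smul, Derivation.leibniz, hpow, eq_sub_of_add_eq h1, Nat.cast_sub hj']
    simp only [smul_eq_mul]
    simp only [Algebra.smul_def, map_mul, map_sub, map_add, map_natCast, map_ofNat]
    push_cast
    ring
  rw [serT, serT, map_sum, ← Finset.sum_add_distrib, Finset.sum_congr rfl key,
    Finset.sum_add_distrib, Finset.mul_sum, Finset.smul_sum, add_eq_left, Finset.sum_sub_distrib,
    sub_eq_zero, Finset.sum_range_succ, Finset.sum_range_succ', hE]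
  have h0 : S.expF g 0 = 0 := by ext; simp [expF]
  rw [h0]
  simp only [mul_zero, smul_zero, add_zero, Nat.cast_zero, zero_mul, zero_smul]
  refine Finset.sum_congr rfl fun j hj => ?_
  rw [Nat.cast_succ, inv_factorial_succ]
  congr 3
  rw [Finset.mem_range] at hj
  omega

/-- The series `∑ y^l / l! (serT m w (F^l g))`, that is `serT` with `exp(y F) g` in place of `g`. -/
def serTY (m : ℕ) (w : W) (g : U) : (LaurentPoly n)⟦X⟧⟦X⟧ :=
  PowerSeries.mk fun l => (l.factorial : ℂ)⁻¹ • S.serT m w ((S.FU ^ l) g)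

/-- The vector field `∂/∂y - t² ∂/∂t + ∑ ∂/∂x_i`. -/
def fieldY (n : ℕ) : Derivation ℂ (LaurentPoly n)⟦X⟧⟦X⟧ (LaurentPoly n)⟦X⟧⟦X⟧ :=
  der _ + mapDeriv (fieldX n)

/-- The differential equation of `serTY` in the variable `y`. -/
theorem fieldY_serTY {m : ℕ} {w : W} {h : ℂ} (hw : S.HW w = (h + m) • w)
    (hE : (S.EW ^ (m + 1)) w = 0) (g : U) : fieldY n (S.serTY m w g) =
      (2 * h) • (C PowerSeries.X * S.serTY m w g) := by
  have h1 : ∀ l, S.serT m w ((S.FU ^ (l + 1)) g) =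
      (2 * h) • (PowerSeries.X * S.serT m w ((S.FU ^ l) g)) - fieldX n (S.serT m w ((S.FU ^ l) g)) :=
    fun l => by
      rw [pow_succ', Module.End.mul_apply]
      exact eq_sub_of_add_eq (S.serT_FU hw hE _)
  ext l : 1
  rw [fieldY, Derivation.add_apply, map_add, ← smul_coeff_succ, coeff_mapDeriv, ← smul_mul_assoc,
    ← C_smul, coeff_C_mul, serTY, coeff_mk, coeff_mk, smul_smul, inv_factorial_succ, h1,
    Derivation.map_smul]
  simp only [Algebra.smul_def]
  ring

/-- Uniqueness for the differential equation of `serTY`. -/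
theorem eq_of_fieldY {f g : (LaurentPoly n)⟦X⟧⟦X⟧} {a : (LaurentPoly n)⟦X⟧}
    (hf : fieldY n f = C a * f) (hg : fieldY n g = C a * g) (h0 : constHom _ f = constHom _ g) :
    f = g := by
  have step : ∀ f : (LaurentPoly n)⟦X⟧⟦X⟧, fieldY n f = C a * f → ∀ l : ℕ,
      ((l : ℂ) + 1) • coeff (l + 1) f = a * coeff l f - fieldX n (coeff l f) := by
    intro f hf l
    rw [smul_coeff_succ, ← coeff_C_mul, ← hf, fieldY, Derivation.add_apply, map_add, coeff_mapDeriv,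
      add_sub_cancel_right]
  ext l : 1
  induction l with
  | zero => exact (coeff_zero_eq_constantCoeff_apply f).trans (h0.trans (coeff_zero_eq_constantCoeff_apply g).symm)
  | succ l ih =>
    refine smul_right_injective _ (Nat.cast_add_one_ne_zero l : ((l : ℂ) + 1) ≠ 0) ?_
    simp only [step f hf, step g hg, ih]

/-- The units `(x_i - y) / (1 - t x_i)`. -/
def unitTY (i : Fin n) : ((LaurentPoly n)⟦X⟧⟦X⟧)ˣ :=
  Units.map (C : (LaurentPoly n)⟦X⟧ →+* (LaurentPoly n)⟦X⟧⟦X⟧).toMonoidHom (unitT i) *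
    oneSub (C (mono (-Pi.single i 1)))

theorem fieldY_C (f : (LaurentPoly n)⟦X⟧) : fieldY n (C f) = C (fieldX n f) := by
  rw [fieldY, Derivation.add_apply, der_C, mapDeriv_C, zero_add]

theorem fieldX_C (p : LaurentPoly n) : fieldX n (C p) = C (field (-1) p) := by
  rw [fieldX_apply, der_C, mapDeriv_C, mul_zero, sub_zero]

theorem field_neg_one_var (i : Fin n) : field (-1) (var i) = 1 := by
  rw [field_X, mul_comm, Pi.single_neg, X_mul_mono_neg]

theorem dlog_fieldX_oneSub (i : Fin n) : dlog (fieldX n) (oneSub (var i)) = -PowerSeries.X := by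
  refine dlog_eq_of ?_
  rw [coe_oneSub, map_sub, Derivation.map_one_eq_zero, Derivation.leibniz, fieldX_X, fieldX_C,
    field_neg_one_var, map_one]
  simp only [smul_eq_mul]
  ring

theorem dlog_map_C (d : Derivation ℂ (LaurentPoly n)⟦X⟧⟦X⟧ (LaurentPoly n)⟦X⟧⟦X⟧)
    (d' : Derivation ℂ (LaurentPoly n)⟦X⟧ (LaurentPoly n)⟦X⟧) (h : ∀ f, d (C f) = C (d' f))
    (x : ((LaurentPoly n)⟦X⟧)ˣ) : dlog d
      (Units.map (C : (LaurentPoly n)⟦X⟧ →+* (LaurentPoly n)⟦X⟧⟦X⟧).toMonoidHom x) =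
      C (dlog d' x) := by
  refine dlog_eq_of ?_
  change d (C (x : (LaurentPoly n)⟦X⟧)) = _ * C (x : (LaurentPoly n)⟦X⟧)
  rw [h, ← map_mul, ← apply_eq_dlog_mul]

theorem dlog_fieldY_unitTY (i : Fin n) : dlog (fieldY n) (unitTY i) = C PowerSeries.X := by
  have h1 : dlog (fieldX n) (unitT i) = C (mono (-Pi.single i 1)) + PowerSeries.X := by
    rw [unitT, dlog_mul, dlog_inv, dlog_fieldX_oneSub, neg_neg]
    congr 1
    refine dlog_eq_of ?_
    change fieldX n (C (var i)) = _ * C (var i)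
    rw [fieldX_C, field_neg_one_var, ← map_mul, mul_comm, X_mul_mono_neg]
  have h2 : dlog (fieldY n) (oneSub (C (mono (-Pi.single i 1)))) = -C (C (mono (-Pi.single i 1))) := by
    refine dlog_eq_of ?_
    have h3 : field (-1) (mono (-Pi.single i 1 : Fin n → ℤ)) = -mono (-Pi.single i 1) ^ 2 := by
      rw [field_apply, Finset.sum_eq_single i]
      · rw [euler_mono, Pi.single_neg, Pi.neg_apply, Pi.single_eq_same]
        simp [sq]
      · intro j _ hj
        rw [euler_mono, Pi.neg_apply, Pi.single_eq_of_ne hj]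
        simp
      · simp
    have h4 : fieldY n PowerSeries.X = 1 := by
      rw [fieldY, Derivation.add_apply, der_X, mapDeriv_X, add_zero]
    rw [coe_oneSub, map_sub, Derivation.map_one_eq_zero, Derivation.leibniz, fieldY_C, fieldX_C, h3,
      h4]
    simp only [smul_eq_mul, map_neg, map_pow]
    ring
  rw [unitTY, dlog_mul, dlog_map_C _ _ fieldY_C, h1, h2, map_add]
  ring

theorem dlog_fieldX_jacT : dlog (fieldX n) S.jacT = (2 * ∑ i, (S.lam i : ℂ)) • PowerSeries.X := by
  rw [jacT, dlog_prod, Algebra.smul_def, map_mul, map_sum, mul_assoc, Finset.sum_mul,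
    Finset.mul_sum]
  refine Finset.sum_congr rfl fun i _ => ?_
  rw [dlog_zpow, dlog_fieldX_oneSub]
  simp only [map_intCast, map_ofNat]
  push_cast
  ring

theorem fieldY_pw (ν : ℂ) : fieldY n (pw ν PowerSeries.X) =
    -ν • (C PowerSeries.X * pw ν PowerSeries.X) := by
  have h1 := oneSub_mul_der_pw ν (PowerSeries.X : (LaurentPoly n)⟦X⟧)
  have h2 := oneSub_mul_mapDeriv_pw (fieldX n) ν (PowerSeries.X : (LaurentPoly n)⟦X⟧)
  have h3 : fieldY n (1 - C PowerSeries.X * PowerSeries.X) =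
      -(C PowerSeries.X * (1 - C PowerSeries.X * PowerSeries.X)) := by
    rw [map_sub, Derivation.map_one_eq_zero, Derivation.leibniz, fieldY_C, fieldX_X, fieldY,
      Derivation.add_apply, der_X, mapDeriv_X]
    simp only [smul_eq_mul, map_neg, map_pow]
    ring
  rw [fieldY, Derivation.add_apply] at h3
  rw [← (oneSub (PowerSeries.X : (LaurentPoly n)⟦X⟧)).mul_right_inj, coe_oneSub, fieldY,
    Derivation.add_apply, mul_add, h1, h2, ← mul_add, ← add_mul, h3, Algebra.smul_def, map_neg]
  ring

/-- The action of the vector field on an evaluated homogeneous polynomial. -/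
theorem fieldY_ev_unitTY {q : LaurentPoly n} {a : ℂ} (hq : ∑ i, euler i q = a • q) :
    fieldY n (ev unitTY q) = a • (C PowerSeries.X * ev unitTY q) := by
  rw [derivation_ev_dlog]
  simp only [dlog_fieldY_unitTY]
  rw [← Finset.sum_mul, ← map_sum, hq, map_smul, smul_mul_assoc, mul_comm]

theorem sum_euler_poly {g : U} {w : W} {a c : ℂ} (hg : S.HU g = a • g) (hw : S.HW w = c • w) :
    ∑ i, euler i (S.poly g w) = (c - a - ∑ i, (S.lam i : ℂ)) • S.poly g w := by
  have h := S.ward_H g w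
  rw [hg, hw, Finset.sum_add_distrib, ← Finset.sum_smul] at h
  simp only [map_smul, LinearMap.smul_apply] at h
  rw [eq_sub_of_add_eq h.symm]
  module

/-- The explicit form of `serTY`: the variables are moved by the Möbius transformation
`x ↦ (x - y) / (1 - t x)`, which sends `t⁻¹` to `∞` and `y` to `0`. -/
def flowTY (h : ℂ) (m : ℕ) (w : W) (g : U) : (LaurentPoly n)⟦X⟧⟦X⟧ :=
  ∑ i ∈ Finset.range (m + 1), ∑ j ∈ Finset.range (m + 1),
    ((i.factorial : ℂ)⁻¹ * (j.factorial : ℂ)⁻¹) •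
      (C (PowerSeries.X ^ (2 * m - j + i) * (S.jacT : (LaurentPoly n)⟦X⟧)) *
        pw (-2 * h - 2 * m + ∑ i, (S.lam i : ℂ)) PowerSeries.X *
        ev unitTY (S.poly ((S.EU ^ i) g) ((S.EW ^ j) w)))

/-- The explicit form satisfies the differential equation of `serTY`, as `fieldY` multiplies each
factor by a multiple of `t`. -/
theorem fieldY_flowTY {m : ℕ} {w : W} {g : U} {h : ℂ} (hw : S.HW w = (h + m) • w)
    (hg : S.HU g = (h + m) • g) :
    fieldY n (S.flowTY h m w g) = (2 * h) • (C PowerSeries.X * S.flowTY h m w g) := by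
  rw [flowTY, map_sum, Finset.mul_sum, Finset.smul_sum]
  refine Finset.sum_congr rfl fun i hi => ?_
  rw [map_sum, Finset.mul_sum, Finset.smul_sum]
  refine Finset.sum_congr rfl fun j hj => ?_
  have hpow : ∀ a : ℕ, fieldX n (PowerSeries.X ^ a) =
      -(algebraMap ℂ _ (a : ℂ)) * PowerSeries.X ^ (a + 1) := by
    intro a
    rw [Derivation.leibniz_pow, fieldX_X, map_natCast]
    cases a with
    | zero => simp
    | succ a =>
      simp only [nsmul_eq_mul, smul_eq_mul, Nat.add_sub_cancel]
      ring
  have hj' : j ≤ 2 * m := by rw [Finset.mem_range] at hj; omega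
  rw [Derivation.map_smul, Derivation.leibniz, Derivation.leibniz,
    fieldY_ev_unitTY (S.sum_euler_poly (S.HU_EU_pow hg i) (S.HW_EW_pow hw j)), fieldY_pw, fieldY_C,
    Derivation.leibniz, hpow, apply_eq_dlog_mul _ S.jacT, dlog_fieldX_jacT, Nat.cast_add,
    Nat.cast_sub hj']
  simp only [smul_eq_mul]
  simp only [Algebra.smul_def, map_mul, map_sub, map_add, map_neg, map_natCast, map_ofNat,
    map_pow, PowerSeries.algebraMap_apply]
  push_cast
  ring

theorem constHom_unitTY : (fun i => Units.map (constHom (LaurentPoly n)⟦X⟧ :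
    (LaurentPoly n)⟦X⟧⟦X⟧ →* (LaurentPoly n)⟦X⟧) (unitTY i)) = unitT (n := n) := by
  funext i
  rw [unitTY, map_mul, constHom_oneSub, mul_one]
  ext1
  exact constHom_C _

theorem constHom_ev_unitTY (q : LaurentPoly n) :
    constHom _ (ev unitTY q) = ev (unitT (n := n)) q := by
  rw [map_ev, constHom_unitTY]

theorem constHom_pw_X (ν : ℂ) :
    constHom (LaurentPoly n)⟦X⟧ (pw ν PowerSeries.X) = 1 := by
  rw [constHom_apply, coeff_pw]
  simp

theorem constHom_term (a b : ℂ) (k l : ℕ) (q : LaurentPoly n) (ν : ℂ) :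
    constHom (LaurentPoly n)⟦X⟧
      ((a * b) • (C (PowerSeries.X ^ (k + l) * (S.jacT : (LaurentPoly n)⟦X⟧)) *
        pw ν PowerSeries.X * ev unitTY q)) = b • (PowerSeries.X ^ k *
          (a • (PowerSeries.X ^ l * ((S.jacT : (LaurentPoly n)⟦X⟧) * ev unitT q)))) := by
  rw [constHom_smul_mul _ _ (constHom_pw_X ν), constHom_ev_unitTY, mul_smul_comm, smul_smul,
    mul_comm a, pow_add, mul_assoc, mul_assoc]

theorem smul_mul_flowT (N : ℕ) (g : U) (w : W) (b : ℂ) (f : (LaurentPoly n)⟦X⟧) :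
    b • (f * S.flowT N g w) = ∑ i ∈ Finset.range N, b • (f * ((i.factorial : ℂ)⁻¹ •
      (PowerSeries.X ^ i * ((S.jacT : (LaurentPoly n)⟦X⟧) *
        ev unitT (S.poly ((S.EU ^ i) g) w))))) := by
  rw [flowT, Finset.mul_sum, Finset.smul_sum]

theorem constHom_flowTY {m : ℕ} {w : W} {g : U} (h : ℂ) (hEg : (S.EU ^ (m + 1)) g = 0) :
    constHom _ (S.flowTY h m w g) = S.serT m w g := by
  rw [serT, flowTY, map_sum, Finset.sum_congr rfl fun i _ => map_sum _ _ _, Finset.sum_comm]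
  refine Finset.sum_congr rfl fun j _ => ?_
  rw [S.expF_eq_flowT hEg, smul_mul_flowT]
  refine Finset.sum_congr rfl fun i _ => ?_
  rw [constHom_term]

theorem constHom_serTY (m : ℕ) (w : W) (g : U) :
    constHom _ (S.serTY m w g) = S.serT m w g := by
  rw [constHom_apply, serTY, coeff_mk]
  simp

/-- Both sides satisfy the same differential equation in `y`, and they agree at `y = 0`. -/
theorem serTY_eq_flowTY {m : ℕ} {w : W} {g : U} {h : ℂ} (hw : S.HW w = (h + m) • w)
    (hg : S.HU g = (h + m) • g) (hEw : (S.EW ^ (m + 1)) w = 0) (hEg : (S.EU ^ (m + 1)) g = 0) :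
    S.serTY m w g = S.flowTY h m w g := by
  have e : ∀ f : (LaurentPoly n)⟦X⟧⟦X⟧, (2 * h) • (C PowerSeries.X * f) =
      C ((2 * h) • PowerSeries.X) * f := fun f => by rw [C_smul, smul_mul_assoc]
  have h1 := (S.fieldY_serTY hw hEw g).trans (e _)
  have h2 := (S.fieldY_flowTY hw hg).trans (e _)
  exact eq_of_fieldY h1 h2 ((S.constHom_serTY m w g).trans (S.constHom_flowTY h hEg).symm)

end QuasiprimaryFields

/-! ### Convergence of formal series in several variables -/

open Classical in
/-- The coefficient functionals `c` of a ring of formal series multiply by convolution. -/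
def IsConvolution {R I : Type*} [CommRing R] [Algebra ℂ R] [Add I] (c : R →ₗ[ℂ] I → ℂ) : Prop :=
  ∀ f g z, HasSum (fun p : I × I => if p.1 + p.2 = z then c f p.1 * c g p.2 else 0) (c (f * g) z)

/-- The formal series `f`, with coefficients `c f`, converges absolutely to `a` if the monomials
take the values `m`. -/
def SumsTo {R I : Type*} [CommRing R] [Algebra ℂ R] (c : R →ₗ[ℂ] I → ℂ) (m : I → ℂ) (f : R)
    (a : ℂ) : Prop := HasSum (fun z => c f z * m z) a

section

variable {R I : Type*} [CommRing R] [Algebra ℂ R] {c : R →ₗ[ℂ] I → ℂ} {m : I → ℂ}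

theorem SumsTo.smul {f : R} {a : ℂ} (h : SumsTo c m f a) (r : ℂ) : SumsTo c m (r • f) (r * a) := by
  refine hasSum_congr' (h.mul_left r) fun z => ?_
  simp [mul_assoc]

theorem SumsTo.sum {ι : Type*} {s : Finset ι} {f : ι → R} {a : ι → ℂ}
    (h : ∀ i ∈ s, SumsTo c m (f i) (a i)) : SumsTo c m (∑ i ∈ s, f i) (∑ i ∈ s, a i) := by
  refine hasSum_congr' (hasSum_sum h) fun z => ?_
  simp [Finset.sum_mul]

theorem SumsTo.mul [Add I] (hc : IsConvolution c) (hm : ∀ z w, m (z + w) = m z * m w) {f g : R}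
    {a b : ℂ} (hf : SumsTo c m f a) (hg : SumsTo c m g b) : SumsTo c m (f * g) (a * b) := by
  classical
  have h := hasSum_mul_prod hf hg
  let φ : I × I → I × (I × I) := fun p => (p.1 + p.2, p)
  have hφ : Function.Injective φ := fun p q h => congrArg Prod.snd h
  let F : I × (I × I) → ℂ := fun z =>
    (if z.2.1 + z.2.2 = z.1 then c f z.2.1 * c g z.2.2 else 0) * m z.1
  have hF : HasSum F (a * b) := by
    refine (hφ.hasSum_iff ?_).mp (hasSum_congr' h ?_)
    · rintro ⟨z, p⟩ hz
      have : p.1 + p.2 ≠ z := fun h => hz ⟨p, by rw [← h]⟩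
      simp [F, this]
    · rintro ⟨z, w⟩
      simp only [Function.comp_apply, φ, F, if_true, hm]
      ring
  exact hF.prod_fiberwise fun z => (hc f g z).mul_right (m z)

/-- A unit and its inverse both converge. -/
def SumsToUnit (c : R →ₗ[ℂ] I → ℂ) (m : I → ℂ) (x : Rˣ) (a : ℂ) : Prop :=
  SumsTo c m x a ∧ SumsTo c m (x⁻¹ : Rˣ) a⁻¹

theorem SumsToUnit.inv {x : Rˣ} {a : ℂ} (h : SumsToUnit c m x a) : SumsToUnit c m x⁻¹ a⁻¹ :=
  ⟨h.2, by rw [inv_inv, inv_inv]; exact h.1⟩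

theorem SumsToUnit.mul [Add I] (hc : IsConvolution c) (hm : ∀ z w, m (z + w) = m z * m w)
    {x y : Rˣ} {a b : ℂ} (hx : SumsToUnit c m x a) (hy : SumsToUnit c m y b) :
    SumsToUnit c m (x * y) (a * b) := by
  refine ⟨hx.1.mul hc hm hy.1, ?_⟩
  rw [mul_inv, mul_inv]
  exact hx.2.mul hc hm hy.2

theorem SumsToUnit.zpow [Add I] (hc : IsConvolution c) (hm : ∀ z w, m (z + w) = m z * m w)
    (h1 : SumsTo c m 1 1) {x : Rˣ} {a : ℂ} (hx : SumsToUnit c m x a) (k : ℤ) :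
    SumsToUnit c m (x ^ k) (a ^ k) := by
  have hone : SumsToUnit c m 1 1 := ⟨h1, by simpa using h1⟩
  have hnat : ∀ k : ℕ, SumsToUnit c m (x ^ k) (a ^ k) := by
    intro k
    induction k with
    | zero => simpa using hone
    | succ k ih => rw [pow_succ, pow_succ]; exact ih.mul hc hm hx
  obtain ⟨k, rfl | rfl⟩ := k.eq_nat_or_neg
  · simpa using hnat k
  · simpa using (hnat k).inv

theorem SumsToUnit.prod [Add I] (hc : IsConvolution c) (hm : ∀ z w, m (z + w) = m z * m w)
    (h1 : SumsTo c m 1 1) {ι : Type*} (s : Finset ι) {x : ι → Rˣ} {a : ι → ℂ}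
    (hx : ∀ i, SumsToUnit c m (x i) (a i)) : SumsToUnit c m (∏ i ∈ s, x i) (∏ i ∈ s, a i) := by
  classical
  have hone : SumsToUnit c m 1 1 := ⟨h1, by simpa using h1⟩
  induction s using Finset.induction_on with
  | empty => simpa using hone
  | insert i s hi ih =>
    rw [Finset.prod_insert hi, Finset.prod_insert hi]
    exact (hx i).mul hc hm ih

/-- The formal series `f` is a monomial, and takes the value `u`. -/
def IsMonomial (c : R →ₗ[ℂ] I → ℂ) (m : I → ℂ) (f : R) (u : ℂ) : Prop :=
  ∃ z, c f z = 1 ∧ (∀ w, w ≠ z → c f w = 0) ∧ m z = u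

theorem IsMonomial.sumsTo {f : R} {u : ℂ} (h : IsMonomial c m f u) : SumsTo c m f u := by
  obtain ⟨z, h1, h2, rfl⟩ := h
  have := hasSum_single (f := fun z => c f z * m z) z fun w hw => by rw [h2 w hw, zero_mul]
  simpa [SumsTo, h1] using this

/-- The coefficients of a power series whose coefficients are formal series. -/
def liftCoeff (c : R →ₗ[ℂ] I → ℂ) : R⟦X⟧ →ₗ[ℂ] ℕ × I → ℂ where
  toFun f z := c (coeff z.1 f) z.2
  map_add' f g := by ext; simp
  map_smul' r f := by
    ext z
    rw [Algebra.smul_def, PowerSeries.algebraMap_apply, coeff_C_mul, ← Algebra.smul_def, map_smul]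
    rfl

theorem IsConvolution.lift [Add I] (hc : IsConvolution c) : IsConvolution (liftCoeff c) := by
  classical
  rintro f g ⟨l, z⟩
  have h1 : liftCoeff c (f * g) (l, z) =
      ∑ ab ∈ Finset.HasAntidiagonal.antidiagonal l, c (coeff ab.1 f * coeff ab.2 g) z := by
    simp [liftCoeff, coeff_mul]
  rw [h1]
  have h2 : ∀ ab ∈ Finset.HasAntidiagonal.antidiagonal l, HasSum (fun p : (ℕ × I) × (ℕ × I) =>
      if p.1.1 = ab.1 ∧ p.2.1 = ab.2 ∧ p.1.2 + p.2.2 = z then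
        c (coeff ab.1 f) p.1.2 * c (coeff ab.2 g) p.2.2 else 0)
      (c (coeff ab.1 f * coeff ab.2 g) z) := by
    rintro ⟨a, b⟩ -
    let φ : I × I → (ℕ × I) × (ℕ × I) := fun p => ((a, p.1), (b, p.2))
    have hφ : Function.Injective φ := by
      rintro ⟨p, q⟩ ⟨p', q'⟩ h
      simpa [φ] using h
    refine (hφ.hasSum_iff ?_).mp (hasSum_congr' (hc (coeff a f) (coeff b g) z) ?_)
    · rintro ⟨⟨a', p⟩, ⟨b', q⟩⟩ h
      refine if_neg ?_
      rintro ⟨h1, h2, -⟩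
      simp only at h1 h2
      exact h ⟨(p, q), by simp only [φ]; rw [h1, h2]⟩
    · rintro ⟨p, q⟩
      simp [φ]
  refine hasSum_congr' (hasSum_sum h2) ?_
  rintro ⟨⟨a, p⟩, ⟨b, q⟩⟩
  by_cases h : (a, p) + (b, q) = (l, z)
  · rw [if_pos h]
    rw [Prod.mk_add_mk, Prod.mk.injEq] at h
    rw [Finset.sum_eq_single (a, b)]
    · simp [liftCoeff, h.2]
    · rintro ⟨a', b'⟩ - hne
      exact if_neg fun h' => hne (Prod.ext h'.1.symm h'.2.1.symm)
    · intro hne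
      exact absurd (Finset.HasAntidiagonal.mem_antidiagonal.mpr h.1) hne
  · rw [if_neg h]
    refine (Finset.sum_eq_zero ?_).symm
    rintro ⟨a', b'⟩ hab
    refine if_neg ?_
    rintro ⟨h1, h2, h3⟩
    refine h ?_
    rw [Prod.mk_add_mk, h3]
    simp only at h1 h2
    rw [h1, h2, Finset.HasAntidiagonal.mem_antidiagonal.mp hab]

/-- The values of the monomials after adjunction of a variable with value `y`. -/
def liftWeight (m : I → ℂ) (y : ℂ) (z : ℕ × I) : ℂ := y ^ z.1 * m z.2

theorem liftWeight_add [Add I] (hm : ∀ z w, m (z + w) = m z * m w) (y : ℂ) (z w : ℕ × I) :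
    liftWeight m y (z + w) = liftWeight m y z * liftWeight m y w := by
  simp only [liftWeight, Prod.fst_add, Prod.snd_add, hm, pow_add]
  ring

theorem IsMonomial.C {f : R} {u : ℂ} (h : IsMonomial c m f u) (y : ℂ) :
    IsMonomial (liftCoeff c) (liftWeight m y) (C f) u := by
  obtain ⟨z, h1, h2, rfl⟩ := h
  refine ⟨(0, z), by simpa [liftCoeff] using h1, ?_, by simp [liftWeight]⟩
  rintro ⟨l, w⟩ hw
  by_cases hl : l = 0
  · subst hl
    simpa [liftCoeff] using h2 w fun h => hw (by rw [h])
  · simp [liftCoeff, coeff_C, hl]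

theorem IsMonomial.X_pow (h : IsMonomial c m 1 1) (y : ℂ) (s : ℕ) :
    IsMonomial (liftCoeff c) (liftWeight m y) (PowerSeries.X ^ s) (y ^ s) := by
  obtain ⟨z, h1, h2, h3⟩ := h
  refine ⟨(s, z), by simpa [liftCoeff] using h1, ?_, by simp [liftWeight, h3]⟩
  rintro ⟨l, w⟩ hw
  by_cases hl : l = s
  · subst hl
    simpa [liftCoeff] using h2 w fun h => hw (by rw [h])
  · simp [liftCoeff, coeff_X_pow, hl]

theorem IsMonomial.one_lift (h : IsMonomial c m 1 1) (y : ℂ) :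
    IsMonomial (liftCoeff c) (liftWeight m y) 1 1 := by
  simpa using h.X_pow y 0

theorem SumsTo.C {f : R} {a : ℂ} (h : SumsTo c m f a) (y : ℂ) :
    SumsTo (liftCoeff c) (liftWeight m y) (C f) a := by
  let φ : I → ℕ × I := fun z => (0, z)
  have hφ : Function.Injective φ := fun z w h => congrArg Prod.snd h
  refine (hφ.hasSum_iff ?_).mp (hasSum_congr' h ?_)
  · rintro ⟨l, w⟩ hw
    have hl : l ≠ 0 := fun h => hw ⟨w, by simp [φ, h]⟩
    simp [liftCoeff, coeff_C, hl]
  · intro z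
    simp [φ, liftCoeff, liftWeight]

theorem SumsToUnit.C {x : Rˣ} {a : ℂ} (h : SumsToUnit c m x a) (y : ℂ) :
    SumsToUnit (liftCoeff c) (liftWeight m y)
      (Units.map (PowerSeries.C : R →+* R⟦X⟧).toMonoidHom x) a :=
  ⟨h.1.C y, h.2.C y⟩

theorem hasSum_binomial (ν : ℂ) {u : ℂ} (hu : ‖u‖ < 1) :
    HasSum (fun s : ℕ => Ring.choose ν s * (-u) ^ s) ((1 - u) ^ ν) := by
  have h := (Complex.one_add_cpow_hasFPowerSeriesOnBall_zero (a := ν)).hasSum (y := -u)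
    (by simpa [enorm_eq_nnnorm, ← NNReal.coe_lt_coe] using hu)
  rw [zero_add, ← sub_eq_add_neg] at h
  refine hasSum_congr' h fun s => ?_
  rw [binomialSeries_apply]
  simp

/-- Convergence of binomial powers. -/
theorem sumsTo_pw (ν : ℂ) {f : R} {u y : ℂ} (h : ∀ s : ℕ, IsMonomial c m (f ^ s) (u ^ s))
    (hu : ‖u * y‖ < 1) :
    SumsTo (liftCoeff c) (liftWeight m y) (pw ν f) ((1 - u * y) ^ ν) := by
  choose z h1 h2 h3 using h
  let φ : ℕ → ℕ × I := fun s => (s, z s)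
  have hφ : Function.Injective φ := fun s t h => congrArg Prod.fst h
  have hco : ∀ s w, liftCoeff c (pw ν f) (s, w) = Ring.choose ν s * (-1) ^ s * c (f ^ s) w := by
    intro s w
    have : coeff s (pw ν f) = (Ring.choose ν s * (-1) ^ s) • f ^ s := by
      rw [coeff_pw, neg_pow f, Algebra.smul_def, map_mul, map_pow, map_neg, map_one, mul_assoc]
    change c (coeff s (pw ν f)) w = _
    rw [this, map_smul]
    rfl
  refine (hφ.hasSum_iff ?_).mp (hasSum_congr' (hasSum_binomial ν hu) ?_)
  · rintro ⟨s, w⟩ hw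
    rw [hco, h2 s w fun h => hw ⟨s, by simp [φ, h]⟩, mul_zero, zero_mul]
  · intro s
    change liftCoeff c (pw ν f) (s, z s) * (y ^ s * m (z s)) = _
    rw [hco, h1, h3, neg_pow (u * y), mul_pow]
    ring

theorem sumsToUnit_oneSub {f : R} {u y : ℂ} (h : ∀ s : ℕ, IsMonomial c m (f ^ s) (u ^ s))
    (hu : ‖u * y‖ < 1) :
    SumsToUnit (liftCoeff c) (liftWeight m y) (oneSub f) (1 - u * y) := by
  refine ⟨?_, ?_⟩
  · have := sumsTo_pw 1 h hu
    rwa [Complex.cpow_one] at this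
  · have := sumsTo_pw (-1) h hu
    rwa [Complex.cpow_neg_one] at this

/-- The convergence of the evaluation of a Laurent polynomial. -/
theorem SumsToUnit.ev [Add I] (hc : IsConvolution c) (hm : ∀ z w, m (z + w) = m z * m w)
    (h1 : SumsTo c m 1 1) {n : ℕ} {x : Fin n → Rˣ} {a : Fin n → ℂˣ}
    (hx : ∀ i, SumsToUnit c m (x i) (a i)) (p : LaurentPoly n) :
    SumsTo c m (LaurentPoly.ev x p) (LaurentPoly.ev a p) := by
  rw [ev_apply, ev_apply]
  refine SumsTo.sum fun k _ => ?_
  have h := (SumsToUnit.prod hc hm h1 Finset.univ (fun i => (hx i).zpow hc hm h1 (k i))).1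
  convert h.smul (p.coeff k) using 1
  simp

end

namespace LaurentPoly

variable {n : ℕ}

/-- The coefficients of a Laurent polynomial, as a linear function. -/
def coeffLin : LaurentPoly n →ₗ[ℂ] (Fin n → ℤ) → ℂ where
  toFun p := p.coeff
  map_add' _ _ := rfl
  map_smul' _ _ := rfl

theorem coeffLin_apply (p : LaurentPoly n) (k : Fin n → ℤ) : coeffLin p k = p.coeff k := rfl

theorem isConvolution_coeffLin : IsConvolution (coeffLin (n := n)) := by
  intro f g z
  have h1 : ∑ p ∈ f.coeff.support ×ˢ g.coeff.support,
      (if p.1 + p.2 = z then f.coeff p.1 * g.coeff p.2 else 0) = (f * g).coeff z := by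
    rw [AddMonoidAlgebra.coeff_mul, Finset.sum_product]
    rfl
  have h2 : HasSum (fun p : (Fin n → ℤ) × (Fin n → ℤ) =>
      if p.1 + p.2 = z then f.coeff p.1 * g.coeff p.2 else 0) ((f * g).coeff z) := by
    rw [← h1]
    refine hasSum_sum_of_ne_finset_zero ?_
    rintro ⟨a, b⟩ h
    rw [Finset.mem_product, not_and_or, Finsupp.notMem_support_iff, Finsupp.notMem_support_iff] at h
    rw [mul_eq_zero.mpr h, ite_self]
  refine hasSum_congr' h2 fun p => ?_
  simp only [coeffLin_apply]
  by_cases h : p.1 + p.2 = z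
  · rw [if_pos h, if_pos h]
  · rw [if_neg h, if_neg h]

/-- The values of the monomials at a point. -/
def weight (x : Fin n → ℂ) (k : Fin n → ℤ) : ℂ := ∏ i, x i ^ k i

theorem isMonomial_mono (x : Fin n → ℂ) (k : Fin n → ℤ) :
    IsMonomial coeffLin (weight x) (mono k) (∏ i, x i ^ k i) := by
  have e : ∀ w, coeffLin (mono k) w = if k = w then 1 else 0 := fun w => by
    change (AddMonoidAlgebra.single k (1 : ℂ)).coeff w = _
    rw [AddMonoidAlgebra.coeff_single, Finsupp.single_apply]
  exact ⟨k, by rw [e, if_pos rfl], fun w hw => by rw [e, if_neg hw.symm], rfl⟩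

end LaurentPoly

/-! ### Summation of correlation functions -/

namespace LaurentPoly

variable {n : ℕ}

theorem Truncated.sum {ι : Type*} {s : Finset ι} {c : ι → (Fin n → ℤ) → ℂ}
    (h : ∀ i ∈ s, Truncated (c i)) : Truncated (∑ i ∈ s, c i) := by
  classical
  intro i j hij k
  choose! r hr using fun a ha => h a ha i j hij k
  refine ⟨s.sup r, fun q hq => ?_⟩
  rw [Finset.sum_apply]
  exact Finset.sum_eq_zero fun a ha => hr a ha q ((Finset.le_sup ha).trans hq)

theorem Truncated.smul {c : (Fin n → ℤ) → ℂ} (h : Truncated c) (a : ℂ) : Truncated (a • c) := by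
  intro i j hij k
  obtain ⟨r, hr⟩ := h i j hij k
  exact ⟨r, fun q hq => by rw [Pi.smul_apply, hr q hq, smul_zero]⟩

theorem weight_add {x : Fin n → ℂ} (hx : ∀ i, x i ≠ 0) (k l : Fin n → ℤ) :
    weight x (k + l) = weight x k * weight x l := by
  simp only [weight, Pi.add_apply, zpow_add₀ (hx _), Finset.prod_mul_distrib]

theorem isMonomial_one (x : Fin n → ℂ) : IsMonomial coeffLin (weight x) 1 1 := by
  simpa [mono_zero] using isMonomial_mono x 0

theorem isMonomial_var_pow (x : Fin n → ℂ) (i : Fin n) (s : ℕ) :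
    IsMonomial coeffLin (weight x) (var i ^ s) (x i ^ s) := by
  have h := isMonomial_mono x (s • Pi.single i 1)
  rw [mono_nsmul, ← var] at h
  convert h using 1
  rw [Finset.prod_eq_single i] <;> simp +contextual

theorem isMonomial_var_inv_pow (x : Fin n → ℂ) (i : Fin n) (s : ℕ) :
    IsMonomial coeffLin (weight x) (mono (-Pi.single i 1) ^ s) ((x i)⁻¹ ^ s) := by
  have h := isMonomial_mono x (s • -Pi.single i 1)
  rw [mono_nsmul] at h
  convert h using 1
  rw [Finset.prod_eq_single i] <;> simp +contextual

theorem sumsToUnit_varU (x : Fin n → ℂ) (i : Fin n) :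
    SumsToUnit coeffLin (weight x) (varU i) (x i) := by
  constructor
  · have := (isMonomial_var_pow x i 1).sumsTo
    rwa [pow_one, pow_one] at this
  · have := (isMonomial_var_inv_pow x i 1).sumsTo
    rwa [pow_one, pow_one] at this

end LaurentPoly

namespace QuasiprimaryFields

variable {n : ℕ} {U W : Type*} [AddCommGroup U] [Module ℂ U] [AddCommGroup W] [Module ℂ W]
  (S : QuasiprimaryFields n U W)

/-- The value of `flowTY` at a point; `u` stands for the units `(x_i - y) / (1 - t x_i)`. -/
def flowVal (h : ℂ) (m : ℕ) (w : W) (g : U) (x : Fin n → ℂ) (t y : ℂ) (u : Fin n → ℂˣ) : ℂ :=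
  ∑ i ∈ Finset.range (m + 1), ∑ j ∈ Finset.range (m + 1),
    ((i.factorial : ℂ)⁻¹ * (j.factorial : ℂ)⁻¹) *
      ((t ^ (2 * m - j + i) * ∏ i, (1 - x i * t) ^ (-2 * S.lam i)) *
        (1 - t * y) ^ (-2 * h - 2 * m + ∑ i, (S.lam i : ℂ)) *
        ev u (S.poly ((S.EU ^ i) g) ((S.EW ^ j) w)))

/-- The explicit form converges, because its factors are binomial series and monomials. -/
theorem sumsTo_flowTY (h : ℂ) (m : ℕ) (w : W) (g : U) {x : Fin n → ℂ} {t y : ℂ}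
    (hx : ∀ i, x i ≠ 0) (htx : ∀ i, ‖x i * t‖ < 1) (hxy : ∀ i, ‖(x i)⁻¹ * y‖ < 1)
    (hty : ‖t * y‖ < 1) {u : Fin n → ℂˣ} (hu : ∀ i, (u i : ℂ) = (x i - y) / (1 - x i * t)) :
    SumsTo (liftCoeff (liftCoeff coeffLin)) (liftWeight (liftWeight (weight x) t) y)
      (S.flowTY h m w g) (S.flowVal h m w g x t y u) := by
  have hc0 := isConvolution_coeffLin (n := n)
  have hc1 := hc0.lift
  have hc2 := hc1.lift
  have hm0 := weight_add hx
  have hm1 := liftWeight_add hm0 t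
  have hm2 := liftWeight_add hm1 y
  have h0 := isMonomial_one x
  have h1 := h0.one_lift t
  have h2 := h1.one_lift y
  have hone : ∀ i, SumsToUnit (liftCoeff coeffLin) (liftWeight (weight x) t) (oneSub (var i))
      (1 - x i * t) := fun i => sumsToUnit_oneSub (isMonomial_var_pow x i) (htx i)
  have hjac : SumsTo (liftCoeff coeffLin) (liftWeight (weight x) t) (S.jacT : (LaurentPoly n)⟦X⟧)
      (∏ i, (1 - x i * t) ^ (-2 * S.lam i)) :=
    (SumsToUnit.prod hc1 hm1 h1.sumsTo Finset.univ fun i =>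
      (hone i).zpow hc1 hm1 h1.sumsTo (-2 * S.lam i)).1
  have hunit : ∀ i, SumsToUnit (liftCoeff (liftCoeff coeffLin))
      (liftWeight (liftWeight (weight x) t) y) (unitTY i) (u i) := by
    intro i
    have e : (u i : ℂ) = (x i * (1 - x i * t)⁻¹) * (1 - (x i)⁻¹ * y) := by
      rw [hu]
      have := hx i
      field_simp
    rw [e]
    refine SumsToUnit.mul hc2 hm2 (SumsToUnit.C (SumsToUnit.mul hc1 hm1
      ((sumsToUnit_varU x i).C t) (hone i).inv) y) (sumsToUnit_oneSub (fun s => ?_) (hxy i))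
    rw [← map_pow]
    exact (isMonomial_var_inv_pow x i s).C t
  rw [flowTY, flowVal]
  refine SumsTo.sum fun i _ => SumsTo.sum fun j _ => SumsTo.smul ?_ _
  refine SumsTo.mul hc2 hm2 (SumsTo.mul hc2 hm2 ?_ ?_)
    (SumsToUnit.ev hc2 hm2 h2.sumsTo hunit _)
  · exact (SumsTo.mul hc1 hm1 (h0.X_pow t _).sumsTo hjac).C y
  · exact sumsTo_pw _ (fun s => h0.X_pow t s) hty

/-- The coefficient of `t^p y^l`, where `z = (l, p)`, in `serTY` without the multiplication by the
discriminant. -/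
def corrTY (m : ℕ) (w : W) (g : U) (z : ℕ × ℕ) : (Fin n → ℤ) → ℂ :=
  ∑ j ∈ Finset.range (m + 1), if 2 * m - j ≤ z.2 then
    ((j.factorial : ℂ)⁻¹ * (z.1.factorial : ℂ)⁻¹ * ((z.2 - (2 * m - j)).factorial : ℂ)⁻¹) •
      S.corr ((S.FU ^ z.1) g) ((S.FW ^ (z.2 - (2 * m - j))) ((S.EW ^ j) w)) else 0

theorem truncated_corrTY (m : ℕ) (w : W) (g : U) (z : ℕ × ℕ) : Truncated (S.corrTY m w g z) := by
  refine Truncated.sum fun j _ => ?_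
  split_ifs
  · exact (S.truncated_corr _ _).smul _
  · intro _ _ _ _
    exact ⟨0, fun _ _ => rfl⟩

/-- The discriminant times `corrTY` gives the coefficients of `serTY`. -/
theorem act_corrTY (m : ℕ) (w : W) (g : U) (z : ℕ × ℕ) (k : Fin n → ℤ) :
    act (discr n S.K) (S.corrTY m w g z) k =
      liftCoeff (liftCoeff coeffLin) (S.serTY m w g) (z.1, (z.2, k)) := by
  obtain ⟨l, p⟩ := z
  have h1 : coeff p (coeff l (S.serTY m w g)) = ∑ j ∈ Finset.range (m + 1),
      if 2 * m - j ≤ p then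
        ((j.factorial : ℂ)⁻¹ * (l.factorial : ℂ)⁻¹ * ((p - (2 * m - j)).factorial : ℂ)⁻¹) •
        S.poly ((S.FU ^ l) g) ((S.FW ^ (p - (2 * m - j))) ((S.EW ^ j) w)) else 0 := by
    have hs : ∀ (a : ℂ) (f : (LaurentPoly n)⟦X⟧), coeff p (a • f) = a • coeff p f := by
      intro a f
      rw [Algebra.smul_def, PowerSeries.algebraMap_apply, coeff_C_mul, ← Algebra.smul_def]
    rw [serTY, coeff_mk, serT, hs, map_sum, Finset.smul_sum]
    refine Finset.sum_congr rfl fun j _ => ?_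
    rw [hs, coeff_X_pow_mul', smul_ite, smul_ite, smul_zero, smul_zero, expF, coeff_mk, smul_smul,
      smul_smul]
    congr 2
    ring
  change _ = coeffLin (coeff p (coeff l (S.serTY m w g))) k
  rw [h1, corrTY, map_sum, map_sum, Finset.sum_apply, Finset.sum_apply]
  refine Finset.sum_congr rfl fun j _ => ?_
  dsimp only
  split_ifs
  · rw [map_smul, map_smul, S.act_corr]
    rfl
  · simp

/-- The correlation functions of descendants converge to the explicit expression. -/
theorem hasSum_corrTY {h : ℂ} {m : ℕ} {w : W} {g : U} (hw : S.HW w = (h + m) • w)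
    (hg : S.HU g = (h + m) • g) (hEw : (S.EW ^ (m + 1)) w = 0) (hEg : (S.EU ^ (m + 1)) g = 0)
    {x : Fin n → ℂ} {t y : ℂ} (hanti : StrictAnti fun i => ‖x i‖)
    (hx : ∀ i, x i ≠ 0) (htx : ∀ i, ‖x i * t‖ < 1) (hxy : ∀ i, ‖(x i)⁻¹ * y‖ < 1)
    (hty : ‖t * y‖ < 1) {u : Fin n → ℂˣ} (hu : ∀ i, (u i : ℂ) = (x i - y) / (1 - x i * t)) :
    HasSum (fun z : (Fin n → ℤ) × (ℕ × ℕ) =>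
      S.corrTY m w g z.2 z.1 * ((∏ i, x i ^ z.1 i) * (y ^ z.2.1 * t ^ z.2.2)))
      (S.flowVal h m w g x t y u * (discrAt S.K x)⁻¹) := by
  refine dividesAt_discr (fun z : ℕ × ℕ => y ^ z.1 * t ^ z.2) hx hanti S.K _
    (S.truncated_corrTY m w g) _ ?_
  have h1 := S.sumsTo_flowTY h m w g hx htx hxy hty hu
  rw [← S.serTY_eq_flowTY hw hg hEw hEg] at h1
  let e : (Fin n → ℤ) × (ℕ × ℕ) ≃ ℕ × (ℕ × (Fin n → ℤ)) :=
    { toFun := fun z => (z.2.1, (z.2.2, z.1))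
      invFun := fun z => (z.2.2, (z.1, z.2.1))
      left_inv := fun _ => rfl
      right_inv := fun _ => rfl }
  refine hasSum_congr' (e.hasSum_iff.mpr h1) fun z => ?_
  rw [act_corrTY]
  simp only [Function.comp_apply, e, Equiv.coe_fn_mk, liftWeight, weight]
  ring

/-- The correlation functions converge to rational functions. -/
theorem hasSum_corr (g : U) (w : W) {x : Fin n → ℂ} (hanti : StrictAnti fun i => ‖x i‖)
    {u : Fin n → ℂˣ} (hu : ∀ i, (u i : ℂ) = x i) :
    HasSum (fun k => S.corr g w k * ∏ i, x i ^ k i) (ev u (S.poly g w) * (discrAt S.K x)⁻¹) := by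
  have hx : ∀ i, x i ≠ 0 := fun i => hu i ▸ (u i).ne_zero
  have h0 := (SumsToUnit.ev isConvolution_coeffLin (weight_add hx) (isMonomial_one x).sumsTo
    (a := u) (fun i => by rw [hu]; exact sumsToUnit_varU x i) (S.poly g w))
  rw [ev_varU] at h0
  have h1 := dividesAt_discr (fun _ : Unit => (1 : ℂ)) hx hanti S.K (fun _ => S.corr g w)
    (fun _ => S.truncated_corr g w) (ev u (S.poly g w)) ?_
  · refine hasSum_congr' ((Equiv.prodPUnit (Fin n → ℤ)).symm.hasSum_iff.mpr h1) fun k => ?_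
    simp
  · refine hasSum_congr' ((Equiv.prodPUnit (Fin n → ℤ)).hasSum_iff.mpr h0) fun k => ?_
    rw [S.act_corr]
    simp [weight, coeffLin_apply]

end QuasiprimaryFields

/-! ### The deformation argument for sewing -/

namespace Sewing

open PowerSeries

/-- The ring `ℂ[σ]⟦q⟧`. -/
abbrev B := (Polynomial ℂ)⟦X⟧

/-- The deformation parameter `σ`. Along the deformation, the points are moved by the flow
`ξ ↦ (ξ - s) / (1 - s ξ)` with `s = σ q`; the sewn sum is the case `σ = 1`, and the case
`σ = 0` is the trace. -/
def sig : Polynomial ℂ := Polynomial.X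

/-- The derivative with respect to the deformation parameter. -/
def D : Derivation ℂ B B := mapDeriv Polynomial.derivative'

/-- The substitution `f(s) ↦ f(σ q)`. -/
def subst : ℂ⟦X⟧ →+* B := (rescale sig).comp (map Polynomial.C)

theorem coeff_subst (f : ℂ⟦X⟧) (k : ℕ) : coeff k (subst f) = sig ^ k * Polynomial.C (coeff k f) := by
  rw [subst, RingHom.comp_apply, coeff_rescale, coeff_map]

theorem D_subst (f : ℂ⟦X⟧) : D (subst f) = X * subst (der ℂ f) := by
  ext1 k
  rw [D, coeff_mapDeriv, coeff_subst]
  rcases k with _ | k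
  · rw [coeff_zero_X_mul]
    simp [Polynomial.derivative']
  · rw [coeff_succ_X_mul, coeff_subst, coeff_der]
    simp [Polynomial.derivative', sig]
    ring

theorem D_oneSub (c : Polynomial ℂ) :
    D (oneSub c : B) = -(C (Polynomial.derivative c) * X) := by
  rw [coe_oneSub, D, map_sub, Derivation.map_one_eq_zero, Derivation.leibniz, mapDeriv_X,
    mapDeriv_C,
    zero_sub, smul_zero, zero_add, smul_eq_mul, mul_comm]
  rfl

/-- The unit `1 - σ² q² = (1 - σ q) (1 + σ q)`. -/
def den : Bˣ := oneSub sig * oneSub (-sig)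

theorem coe_den : (den : B) = 1 - C (sig ^ 2) * X ^ 2 := by
  rw [den, Units.val_mul, coe_oneSub, coe_oneSub, map_neg, map_pow]
  ring

/-- The inverse of `1 - σ² q²`. -/
def invDen : B := ((den⁻¹ : Bˣ) : B)

/-- The inverse of `1 - σ² q`. -/
def invNum : B := (((oneSub (sig ^ 2))⁻¹ : Bˣ) : B)

theorem den_mul_invDen : (1 - C sig ^ 2 * X ^ 2) * invDen = 1 := by
  rw [← map_pow, ← coe_den, invDen, Units.mul_inv]

theorem num_mul_invNum : (1 - C sig ^ 2 * X) * invNum = 1 := by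
  rw [← map_pow, ← coe_oneSub, invNum, Units.mul_inv]

/-- The deformation `-σ (1 - q) / (1 - σ² q)` of `-1`. It is the parameter of the exponential of
`E`, and the solution with value `0` at `σ = 0` of the Riccati equation `D_a`. -/
def a : B := -(C sig * (1 - X)) * invNum

/-- The unit `κ / q`. -/
def kapU : Bˣ := (oneSub (sig ^ 2) * oneSub (sig ^ 2)) * (den⁻¹ * den⁻¹)

/-- The deformation `q (1 - σ² q)² / (1 - σ² q²)²` of the sewing parameter `q / (1 + q)²`. -/
def kap : B := X * (kapU : B)

/-- The factor `q / (1 - s²)` at `s = σ q`. -/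
def nu : B := X * invDen

/-- The quotient of `nu` and `kap`. -/
def mu : B := (den : B) * invNum ^ 2

theorem kap_mul_mu : kap * mu = nu := by
  have e : (kapU : B) = (1 - C sig ^ 2 * X) ^ 2 * invDen ^ 2 := by
    rw [kapU, Units.val_mul, Units.val_mul, Units.val_mul, coe_oneSub, ← invDen, map_pow]
    ring
  rw [kap, mu, nu, e, coe_den, map_pow]
  linear_combination (X * invDen * ((1 - C sig ^ 2 * X) * invNum) ^ 2) * den_mul_invDen
    + X * invDen * ((1 - C sig ^ 2 * X) * invNum + 1) * num_mul_invNum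

theorem derivative_sig_sq : Polynomial.derivative (sig ^ 2) = 2 * sig := by
  rw [sig, Polynomial.derivative_X_sq]
  rfl

theorem dlog_oneSub (c : Polynomial ℂ) : dlog D (oneSub c) =
    -(C (Polynomial.derivative c) * X) * (((oneSub c)⁻¹ : Bˣ) : B) := by
  rw [dlog, D_oneSub, mul_comm]

theorem dlog_num : dlog D (oneSub (sig ^ 2)) = -(2 * C sig * X) * invNum := by
  rw [dlog_oneSub, derivative_sig_sq, map_mul, map_ofNat, invNum]

theorem D_X : D X = 0 := mapDeriv_X _

theorem D_C_sig : D (C sig) = 1 := by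
  rw [D, mapDeriv_C]
  have : Polynomial.derivative' sig = 1 := Polynomial.derivative_X
  rw [this, map_one]

theorem dlog_den : dlog D den = -(2 * C sig * X ^ 2) * invDen := by
  have : D (den : B) = -(2 * C sig * X ^ 2) := by
    rw [coe_den, map_pow, map_sub, Derivation.map_one_eq_zero, Derivation.leibniz,
      Derivation.leibniz_pow, Derivation.leibniz_pow, D_C_sig, D_X]
    simp only [smul_eq_mul, nsmul_eq_mul]
    push_cast
    ring
  rw [dlog, this, invDen, mul_comm]

theorem dlog_kapU : dlog D kapU = 4 * a * nu := by
  rw [kapU, dlog_mul, dlog_mul, dlog_mul, dlog_inv, dlog_num, dlog_den, a, nu]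
  linear_combination (4 * C sig * X * invNum) * den_mul_invDen
    - 4 * C sig * X ^ 2 * invDen * num_mul_invNum

theorem D_kap : D kap = 4 * a * nu * kap := by
  rw [kap, Derivation.leibniz, D_X, apply_eq_dlog_mul, dlog_kapU]
  simp only [smul_eq_mul]
  ring

theorem D_a : D a = nu * (1 - a ^ 2) - mu := by
  have h1 : D invNum = 2 * C sig * X * invNum ^ 2 := by
    rw [invNum, apply_eq_dlog_mul, dlog_inv, dlog_num, invNum]
    ring
  rw [a, Derivation.leibniz, map_neg, Derivation.leibniz, D_C_sig, map_sub, D_X,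
    Derivation.map_one_eq_zero, h1, nu, mu, coe_den, map_pow]
  simp only [smul_eq_mul]
  linear_combination ((1 - X) * invNum + X * invDen * ((1 - C sig ^ 2 * X) * invNum + 1)) *
    num_mul_invNum - X * (1 - C sig ^ 2) * invNum ^ 2 * den_mul_invDen

/-- The deformation of `(1 + q)^(-2h)`. -/
def fac (h : ℂ) : B := pw (2 * h) (sig ^ 2) * (pw (-2 * h) sig * pw (-2 * h) (-sig))

theorem D_pw (ν : ℂ) (c : Polynomial ℂ) :
    D (pw ν c) = algebraMap ℂ B ν * dlog D (oneSub c) * pw ν c := by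
  have h := oneSub_mul_mapDeriv_pw Polynomial.derivative' ν c
  rw [← coe_oneSub] at h
  have h2 : D (pw ν c) = (((oneSub c)⁻¹ : Bˣ) : B) * ((oneSub c : B) * D (pw ν c)) := by
    rw [Units.inv_mul_cancel_left]
  rw [h2, D, h, dlog]
  ring

theorem D_fac (h : ℂ) : D (fac h) = algebraMap ℂ B h * (4 * a * nu) * fac h := by
  rw [fac, Derivation.leibniz, Derivation.leibniz, D_pw, D_pw, D_pw, ← dlog_kapU, kapU, den,
    mul_inv]
  simp only [dlog_mul, dlog_inv, smul_eq_mul, map_mul, map_neg, map_ofNat]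
  ring

/-- Series `y_{n,i}(s)` subject to the differential equations of `E^i Ω_n / i!`, moved along the
flow of `F - E`, when `Ω_n` has weight `2 (h + n)` and `F Ω_n = E Ω_{n+1}` for an `sl₂`-triple `E`,
`F`, `H`. -/
structure System (h : ℂ) (y : ℕ → ℕ → ℂ⟦X⟧) : Prop where
  zero : ∀ n, (1 - X ^ 2) * der ℂ (y n 0) = y (n + 1) 1 - y n 1
  succ : ∀ n i, (1 - X ^ 2) * der ℂ (y n (i + 1)) =
    ((i : ℂ) + 2) • y (n + 1) (i + 2) - (4 * (h + n) - i) • y n i - ((i : ℂ) + 2) • y n (i + 2)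
  vanish : ∀ n i, 2 * n < i → y n i = 0

variable {h : ℂ} {y : ℕ → ℕ → ℂ⟦X⟧}

/-- The polynomial `∑ a^i y_{n,i}(σ q)` in `a`. -/
def sumA (y : ℕ → ℕ → ℂ⟦X⟧) (N n : ℕ) : B := ∑ i ∈ Finset.range N, a ^ i * subst (y n i)

/-- The derivative of `sumA` with respect to `a`. -/
def sumB (y : ℕ → ℕ → ℂ⟦X⟧) (N n : ℕ) : B :=
  ∑ i ∈ Finset.range N, ((i : B) + 1) * (a ^ i * subst (y n (i + 1)))

theorem subst_smul (r : ℂ) (f : ℂ⟦X⟧) : subst (r • f) = algebraMap ℂ B r * subst f := by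
  rw [Algebra.smul_def, map_mul]
  congr 1
  rw [PowerSeries.algebraMap_apply, PowerSeries.algebraMap_apply, subst, RingHom.comp_apply, map_C]
  ext1 k
  rw [coeff_rescale, coeff_C, coeff_C]
  split_ifs with hk
  · rw [hk, pow_zero, one_mul]; rfl
  · rw [mul_zero]

theorem nu_mul_subst (f : ℂ⟦X⟧) : nu * subst ((1 - X ^ 2) * f) = X * subst f := by
  have h1 : subst (1 - X ^ 2) = (den : B) := by
    rw [coe_den, subst, RingHom.comp_apply]
    simp only [map_sub, map_one, map_pow, map_X, rescale_X, mul_pow]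
  rw [map_mul, h1, nu, coe_den, map_pow]
  linear_combination X * subst f * den_mul_invDen

/-- The derivative of a polynomial in `a` whose coefficients and whose variable satisfy
differential equations of `sl₂` type. -/
theorem derivation_sum_flow {R : Type*} [CommRing R] [Algebra ℂ R] (D : Derivation ℂ R R)
    {a ν μ c : R} {f g : ℕ → R} {N : ℕ} (ha : D a = ν * (1 - a ^ 2) - μ)
    (h0 : D (f 0) = ν * (g 1 - f 1)) (hs : ∀ i : ℕ, D (f (i + 1)) =
      ν * (((i : R) + 2) * g (i + 2) - (4 * c - i) * f i - ((i : R) + 2) * f (i + 2)))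
    (hv : ∀ i, N < i → f i = 0) :
    D (∑ i ∈ Finset.range (N + 2), a ^ i * f i) =
      ν * ∑ i ∈ Finset.range (N + 2), ((i : R) + 1) * (a ^ i * g (i + 1))
      - μ * ∑ i ∈ Finset.range (N + 2), ((i : R) + 1) * (a ^ i * f (i + 1))
      - c * (4 * a * ν) * ∑ i ∈ Finset.range (N + 2), a ^ i * f i := by
  have hpow : ∀ i : ℕ, D (a ^ (i + 1)) = ((i : R) + 1) * a ^ i * D a := by
    intro i
    rw [Derivation.leibniz_pow]
    simp only [smul_eq_mul, nsmul_eq_mul, Nat.add_sub_cancel]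
    push_cast
    ring
  have h1 : ∑ i ∈ Finset.range (N + 2), a ^ i * f i =
      ∑ i ∈ Finset.range (N + 1), a ^ (i + 1) * f (i + 1) + f 0 := by
    rw [Finset.sum_range_succ', pow_zero, one_mul]
  have h2 : ∑ i ∈ Finset.range (N + 2), a ^ i * f i =
      ∑ i ∈ Finset.range (N + 1), a ^ i * f i := by
    rw [Finset.sum_range_succ, hv (N + 1) (by omega), mul_zero, add_zero]
  have h3 : ∀ g : ℕ → R, ∑ i ∈ Finset.range (N + 2), ((i : R) + 1) * (a ^ i * g (i + 1)) =
      ∑ i ∈ Finset.range (N + 1), ((i : R) + 2) * (a ^ (i + 1) * g (i + 2)) + g 1 := by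
    intro g
    rw [Finset.sum_range_succ', pow_zero, Nat.cast_zero, zero_add, one_mul, one_mul]
    congr 1
    refine Finset.sum_congr rfl fun i _ => ?_
    push_cast
    ring
  have h4 : ∑ i ∈ Finset.range (N + 2), ((i : R) + 1) * (a ^ i * f (i + 1)) =
      ∑ i ∈ Finset.range (N + 1), ((i : R) + 1) * (a ^ i * f (i + 1)) := by
    rw [Finset.sum_range_succ, hv (N + 2) (by omega), mul_zero, mul_zero, add_zero]
  have h5 : a ^ 2 * ∑ i ∈ Finset.range (N + 2), ((i : R) + 1) * (a ^ i * f (i + 1)) =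
      ∑ i ∈ Finset.range (N + 1), (i : R) * (a ^ (i + 1) * f i) := by
    rw [h4, Finset.sum_range_succ, hv (N + 1) (by omega), mul_zero, mul_zero, add_zero,
      Finset.sum_range_succ', Finset.mul_sum, Nat.cast_zero, zero_mul, add_zero]
    refine Finset.sum_congr rfl fun i _ => ?_
    push_cast
    ring
  have key : ∀ i ∈ Finset.range (N + 1), D (a ^ (i + 1) * f (i + 1)) =
      D a * (((i : R) + 1) * (a ^ i * f (i + 1)))
      + ν * (((i : R) + 2) * (a ^ (i + 1) * g (i + 2)))
      - 4 * c * ν * a * (a ^ i * f i) + ν * ((i : R) * (a ^ (i + 1) * f i))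
      - ν * (((i : R) + 2) * (a ^ (i + 1) * f (i + 2))) := by
    intro i _
    rw [Derivation.leibniz, hpow, hs]
    simp only [smul_eq_mul]
    ring
  conv_lhs => rw [h1]
  rw [map_add, map_sum, Finset.sum_congr rfl key, Finset.sum_sub_distrib, Finset.sum_add_distrib,
    Finset.sum_sub_distrib, Finset.sum_add_distrib, ← Finset.mul_sum, ← Finset.mul_sum,
    ← Finset.mul_sum, ← Finset.mul_sum, ← Finset.mul_sum, ← h4, ← h5, ← h2, h0, ha]
  linear_combination (-ν) * h3 g + ν * h3 f

/-- The derivative of the `n`-th term of the deformed sum involves the derivatives in `a` of the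
`(n+1)`-st and of the `n`-th term, with coefficients whose quotient is `kap`. -/
theorem System.D_sumA (hy : System h y) {N n : ℕ} (hN : 2 * n + 2 < N) :
    D (sumA y N n) = nu * sumB y N (n + 1) - mu * sumB y N n
      - algebraMap ℂ B (h + n) * (4 * a * nu) * sumA y N n := by
  obtain ⟨N, rfl⟩ : ∃ N', N = N' + 2 := ⟨N - 2, by omega⟩
  have hD : ∀ f, D (subst f) = nu * subst ((1 - X ^ 2) * der ℂ f) := fun f => by
    rw [D_subst, nu_mul_subst]
  refine derivation_sum_flow D (f := fun i => subst (y n i)) (g := fun i => subst (y (n + 1) i)) D_a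
    ?_ ?_ ?_
  · rw [hD, hy.zero, map_sub]
  · intro i
    rw [hD, hy.succ, map_sub, map_sub, subst_smul, subst_smul, subst_smul]
    simp only [map_add, map_sub, map_mul, map_natCast, map_ofNat]
  · intro i hi
    rw [hy.vanish n i (by omega), map_zero]

/-- The coefficient of `q^M` of the deformed sum does not depend on `σ`: the derivatives of the
terms with respect to `σ` telescope, and the last one is divisible by `q^(M+1)`. -/
theorem System.coeff_sum (hy : System h y) (M : ℕ) :
    Polynomial.derivative (coeff M (fac h * ∑ n ∈ Finset.range (M + 1),
      kap ^ n * sumA y (2 * M + 3) n)) = 0 := by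
  set N := 2 * M + 3
  have h1 : D (fac h * ∑ n ∈ Finset.range (M + 1), kap ^ n * sumA y N n) =
      fac h * (kap ^ (M + 1) * mu * sumB y N (M + 1)) := by
    have h0 : sumB y N 0 = 0 := by
      refine Finset.sum_eq_zero fun i _ => ?_
      rw [hy.vanish 0 (i + 1) (by omega), map_zero, mul_zero, mul_zero]
    have h2 : ∀ n ∈ Finset.range (M + 1), D (kap ^ n * sumA y N n) =
        (kap ^ (n + 1) * mu * sumB y N (n + 1) - kap ^ n * mu * sumB y N n)
          - algebraMap ℂ B h * (4 * a * nu) * (kap ^ n * sumA y N n) := by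
      intro n hn
      have hk : D (kap ^ n) = n * (4 * a * nu) * kap ^ n := by
        have := LaurentPoly.derivation_pow_eigen D D_kap n
        exact this
      rw [Derivation.leibniz, hk, hy.D_sumA (by rw [Finset.mem_range] at hn; omega), ← kap_mul_mu,
        map_add, map_natCast]
      simp only [smul_eq_mul]
      ring
    rw [Derivation.leibniz, map_sum, Finset.sum_congr rfl h2, Finset.sum_sub_distrib,
      ← Finset.mul_sum, Finset.sum_range_sub (fun n => kap ^ n * mu * sumB y N n), h0, D_fac]
    simp only [smul_eq_mul]
    ring
  have h2 := congrArg (coeff M) h1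
  rw [D, coeff_mapDeriv] at h2
  have h3 : fac h * (kap ^ (M + 1) * mu * sumB y N (M + 1)) =
      X ^ (M + 1) * (fac h * ((kapU : B) ^ (M + 1) * mu * sumB y N (M + 1))) := by
    rw [kap, mul_pow]
    ring
  rw [h3, coeff_X_pow_mul', if_neg (by omega)] at h2
  exact h2

/-- The specialisation of the deformation parameter. -/
def spec (c : ℂ) : B →+* ℂ⟦X⟧ := map ((Polynomial.aeval c : Polynomial ℂ →ₐ[ℂ] ℂ) : Polynomial ℂ →+* ℂ)

theorem spec_C_sig (c : ℂ) : spec c (C sig) = C c := by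
  rw [spec, map_C]
  simp [sig]

theorem spec_X (c : ℂ) : spec c X = X := by rw [spec, map_X]

theorem spec_pw (c ν : ℂ) (p : Polynomial ℂ) :
    spec c (pw ν p) = pw ν (Polynomial.aeval c p) := map_pw (Polynomial.aeval c) ν p

theorem coeff_spec (c : ℂ) (f : B) (k : ℕ) : coeff k (spec c f) = (coeff k f).eval c := by
  rw [spec, coeff_map]
  simp

theorem spec_one_subst (f : ℂ⟦X⟧) : spec 1 (subst f) = f := by
  ext k
  rw [coeff_spec, coeff_subst]
  simp [sig]

theorem spec_zero_subst (f : ℂ⟦X⟧) : spec 0 (subst f) = C (coeff 0 f) := by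
  ext k
  rw [coeff_spec, coeff_subst, coeff_C]
  rcases k with _ | k <;> simp [sig]

theorem spec_a (c : ℂ) : (1 - C c ^ 2 * X) * spec c a = -(C c * (1 - X)) := by
  have h : (1 - C sig ^ 2 * X) * a = -(C sig * (1 - X)) := by
    rw [a]
    linear_combination (-(C sig * (1 - X))) * num_mul_invNum
  simpa only [map_mul, map_sub, map_neg, map_one, map_pow, spec_C_sig, spec_X] using
    congrArg (spec c) h

theorem spec_kap (c : ℂ) :
    (1 - C c ^ 2 * X ^ 2) ^ 2 * spec c kap = X * (1 - C c ^ 2 * X) ^ 2 := by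
  have h : (1 - C sig ^ 2 * X ^ 2) ^ 2 * kap = X * (1 - C sig ^ 2 * X) ^ 2 := by
    have e : (kapU : B) = (1 - C sig ^ 2 * X) ^ 2 * invDen ^ 2 := by
      rw [kapU, Units.val_mul, Units.val_mul, Units.val_mul, coe_oneSub, ← invDen, map_pow]
      ring
    rw [kap, e]
    linear_combination (X * (1 - C sig ^ 2 * X) ^ 2) *
      ((1 - C sig ^ 2 * X ^ 2) * invDen + 1) * den_mul_invDen
  simpa only [map_mul, map_sub, map_neg, map_one, map_pow, spec_C_sig, spec_X] using
    congrArg (spec c) h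

theorem one_add_smul_X_ne_zero (c : ℂ) : (1 + C c * X : ℂ⟦X⟧) ≠ 0 := fun h => by
  have := congrArg (coeff 0) h
  simp at this

/-- The sewn sum `(1 + q)^(-2h) ∑ κ^n ∑ (-1)^i y_{n,i}(q)`, where `κ = q / (1 + q)²`, is
`∑ q^n y_{n,0}(0)`. -/
theorem System.sewing (hy : System h y) {k : ℂ⟦X⟧} (hk : (1 + X) ^ 2 * k = X) (M : ℕ) :
    coeff M (PowerSeries.binomialSeries ℂ (-2 * h) * ∑ n ∈ Finset.range (M + 1),
      k ^ n * ∑ i ∈ Finset.range (2 * M + 3), (-1) ^ i * y n i) = coeff 0 (y M 0) := by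
  have h0 := hy.coeff_sum M
  obtain ⟨r, hr⟩ : ∃ r, Polynomial.C r = coeff M (fac h * ∑ n ∈ Finset.range (M + 1),
      kap ^ n * sumA y (2 * M + 3) n) :=
    ⟨_, (Polynomial.eq_C_of_natDegree_eq_zero
      (Polynomial.derivative_eq_zero.mp h0)).symm⟩
  have h1 : ∀ c, coeff M (spec c (fac h * ∑ n ∈ Finset.range (M + 1),
      kap ^ n * sumA y (2 * M + 3) n)) = r := by
    intro c
    rw [coeff_spec, ← hr, Polynomial.eval_C]
  -- comparison of the sewn sum, at `σ = 1`, with the trace, at `σ = 0`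
  have h2 := (h1 1).trans (h1 0).symm
  have hX : (1 - X : ℂ⟦X⟧) ≠ 0 := by simpa [sub_eq_add_neg] using one_add_smul_X_ne_zero (-1)
  have hX' : (1 + X : ℂ⟦X⟧) ≠ 0 := by simpa using one_add_smul_X_ne_zero 1
  have a1 : spec 1 a = -1 := by
    have := spec_a 1
    rw [map_one] at this
    refine mul_left_cancel₀ hX ?_
    linear_combination this
  have a0 : spec 0 a = 0 := by
    have := spec_a 0
    simpa using this
  have k1 : spec 1 kap = k := by
    have := spec_kap 1
    rw [map_one] at this
    refine mul_left_cancel₀ (pow_ne_zero 2 (mul_ne_zero hX hX')) ?_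
    linear_combination this - (1 - X) ^ 2 * hk
  have k0 : spec 0 kap = X := by
    have := spec_kap 0
    simpa using this
  have f1 : spec 1 (fac h) = PowerSeries.binomialSeries ℂ (-2 * h) := by
    have e1 : pw (-2 * h) (-1 : ℂ) = PowerSeries.binomialSeries ℂ (-2 * h) := by
      rw [pw, neg_neg, rescale_one, RingHom.id_apply]
    rw [fac, map_mul, map_mul, spec_pw, spec_pw, spec_pw, ← e1]
    simp only [sig, map_neg, map_pow, Polynomial.aeval_X, one_pow]
    rw [← mul_assoc, ← pw_add, show 2 * h + -2 * h = 0 by ring, pw_zero, one_mul]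
  have f0 : spec 0 (fac h) = 1 := by
    rw [fac, map_mul, map_mul, spec_pw, spec_pw, spec_pw]
    simp [sig, pw_zero_right]
  simp only [map_mul, map_sum, map_pow, sumA, spec_one_subst, spec_zero_subst, a1, a0, k1, k0, f1,
    f0,
    one_mul] at h2
  rw [h2, Finset.sum_eq_single M]
  · rw [Finset.sum_eq_single 0]
    · rw [pow_zero, one_mul, coeff_X_pow_mul', if_pos le_rfl, Nat.sub_self, coeff_C, if_pos rfl]
    · intro i _ hi
      rw [zero_pow hi, zero_mul]
    · simp
  · intro n hn hne
    rw [Finset.sum_eq_single 0]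
    · rw [Finset.mem_range] at hn
      rw [pow_zero, one_mul, coeff_X_pow_mul', if_pos (by omega), coeff_C, if_neg (by omega)]
    · intro i _ hi
      rw [zero_pow hi, zero_mul]
    · simp
  · simp

end Sewing

/-! ### Sewing of correlation functions -/

/-- The commutator of `F` with a power of `E` on an eigenvector of `H`. -/
theorem sl2_F_E_pow {T : Type*} [AddCommGroup T] [Module ℂ T] {E F H : Module.End ℂ T}
    (hEF : E * F - F * E = (2 : ℂ) • H) (hHE : H * E - E * H = -E) {x : T} {μ : ℂ}
    (hx : H x = μ • x) (i : ℕ) :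
    F ((E ^ (i + 1)) x) = (E ^ (i + 1)) (F x) - (((i : ℂ) + 1) * (2 * μ - i)) • (E ^ i) x := by
  have h1 : ∀ y, F (E y) = E (F y) - (2 : ℂ) • H y := fun y => by
    have := LinearMap.congr_fun hEF y
    simp only [LinearMap.sub_apply, Module.End.mul_apply, LinearMap.smul_apply] at this
    rw [← this]; abel
  have h2 : ∀ y, H (E y) = E (H y) - E y := fun y => by
    have := LinearMap.congr_fun hHE y
    simp only [LinearMap.sub_apply, Module.End.mul_apply, LinearMap.neg_apply] at this
    rw [sub_eq_iff_eq_add] at this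
    rw [this]; abel
  have h3 : ∀ j : ℕ, H ((E ^ j) x) = (μ - j) • (E ^ j) x := by
    intro j
    induction j with
    | zero => simpa using hx
    | succ j ih =>
      rw [pow_succ', Module.End.mul_apply, h2, ih, map_smul]
      push_cast
      module
  induction i with
  | zero =>
    simp only [zero_add, pow_one, pow_zero, Module.End.one_apply, h1, hx]
    push_cast
    module
  | succ i ih =>
    rw [pow_succ', Module.End.mul_apply, h1, ih, h3, map_sub, map_smul, Module.End.mul_apply,
      ← Module.End.mul_apply E (E ^ i), ← pow_succ']
    push_cast
    module

/-- The sum of a function of two indices over the antidiagonals, if it is supported in a square. -/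
theorem sum_antidiagonal_eq_square {A : Type*} [AddCommMonoid A] {n N : ℕ} (hN : 2 * n < N)
    {f : ℕ → ℕ → A} (h1 : ∀ a c, n < a → f a c = 0) (h2 : ∀ a c, n < c → f a c = 0) :
    ∑ i ∈ Finset.range N, ∑ p ∈ Finset.HasAntidiagonal.antidiagonal i, f p.1 p.2 =
      ∑ a ∈ Finset.range (n + 1), ∑ c ∈ Finset.range (n + 1), f a c := by
  rw [← Finset.sum_product' (Finset.range (n + 1)) (Finset.range (n + 1)) f,
    ← Finset.sum_fiberwise_of_maps_to (t := Finset.range N) (g := fun p : ℕ × ℕ => p.1 + p.2)]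
  · refine Finset.sum_congr rfl fun i _ => ?_
    symm
    refine Finset.sum_subset (fun p hp => ?_) fun p hp hp' => ?_
    · rw [Finset.mem_filter] at hp
      exact Finset.HasAntidiagonal.mem_antidiagonal.mpr hp.2
    · rw [Finset.HasAntidiagonal.mem_antidiagonal] at hp
      simp only [Finset.mem_filter, Finset.mem_product, Finset.mem_range, not_and] at hp'
      by_cases ha : n < p.1
      · exact h1 _ _ ha
      · exact h2 _ _ (by by_contra hc; exact hp' ⟨by omega, by omega⟩ hp)
  · intro p hp
    simp only [Finset.mem_product, Finset.mem_range] at hp ⊢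
    omega

namespace Sewing

variable {n : ℕ}

/-- The unit `(ξ - s) / (1 - s ξ)` of `ℂ⟦s⟧`. -/
def unitS (x : ℂˣ) : ℂ⟦X⟧ˣ :=
  Units.map (C : ℂ →+* ℂ⟦X⟧).toMonoidHom x * oneSub ((x⁻¹ : ℂˣ) : ℂ) * (oneSub (x : ℂ))⁻¹

/-- The unit `(1 - s²) / (1 - s ξ)²` of `ℂ⟦s⟧`. -/
def jacS (x : ℂˣ) : ℂ⟦X⟧ˣ :=
  oneSub 1 * oneSub (-1) * ((oneSub (x : ℂ))⁻¹ * (oneSub (x : ℂ))⁻¹)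

theorem unitS_mul (x : ℂˣ) : (unitS x : ℂ⟦X⟧) * (1 - C (x : ℂ) * X) = C (x : ℂ) - X := by
  rw [unitS, Units.val_mul, ← coe_oneSub, Units.inv_mul_cancel_right, Units.val_mul, coe_oneSub]
  change C (x : ℂ) * (1 - C ((x⁻¹ : ℂˣ) : ℂ) * X) = _
  have : (C (x : ℂ) * C ((x⁻¹ : ℂˣ) : ℂ) : ℂ⟦X⟧) = 1 := by rw [← map_mul, Units.mul_inv, map_one]
  linear_combination (-X) * this

theorem jacS_mul (x : ℂˣ) : (jacS x : ℂ⟦X⟧) * (1 - C (x : ℂ) * X) ^ 2 = 1 - X ^ 2 := by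
  have h := Units.inv_mul (oneSub (x : ℂ))
  rw [coe_oneSub] at h
  rw [jacS, Units.val_mul, Units.val_mul, Units.val_mul, coe_oneSub 1, coe_oneSub (-1), map_neg,
    map_one]
  linear_combination (1 - X ^ 2) *
    ((((oneSub (x : ℂ))⁻¹ : ℂ⟦X⟧ˣ) : ℂ⟦X⟧) * (1 - C (x : ℂ) * X) + 1) * h

/-- The logarithmic form of the equation `(1 - s²) dη/ds = η² - 1` for `η = (ξ - s) / (1 - s ξ)`. -/
theorem dlog_unitS (x : ℂˣ) : (1 - X ^ 2) * dlog (der ℂ) (unitS x) =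
    (unitS x : ℂ⟦X⟧) - (((unitS x)⁻¹ : ℂ⟦X⟧ˣ) : ℂ⟦X⟧) := by
  have h1 := unitS_mul x
  have h2 := congrArg (der ℂ) h1
  rw [Derivation.leibniz, apply_eq_dlog_mul, map_sub, map_sub, Derivation.leibniz, der_C, der_X,
    Derivation.map_one_eq_zero] at h2
  simp only [smul_eq_mul, mul_zero, add_zero, mul_one, zero_sub] at h2
  have h3 := Units.mul_inv (unitS x)
  set u : ℂ⟦X⟧ := (unitS x : ℂ⟦X⟧)
  set v : ℂ⟦X⟧ := (((unitS x)⁻¹ : ℂ⟦X⟧ˣ) : ℂ⟦X⟧)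
  set d := dlog (der ℂ) (unitS x)
  set c : ℂ⟦X⟧ := C (x : ℂ)
  have h0 : (1 - c * X) ≠ 0 := by
    rw [← coe_oneSub]; exact Units.ne_zero _
  have hu : u ≠ 0 := Units.ne_zero _
  refine mul_left_cancel₀ (mul_ne_zero (pow_ne_zero 2 h0) hu) ?_
  linear_combination (1 - X ^ 2) * (1 - c * X) * h2 + (1 - c * X) ^ 2 * h3
    - (u * (1 - c * X) + (c - X) - c * (1 - X ^ 2)) * h1

theorem dlog_jacS (x : ℂˣ) : (1 - X ^ 2) * dlog (der ℂ) (jacS x) = 2 * (unitS x : ℂ⟦X⟧) := by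
  have h1 := jacS_mul x
  have h4 := unitS_mul x
  have h2 := congrArg (der ℂ) h1
  rw [Derivation.leibniz, apply_eq_dlog_mul, Derivation.leibniz_pow, map_sub, map_sub,
    Derivation.leibniz, Derivation.leibniz_pow, der_C, der_X, Derivation.map_one_eq_zero] at h2
  simp only [smul_eq_mul, mul_zero, add_zero, mul_one, zero_sub, nsmul_eq_mul, pow_one,
    Nat.cast_ofNat,
    Nat.add_one_sub_one] at h2
  set u : ℂ⟦X⟧ := (unitS x : ℂ⟦X⟧)
  set d := dlog (der ℂ) (jacS x)
  set J : ℂ⟦X⟧ := (jacS x : ℂ⟦X⟧)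
  set c : ℂ⟦X⟧ := C (x : ℂ)
  have h0 : (1 - c * X) ≠ 0 := by
    rw [← coe_oneSub]; exact Units.ne_zero _
  have hJ : J ≠ 0 := Units.ne_zero _
  refine mul_left_cancel₀ (mul_ne_zero (pow_ne_zero 2 h0) hJ) ?_
  linear_combination (1 - X ^ 2) * h2 + 2 * X * h1 - 2 * J * (1 - c * X) * h4

end Sewing

namespace QuasiprimaryFields

open scoped TensorProduct

variable {n : ℕ} {U W : Type*} [AddCommGroup U] [Module ℂ U] [AddCommGroup W] [Module ℂ W]
  (S : QuasiprimaryFields n U W)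

/-- The operator `E ⊗ 1 + 1 ⊗ E` on `U ⊗ W`. -/
def ET : Module.End ℂ (U ⊗[ℂ] W) := LinearMap.rTensor W S.EU + LinearMap.lTensor U S.EW

/-- The operator `F ⊗ 1 + 1 ⊗ F` on `U ⊗ W`. -/
def FT : Module.End ℂ (U ⊗[ℂ] W) := LinearMap.rTensor W S.FU + LinearMap.lTensor U S.FW

/-- The operator `H ⊗ 1 + 1 ⊗ H` on `U ⊗ W`. -/
def HT : Module.End ℂ (U ⊗[ℂ] W) := LinearMap.rTensor W S.HU + LinearMap.lTensor U S.HW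

theorem ET_tmul (g : U) (w : W) : S.ET (g ⊗ₜ w) = S.EU g ⊗ₜ w + g ⊗ₜ S.EW w := by
  simp [ET]

theorem FT_tmul (g : U) (w : W) : S.FT (g ⊗ₜ w) = S.FU g ⊗ₜ w + g ⊗ₜ S.FW w := by
  simp [FT]

theorem HT_tmul (g : U) (w : W) : S.HT (g ⊗ₜ w) = S.HU g ⊗ₜ w + g ⊗ₜ S.HW w := by
  simp [HT]

theorem bracket_EFT : S.ET * S.FT - S.FT * S.ET = (2 : ℂ) • S.HT := by
  ext g w
  have h1 := LinearMap.congr_fun S.EFU g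
  have h2 := LinearMap.congr_fun S.EFW w
  simp only [LinearMap.sub_apply, Module.End.mul_apply, LinearMap.smul_apply] at h1 h2
  simp only [TensorProduct.AlgebraTensorModule.curry_apply, TensorProduct.curry_apply,
    LinearMap.coe_restrictScalars, LinearMap.sub_apply, Module.End.mul_apply, LinearMap.smul_apply,
    ET_tmul, FT_tmul, HT_tmul, map_add, smul_add, TensorProduct.smul_tmul', ← h1]
  rw [TensorProduct.smul_tmul, ← h2, TensorProduct.sub_tmul, TensorProduct.tmul_sub]
  abel

theorem bracket_HET : S.HT * S.ET - S.ET * S.HT = -S.ET := by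
  ext g w
  have h1 := LinearMap.congr_fun S.HEU g
  have h2 := LinearMap.congr_fun S.HEW w
  simp only [LinearMap.sub_apply, Module.End.mul_apply, LinearMap.neg_apply] at h1 h2
  simp only [TensorProduct.AlgebraTensorModule.curry_apply, TensorProduct.curry_apply,
    LinearMap.coe_restrictScalars, LinearMap.sub_apply, Module.End.mul_apply, LinearMap.neg_apply,
    ET_tmul, HT_tmul, map_add]
  rw [neg_add, ← TensorProduct.neg_tmul, ← TensorProduct.tmul_neg, ← h1, ← h2,
    TensorProduct.sub_tmul, TensorProduct.tmul_sub]
  abel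

theorem ET_pow_tmul (g : U) (w : W) (i : ℕ) : (i.factorial : ℂ)⁻¹ • (S.ET ^ i) (g ⊗ₜ[ℂ] w) =
    ∑ p ∈ Finset.HasAntidiagonal.antidiagonal i,
      ((p.1.factorial : ℂ)⁻¹ * (p.2.factorial : ℂ)⁻¹) • ((S.EU ^ p.1) g ⊗ₜ[ℂ] (S.EW ^ p.2) w) := by
  have hc : Commute (LinearMap.rTensor W S.EU) (LinearMap.lTensor U S.EW) := by
    rw [Commute, SemiconjBy, Module.End.mul_eq_comp, Module.End.mul_eq_comp,
      LinearMap.rTensor_comp_lTensor, LinearMap.lTensor_comp_rTensor]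
  have h1 : ∀ (a : ℕ) (g : U) (w : W),
      ((LinearMap.rTensor W S.EU) ^ a) (g ⊗ₜ[ℂ] w) = (S.EU ^ a) g ⊗ₜ[ℂ] w := by
    intro a
    induction a with
    | zero => intro g w; rfl
    | succ a ih => intro g w; rw [pow_succ, Module.End.mul_apply, LinearMap.rTensor_tmul, ih]; rfl
  have h2 : ∀ (a : ℕ) (g : U) (w : W),
      ((LinearMap.lTensor U S.EW) ^ a) (g ⊗ₜ[ℂ] w) = g ⊗ₜ[ℂ] (S.EW ^ a) w := by
    intro a
    induction a with
    | zero => intro g w; rfl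
    | succ a ih => intro g w; rw [pow_succ, Module.End.mul_apply, LinearMap.lTensor_tmul, ih]; rfl
  rw [ET, hc.add_pow', LinearMap.sum_apply, Finset.smul_sum]
  refine Finset.sum_congr rfl fun p hp => ?_
  rw [Finset.HasAntidiagonal.mem_antidiagonal] at hp
  rw [LinearMap.smul_apply, Module.End.mul_apply, h2, h1, ← Nat.cast_smul_eq_nsmul ℂ, smul_smul]
  congr 1
  rw [← hp, Nat.cast_add_choose]
  have h3 : ((p.1 + p.2).factorial : ℂ) ≠ 0 := by exact_mod_cast (p.1 + p.2).factorial_ne_zero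
  field_simp

/-- The unit `∏ ((1 - s²) / (1 - s ξ_i)²)^(λ_i)` of `ℂ⟦s⟧`. -/
def jacProd (x : Fin n → ℂˣ) : ℂ⟦X⟧ˣ := ∏ i, Sewing.jacS (x i) ^ S.lam i

/-- The numerator of the correlation function attached to a tensor, with the variables moved along
the flow `ξ ↦ (ξ - s) / (1 - s ξ)`. -/
def flowS (x : Fin n → ℂˣ) : U ⊗[ℂ] W →ₗ[ℂ] ℂ⟦X⟧ where
  toFun t := ev (fun i => Sewing.unitS (x i)) (TensorProduct.lift S.poly t) * (S.jacProd x : ℂ⟦X⟧)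
  map_add' t t' := by rw [map_add, map_add, add_mul]
  map_smul' a t := by rw [map_smul, map_smul, smul_mul_assoc, RingHom.id_apply]

theorem flowS_apply (x : Fin n → ℂˣ) (t : U ⊗[ℂ] W) : S.flowS x t =
    ev (fun i => Sewing.unitS (x i)) (TensorProduct.lift S.poly t) * (S.jacProd x : ℂ⟦X⟧) := rfl

/-- The flow is generated by `F - E`. -/
theorem der_flowS (x : Fin n → ℂˣ) (t : U ⊗[ℂ] W) :
    (1 - X ^ 2) * der ℂ (S.flowS x t) = S.flowS x (S.FT t) - S.flowS x (S.ET t) := by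
  induction t using TensorProduct.induction_on with
  | zero => simp
  | add t t' h h' =>
    simp only [map_add, mul_add, h, h']
    ring
  | tmul g w =>
    have h1 := congrArg (ev fun i => Sewing.unitS (x i)) (S.ward_E g w)
    have h2 := congrArg (ev fun i => Sewing.unitS (x i)) (S.ward_F g w)
    simp only [map_sub, map_sum, map_mul, map_add, map_smul, ev_X] at h1 h2
    have h3 : ∀ i, ev (fun i => Sewing.unitS (x i)) (mono (-Pi.single i 1)) =
        (((Sewing.unitS (x i))⁻¹ : ℂ⟦X⟧ˣ) : ℂ⟦X⟧) := by
      intro i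
      have := congrArg (ev fun i => Sewing.unitS (x i)) (X_mul_mono_neg i)
      rw [map_mul, map_one, ev_X] at this
      exact (Units.inv_eq_of_mul_eq_one_right this).symm
    simp only [h3] at h2
    have h4 : (1 - X ^ 2) * dlog (der ℂ) (S.jacProd x) =
        ∑ i, (2 * S.lam i : ℂ) • (Sewing.unitS (x i) : ℂ⟦X⟧) := by
      rw [jacProd, dlog_prod, Finset.mul_sum]
      refine Finset.sum_congr rfl fun i _ => ?_
      rw [dlog_zpow, mul_left_comm, Sewing.dlog_jacS]
      simp only [Algebra.smul_def, map_mul, map_ofNat, map_intCast]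
      ring
    have h5 : (1 - X ^ 2) * der ℂ (ev (fun i => Sewing.unitS (x i)) (S.poly g w)) =
        ∑ i, ev (fun i => Sewing.unitS (x i)) (euler i (S.poly g w)) *
          ((Sewing.unitS (x i) : ℂ⟦X⟧) - (((Sewing.unitS (x i))⁻¹ : ℂ⟦X⟧ˣ) : ℂ⟦X⟧)) := by
      rw [derivation_ev_dlog, Finset.mul_sum]
      refine Finset.sum_congr rfl fun i _ => ?_
      rw [mul_left_comm, Sewing.dlog_unitS]
    simp only [flowS_apply, ET_tmul, FT_tmul, map_add, TensorProduct.lift.tmul]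
    rw [Derivation.leibniz, apply_eq_dlog_mul]
    simp only [smul_eq_mul]
    have h6 := congrArg₂ (· - ·) h1 h2
    simp only [← Finset.sum_sub_distrib] at h6
    have h7 : (1 - X ^ 2) * der ℂ (ev (fun i => Sewing.unitS (x i)) (S.poly g w)) +
        ev (fun i => Sewing.unitS (x i)) (S.poly g w) *
          ((1 - X ^ 2) * dlog (der ℂ) (S.jacProd x)) =
        ∑ i, ((Sewing.unitS (x i) : ℂ⟦X⟧) *
          (ev (fun i => Sewing.unitS (x i)) (euler i (S.poly g w)) +
            (2 * S.lam i : ℂ) • ev (fun i => Sewing.unitS (x i)) (S.poly g w)) -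
          (((Sewing.unitS (x i))⁻¹ : ℂ⟦X⟧ˣ) : ℂ⟦X⟧) *
            ev (fun i => Sewing.unitS (x i)) (euler i (S.poly g w))) := by
      rw [h4, h5, Finset.mul_sum, ← Finset.sum_add_distrib]
      refine Finset.sum_congr rfl fun i _ => ?_
      simp only [Algebra.smul_def]
      ring
    rw [← h6] at h7
    linear_combination (S.jacProd x : ℂ⟦X⟧) * h7

/-- The image of `exp(-E) g ⊗ exp(-E) w`, moved along the flow. The sums are cut off at `N`. -/
def sewTerm (N : ℕ) (x : Fin n → ℂˣ) (g : U) (w : W) : ℂ⟦X⟧ :=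
  (∑ a ∈ Finset.range (N + 1), ∑ c ∈ Finset.range (N + 1),
    ((-1) ^ (a + c) * ((a.factorial : ℂ)⁻¹ * (c.factorial : ℂ)⁻¹)) •
      ev (fun i => Sewing.unitS (x i)) (S.poly ((S.EU ^ a) g) ((S.EW ^ c) w))) *
    (S.jacProd x : ℂ⟦X⟧)

theorem pow_apply_eq_zero {T : Type*} [AddCommGroup T] [Module ℂ T] {E : Module.End ℂ T} {N a : ℕ}
    {x : T} (h : (E ^ (N + 1)) x = 0) (ha : N < a) : (E ^ a) x = 0 := by
  obtain ⟨d, rfl⟩ := Nat.exists_eq_add_of_lt ha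
  rw [show N + d + 1 = d + (N + 1) by ring, pow_add, Module.End.mul_apply, h, map_zero]

theorem ET_pow_tmul_eq_zero {N i : ℕ} (hi : 2 * N < i) {g : U} {w : W}
    (hg : (S.EU ^ (N + 1)) g = 0) (hw : (S.EW ^ (N + 1)) w = 0) :
    (S.ET ^ i) (g ⊗ₜ[ℂ] w) = 0 := by
  have h := S.ET_pow_tmul g w i
  have h0 : (i.factorial : ℂ)⁻¹ ≠ 0 := inv_ne_zero (by exact_mod_cast i.factorial_ne_zero)
  refine (smul_eq_zero.mp ?_).resolve_left h0
  rw [h]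
  refine Finset.sum_eq_zero fun p hp => ?_
  rw [Finset.HasAntidiagonal.mem_antidiagonal] at hp
  rcases Nat.lt_or_ge N p.1 with h1 | h1
  · rw [pow_apply_eq_zero hg h1, TensorProduct.zero_tmul, smul_zero]
  · rw [pow_apply_eq_zero hw (by omega : N < p.2), TensorProduct.tmul_zero, smul_zero]

theorem sum_flowS_eq_sewTerm {N M : ℕ} (hM : 2 * N < M) (x : Fin n → ℂˣ) {g : U} {w : W}
    (hg : (S.EU ^ (N + 1)) g = 0) (hw : (S.EW ^ (N + 1)) w = 0) :
    ∑ i ∈ Finset.range M, (-1) ^ i * (i.factorial : ℂ)⁻¹ • S.flowS x ((S.ET ^ i) (g ⊗ₜ[ℂ] w)) =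
      S.sewTerm N x g w := by
  have h1 : ∀ i ∈ Finset.range M,
      (-1) ^ i * (i.factorial : ℂ)⁻¹ • S.flowS x ((S.ET ^ i) (g ⊗ₜ[ℂ] w)) =
      ∑ p ∈ Finset.HasAntidiagonal.antidiagonal i,
        (((-1) ^ (p.1 + p.2) * ((p.1.factorial : ℂ)⁻¹ * (p.2.factorial : ℂ)⁻¹)) •
          ev (fun i => Sewing.unitS (x i)) (S.poly ((S.EU ^ p.1) g) ((S.EW ^ p.2) w))) *
        (S.jacProd x : ℂ⟦X⟧) := by
    intro i _
    rw [← map_smul, ET_pow_tmul, map_sum, Finset.mul_sum]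
    refine Finset.sum_congr rfl fun p hp => ?_
    rw [Finset.HasAntidiagonal.mem_antidiagonal] at hp
    rw [map_smul, flowS_apply, TensorProduct.lift.tmul, hp]
    simp only [Algebra.smul_def, map_mul, map_pow, map_neg, map_one]
    ring
  rw [Finset.sum_congr rfl h1, sum_antidiagonal_eq_square hM (f := fun a c =>
        (((-1) ^ (a + c) * ((a.factorial : ℂ)⁻¹ * (c.factorial : ℂ)⁻¹)) •
          ev (fun i => Sewing.unitS (x i)) (S.poly ((S.EU ^ a) g) ((S.EW ^ c) w))) *
        (S.jacProd x : ℂ⟦X⟧)), sewTerm, Finset.sum_mul]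
  · exact Finset.sum_congr rfl fun a _ => by rw [Finset.sum_mul]
  · intro a c ha
    simp only [pow_apply_eq_zero hg ha, map_zero, LinearMap.zero_apply, smul_zero, zero_mul]
  · intro a c hc
    simp only [pow_apply_eq_zero hw hc, map_zero, smul_zero, zero_mul]

theorem constCoeff_flowS (x : Fin n → ℂˣ) (g : U) (w : W) :
    coeff 0 (S.flowS x (g ⊗ₜ[ℂ] w)) = ev x (S.poly g w) := by
  have h1 : (fun i => Units.map (constHom ℂ : ℂ⟦X⟧ →* ℂ) (Sewing.unitS (x i))) = x := by
    funext i
    rw [Sewing.unitS, map_mul, map_mul, map_inv, constHom_oneSub, constHom_oneSub, inv_one, mul_one,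
      mul_one]
    ext1
    exact constHom_C _
  have h2 : constHom ℂ (S.jacProd x : ℂ⟦X⟧) = 1 := by
    have : Units.map (constHom ℂ : ℂ⟦X⟧ →* ℂ) (S.jacProd x) = 1 := by
      simp [jacProd, Sewing.jacS, constHom_oneSub]
    exact congrArg Units.val this
  rw [← constHom_apply, flowS_apply, map_mul, h2, mul_one, map_ev, h1, TensorProduct.lift.tmul]

/-- Sewing: for canonical tensors `Ω_m = ∑ g_i ⊗ w_i` with `F Ω_m = E Ω_{m+1}`, the sum over bases
of the graded pieces of the sewn correlation functions is the trace of the product of the fields. -/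
theorem sewing {h : ℂ} {ι : ℕ → Type*} [∀ m, Fintype (ι m)] {g : ∀ m, ι m → U} {w : ∀ m, ι m → W}
    (hHg : ∀ m i, S.HU (g m i) = (h + m) • g m i) (hHw : ∀ m i, S.HW (w m i) = (h + m) • w m i)
    (hEg : ∀ m i, (S.EU ^ (m + 1)) (g m i) = 0) (hEw : ∀ m i, (S.EW ^ (m + 1)) (w m i) = 0)
    (hFE : ∀ m, S.FT (∑ i, g m i ⊗ₜ[ℂ] w m i) = S.ET (∑ i, g (m + 1) i ⊗ₜ[ℂ] w (m + 1) i))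
    (x : Fin n → ℂˣ) {k : ℂ⟦X⟧} (hk : (1 + X) ^ 2 * k = X) (M : ℕ) :
    coeff M (PowerSeries.binomialSeries ℂ (-2 * h) * ∑ m ∈ Finset.range (M + 1),
      k ^ m * ∑ i, S.sewTerm m x (g m i) (w m i)) = ∑ i, ev x (S.poly (g M i) (w M i)) := by
  set Ω : ℕ → U ⊗[ℂ] W := fun m => ∑ i, g m i ⊗ₜ[ℂ] w m i with hΩ
  set y : ℕ → ℕ → ℂ⟦X⟧ := fun m i => (i.factorial : ℂ)⁻¹ • S.flowS x ((S.ET ^ i) (Ω m)) with hy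
  have hH : ∀ m, S.HT (Ω m) = (2 * (h + m)) • Ω m := by
    intro m
    rw [hΩ, map_sum, Finset.smul_sum]
    refine Finset.sum_congr rfl fun i _ => ?_
    rw [HT_tmul, hHg, hHw, TensorProduct.tmul_smul, ← TensorProduct.smul_tmul', ← add_smul]
    ring_nf
  have sys : Sewing.System h y := by
    refine ⟨fun m => ?_, fun m i => ?_, fun m i hi => ?_⟩
    · simp only [hy, Nat.factorial_zero, Nat.cast_one, inv_one, one_smul, pow_zero,
        Module.End.one_apply, Nat.factorial_one, pow_one]
      rw [der_flowS, hFE]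
    · simp only [hy]
      rw [Derivation.map_smul, mul_smul_comm, der_flowS,
        sl2_F_E_pow S.bracket_EFT S.bracket_HET (hH m) i, hFE, map_sub, map_smul,
        ← Module.End.mul_apply, ← pow_succ, ← Module.End.mul_apply S.ET, ← pow_succ']
      have e1 : ((i : ℂ) + 2) * ((i + 2).factorial : ℂ)⁻¹ = ((i + 1).factorial : ℂ)⁻¹ := by
        have := inv_factorial_succ (i + 1)
        push_cast at this
        rw [← this]; ring
      have e2 := inv_factorial_succ i
      rw [smul_smul, smul_smul, smul_smul, e1, ← e2]
      module
    · simp only [hy, hΩ]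
      rw [map_sum, Finset.sum_eq_zero fun j _ => S.ET_pow_tmul_eq_zero hi (hEg m j) (hEw m j),
        map_zero,
        smul_zero]
  have h1 := sys.sewing hk M
  have h2 : ∀ m ∈ Finset.range (M + 1), k ^ m * ∑ i, S.sewTerm m x (g m i) (w m i) =
      k ^ m * ∑ i ∈ Finset.range (2 * M + 3), (-1) ^ i * y m i := by
    intro m hm
    rw [Finset.mem_range] at hm
    congr 1
    rw [Finset.sum_congr rfl fun i _ => (S.sum_flowS_eq_sewTerm (by omega : 2 * m < 2 * M + 3) x
      (hEg m i) (hEw m i)).symm, Finset.sum_comm]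
    refine Finset.sum_congr rfl fun i _ => ?_
    simp only [hy, hΩ]
    rw [map_sum, map_sum, Finset.smul_sum, Finset.mul_sum]
  rw [Finset.sum_congr rfl h2, h1]
  simp only [hy, hΩ, Nat.factorial_zero, Nat.cast_one, inv_one, one_smul, pow_zero,
    Module.End.one_apply]
  rw [map_sum, map_sum]
  exact Finset.sum_congr rfl fun i _ => S.constCoeff_flowS x _ _

end QuasiprimaryFields

/-! ### Consequences of the Jacobi identity -/

namespace VOA

section modes

variable {V W : Type*} [AddCommGroup V] [Module ℂ V] [AddCommGroup W] [Module ℂ W]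
  (Y : V →ₗ[ℂ] VertexOperator ℂ W)

theorem mode_eq_coeffZ (u : V) (n : ℤ) : mode Y u n = coeffZ Y (-n - 1) u := rfl

theorem coeffZ_eq_mode (u : V) (k : ℤ) : coeffZ Y k u = mode Y u (-k - 1) := by
  rw [mode_eq_coeffZ, neg_sub, sub_neg_eq_add, add_sub_cancel_left]

/-- Lower truncation of fields. -/
theorem exists_coeffZ_eq_zero (u : V) (w : W) : ∃ B : ℤ, ∀ k, k < B → coeffZ Y k u w = 0 :=
  ⟨_, fun k hk => VertexOperator.coeff_eq_zero_of_lt_order (Y u) k w hk⟩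

theorem exists_mode_eq_zero (u : V) (w : W) : ∃ B : ℤ, ∀ n, B ≤ n → mode Y u n w = 0 := by
  obtain ⟨B, hB⟩ := exists_coeffZ_eq_zero Y u w
  exact ⟨-B, fun n hn => hB _ (by omega)⟩

end modes

variable {V : Type*} [AddCommGroup V] [Module ℂ V] {𝒱 : VOA V}

/-- A homogeneous vector of weight `N` which is killed by `L(1)`. -/
structure IsQuasiprimary (𝒱 : VOA V) (v : V) (N : ℕ) : Prop where
  mem : v ∈ 𝒱.gr N
  L1 : 𝒱.L 1 v = 0

namespace OrdinaryModule

variable {W : Type*} [AddCommGroup W] [Module ℂ W] (M : 𝒱.OrdinaryModule W)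

/-- The commutator formula for nonnegative modes. -/
theorem commutator (u v : V) (N : ℕ) (n : ℤ) (w : W) :
    mode M.Y u N (mode M.Y v n w) - mode M.Y v n (mode M.Y u N w) =
      ∑ i ∈ Finset.range (N + 1), (N.choose i : ℂ) • mode M.Y (mode 𝒱.Y u i v) (N + n - i) w := by
  have h := M.jacobi u v w 0 N n
  rw [finsum_eq_sum_of_support_subset (s := Finset.range (N + 1)),
    finsum_eq_sum_of_support_subset (s := Finset.range 1)] at h
  · simp only [Finset.sum_range_one, Ring.choose_natCast, Ring.choose_zero_right, zero_add,
      pow_zero,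
      Nat.cast_zero, sub_zero, add_zero, zpow_zero, one_smul, Int.cast_one, one_mul,
      Int.cast_natCast] at h
    exact h.symm
  · intro i hi
    by_contra hc
    have : 0 < i := by simp at hc; omega
    exact hi (by simp [Ring.choose_zero_pos ℤ this])
  · intro i hi
    by_contra hc
    have : N < i := by simp at hc; omega
    exact hi (by simp [Ring.choose_natCast, Nat.choose_eq_zero_of_lt this])

/-- The commutators of `L(-1)`, `L(0)` and `L(1)` with the modes of a quasiprimary vector. -/
theorem commutator_quasiprimary {v : V} {N : ℕ} (hv : 𝒱.IsQuasiprimary v N) {j : ℕ} (hj : j ≤ 2)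
    (n : ℤ) (w : W) :
    mode M.Y 𝒱.ω j (mode M.Y v n w) - mode M.Y v n (mode M.Y 𝒱.ω j w) =
      ((j : ℂ) * N - j - n) • mode M.Y v (j + n - 1) w := by
  have h0 := M.translation v
  have h1 : mode 𝒱.Y 𝒱.ω 1 v = (N : ℂ) • v := Module.End.mem_eigenspace_iff.mp hv.mem
  have h2 : mode 𝒱.Y 𝒱.ω 2 v = 0 := hv.L1
  have hs : ∀ (a : ℂ) (n : ℤ), mode M.Y (a • v) n w = a • mode M.Y v n w := fun a n => by simp [mode]
  have hz : ∀ n : ℤ, mode M.Y 0 n w = 0 := fun n => by simp [mode]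
  rw [commutator]
  interval_cases j
  · simp only [zero_add, Finset.sum_range_one, Nat.choose_self, Nat.cast_one, one_smul,
      Nat.cast_zero,
      sub_zero]
    rw [h0]
    simp
  · simp only [Finset.sum_range_succ, Finset.range_zero, Finset.sum_empty, Nat.reduceAdd, zero_add]
    simp only [Nat.choose_zero_right, Nat.choose_self, Nat.cast_one, Nat.cast_zero, one_smul,
      sub_zero]
    rw [h0, h1, hs]
    push_cast
    module
  · simp only [Finset.sum_range_succ, Finset.range_zero, Finset.sum_empty, Nat.reduceAdd, zero_add]
    simp only [Nat.choose_zero_right, Nat.choose_self, Nat.cast_one, Nat.cast_zero, one_smul,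
      sub_zero,
      Nat.cast_ofNat, Nat.choose_one_right]
    rw [h0, h1, h2, hs, hz]
    push_cast
    module

theorem commutator_coeffZ {v : V} {N : ℕ} (hv : 𝒱.IsQuasiprimary v N) {j : ℕ} (hj : j ≤ 2)
    (k : ℤ) (w : W) :
    mode M.Y 𝒱.ω j (coeffZ M.Y k v w) - coeffZ M.Y k v (mode M.Y 𝒱.ω j w) =
      ((j : ℂ) * N - j + k + 1) • coeffZ M.Y (k + 1 - j) v w := by
  rw [coeffZ_eq_mode, commutator_quasiprimary M hv hj, coeffZ_eq_mode]
  congr 1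
  · push_cast; ring
  · congr 2; ring

/-- Mutual locality of the fields of a module: the Jacobi identity with vanishing products
`u_n v` for `n ≥ K`. -/
theorem local_modes {u v : V} {K : ℕ} (hK : ∀ n : ℤ, K ≤ n → mode 𝒱.Y u n v = 0) (m n : ℤ) (w : W) :
    ∑ i ∈ Finset.range (K + 1), ((-1 : ℂ) ^ (K - i) * (K.choose i : ℂ)) •
        mode M.Y u (m - i) (mode M.Y v (n + i) w) =
      ∑ i ∈ Finset.range (K + 1), ((-1 : ℂ) ^ (K - i) * (K.choose i : ℂ)) •
        mode M.Y v (n + i) (mode M.Y u (m - i) w) := by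
  have h := M.jacobi u v w K (m - K) n
  rw [finsum_eq_zero_of_forall_eq_zero fun i => by rw [hK _ (by omega)]; simp [mode],
    finsum_eq_sum_of_support_subset (s := Finset.range (K + 1))] at h
  · simp only [Ring.choose_natCast, smul_sub, Finset.sum_sub_distrib, sub_add_cancel,
      Int.cast_natCast] at h
    have h2 := (sub_eq_zero.mp h.symm)
    have hsq : ((-1 : ℂ) ^ K) * (-1) ^ K = 1 := by rw [← mul_pow]; simp
    have e : ∀ i ∈ Finset.range (K + 1), (-1 : ℂ) ^ (K - i) = (-1) ^ K * (-1) ^ i := by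
      intro i hi
      have hi' : i ≤ K := by simpa [Nat.lt_succ_iff] using hi
      have hi2 : ((-1 : ℂ) ^ i) * (-1) ^ i = 1 := by rw [← mul_pow]; simp
      obtain ⟨d, rfl⟩ := Nat.exists_eq_add_of_le hi'
      rw [Nat.add_sub_cancel_left, pow_add]
      linear_combination (-(-1 : ℂ) ^ d) * hi2
    have h3 := congrArg (((-1 : ℂ) ^ K) • ·) h2
    simp only [Finset.smul_sum, smul_smul] at h3
    rw [Finset.sum_congr rfl fun i hi => by rw [e i hi, mul_assoc], h3,
      ← Finset.sum_range_reflect]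
    refine Finset.sum_congr rfl fun i hi => ?_
    have hi' : i ≤ K := by simpa [Nat.lt_succ_iff] using hi
    rw [Nat.add_sub_cancel, Nat.choose_symm hi', zpow_natCast]
    have e1 : n + (K : ℤ) - ((K - i : ℕ) : ℤ) = n + i := by push_cast [hi']; ring
    have e2 : m - (K : ℤ) + ((K - i : ℕ) : ℤ) = m - i := by push_cast [hi']; ring
    rw [e1, e2]
    congr 1
    linear_combination ((-1 : ℂ) ^ (K - i) * (K.choose i : ℂ)) * hsq
  · intro i hi
    by_contra hc
    have : K < i := by simp at hc; omega
    exact hi (by simp [Ring.choose_natCast, Nat.choose_eq_zero_of_lt this])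

/-- The spaces `W_{h+n}` exhaust all the generalised weights. -/
theorem eq_zero_of_mem_eigenspace {μ : ℂ} (hμ : ∀ n : ℕ, μ ≠ M.h + n) {w : W}
    (hw : w ∈ Module.End.eigenspace (mode M.Y 𝒱.ω 1) μ) : w = 0 := by
  have h1 := (Module.End.eigenspaces_iSupIndep (mode M.Y 𝒱.ω 1)) μ
  have h2 : (⊤ : Submodule ℂ W) ≤ ⨆ j, ⨆ (_ : j ≠ μ), Module.End.eigenspace (mode M.Y 𝒱.ω 1) j := by
    rw [← M.grading.submodule_iSup_eq_top]
    exact iSup_le fun n => le_iSup₂_of_le (M.h + n) (fun h => hμ n h.symm) le_rfl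
  exact (Submodule.disjoint_def.mp h1) w hw (h2 trivial)

/-- Linear maps which agree on the weight spaces are equal. -/
theorem ext_gr {T : Type*} [AddCommGroup T] [Module ℂ T] {f g : W →ₗ[ℂ] T}
    (h : ∀ n, ∀ w ∈ M.gr n, f w = g w) : f = g := by
  have h1 : (⊤ : Submodule ℂ W) ≤ LinearMap.eqLocus f g := by
    have h2 : (⨆ n, M.gr n) = ⊤ := M.grading.submodule_iSup_eq_top
    rw [← h2]
    exact iSup_le fun n w hw => h n w hw
  ext w
  exact h1 (Submodule.mem_top (x := w))

/-- Weight considerations for the modes of a homogeneous vector. -/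
theorem mode_mem_gr {u : V} {N n m : ℕ} (hu : u ∈ 𝒱.gr N) {k : ℤ} {w : W} (hw : w ∈ M.gr n)
    (e : (n : ℤ) + N - k - 1 = m) : mode M.Y u k w ∈ M.gr m := by
  have h := M.mode_mem_eigenspace k hu hw
  have e2 : ((m : ℤ) : ℂ) = ((n + N - k - 1 : ℤ) : ℂ) := by rw [e]
  push_cast at e2
  rw [gr, e2]
  convert h using 2
  ring

theorem mode_eq_zero {u : V} {N n : ℕ} (hu : u ∈ 𝒱.gr N) {k : ℤ} {w : W} (hw : w ∈ M.gr n)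
    (e : (n : ℤ) + N - k - 1 < 0) : mode M.Y u k w = 0 := by
  refine M.eq_zero_of_mem_eigenspace (fun m h => ?_) (M.mode_mem_eigenspace k hu hw)
  have : ((n + N - k - 1 : ℤ) : ℂ) = ((m : ℤ) : ℂ) := by push_cast; linear_combination h
  have := Int.cast_injective this
  omega

theorem _root_.VOA.ω_mem_gr (𝒱 : VOA V) : 𝒱.ω ∈ 𝒱.gr 2 := by
  have := 𝒱.ω_mem
  rwa [VOA.gr, Nat.cast_ofNat]

theorem Lm1_pow_mem {n : ℕ} {w : W} (hw : w ∈ M.gr n) (j : ℕ) :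
    ((mode M.Y 𝒱.ω 0) ^ j) w ∈ M.gr (n + j) := by
  induction j with
  | zero => simpa using hw
  | succ j ih =>
    rw [pow_succ', Module.End.mul_apply]
    exact M.mode_mem_gr 𝒱.ω_mem_gr ih (by push_cast; ring)

theorem L1_pow_mem_gr {n : ℕ} {w : W} (hw : w ∈ M.gr n) {j : ℕ} (hj : j ≤ n) :
    ((mode M.Y 𝒱.ω 2) ^ j) w ∈ M.gr (n - j) := by
  induction j with
  | zero => simpa using hw
  | succ j ih =>
    rw [pow_succ', Module.End.mul_apply]
    exact M.mode_mem_gr 𝒱.ω_mem_gr (ih (by omega)) (by push_cast [hj, (by omega : j ≤ n)]; ring)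

theorem L1_pow_eq_zero {n : ℕ} {w : W} (hw : w ∈ M.gr n) : ((mode M.Y 𝒱.ω 2) ^ (n + 1)) w = 0 := by
  rw [pow_succ', Module.End.mul_apply]
  exact M.mode_eq_zero 𝒱.ω_mem_gr (M.L1_pow_mem_gr hw le_rfl) (by simp)

end OrdinaryModule

theorem quasiprimary_ω (𝒱 : VOA V) : 𝒱.IsQuasiprimary 𝒱.ω 2 := by
  refine ⟨𝒱.ω_mem_gr, ?_⟩
  have h := 𝒱.virasoro 1 (-2) 𝒱.vac
  have c := 𝒱.creation 𝒱.ω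
  norm_num [c.1, c.2] at h
  exact h

theorem quasiprimary_vac (𝒱 : VOA V) : 𝒱.IsQuasiprimary 𝒱.vac 0 := by
  refine ⟨by simpa [gr] using 𝒱.vac_mem, (𝒱.creation 𝒱.ω).2 _ (by norm_num)⟩

end VOA

/-! ### The contragredient module -/

namespace VOA
namespace OrdinaryModule

variable {V : Type*} [AddCommGroup V] [Module ℂ V] {𝒱 : VOA V}
  {W : Type*} [AddCommGroup W] [Module ℂ W] (M : 𝒱.OrdinaryModule W)

/-- For a quasiprimary vector, the exponential of `L(1)` in the adjoint vertex operator is trivial. -/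
theorem dagger_quasiprimary {v : V} {N : ℕ} (hv : 𝒱.IsQuasiprimary v N) (k : ℤ) :
    M.dagger k v = (-1 : ℂ) ^ N • coeffZ M.Y (-2 * N - k) v := by
  have h0 : ∀ j : ℕ, ((𝒱.L 1) ^ (j + 1)) v = 0 := fun j => by
    rw [pow_succ, Module.End.mul_apply, hv.L1, map_zero]
  simp only [dagger, LinearMap.comp_apply, LinearEquiv.coe_coe, 𝒱.decompose_of_mem hv.mem,
    DirectSum.toModule_lof, Submodule.subtype_apply, LinearMap.sum_apply, LinearMap.smul_apply]
  rw [Finset.sum_range_succ']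
  simp only [h0, map_zero, smul_zero, Finset.sum_const_zero, zero_add, pow_zero,
    Module.End.one_apply, Nat.cast_zero, Nat.factorial_zero, Nat.cast_one, div_one]
  congr 3
  ring

theorem coeffZ_contraY (u : V) (k : ℤ) : coeffZ M.contraY k u = M.contraCoeff u k := by
  ext1 f
  rfl

theorem coeffZ_contraY_apply (u : V) (k : ℤ) (f : M.restrictedDual) (w : W) :
    (coeffZ M.contraY k u f : Module.Dual ℂ W) w = (f : Module.Dual ℂ W) (M.dagger k u w) := by
  rw [coeffZ_contraY]
  rfl

/-- The transpose of the mode `L(j - 1)`. -/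
def dualMode (j : ℕ) : Module.End ℂ M.restrictedDual where
  toFun f := ⟨(f : Module.Dual ℂ W) ∘ₗ mode M.Y 𝒱.ω j, by
    obtain ⟨B, hB⟩ := f.2
    refine ⟨B + j, fun n hn w hw => hB (n + 1 - j) (by omega) _ ?_⟩
    refine M.mode_mem_gr 𝒱.ω_mem_gr hw ?_
    push_cast [(by omega : j ≤ n + 1)]
    ring⟩
  map_add' f g := by ext; simp
  map_smul' a f := by ext; simp

theorem dualMode_apply (j : ℕ) (f : M.restrictedDual) (w : W) :
    (M.dualMode j f : Module.Dual ℂ W) w = (f : Module.Dual ℂ W) (mode M.Y 𝒱.ω j w) := rfl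

theorem dual_ext {f g : M.restrictedDual}
    (h : ∀ w, (f : Module.Dual ℂ W) w = (g : Module.Dual ℂ W) w) : f = g :=
  Subtype.ext (LinearMap.ext h)

theorem commutator_ω {i j : ℕ} (hj : j ≤ 2) :
    mode M.Y 𝒱.ω j * mode M.Y 𝒱.ω i - mode M.Y 𝒱.ω i * mode M.Y 𝒱.ω j =
      ((j : ℂ) - i) • mode M.Y 𝒱.ω ((j : ℤ) + i - 1) := by
  ext w
  have h := M.commutator_quasiprimary 𝒱.quasiprimary_ω hj i w
  simp only [LinearMap.sub_apply, Module.End.mul_apply, LinearMap.smul_apply, h]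
  congr 1
  push_cast
  ring

theorem commutator_dualMode {j : ℕ} (hj : j ≤ 2) (f : M.restrictedDual) (i : ℕ) (w : W) :
    (M.dualMode i (M.dualMode j f) : Module.Dual ℂ W) w
      - (M.dualMode j (M.dualMode i f) : Module.Dual ℂ W) w =
      ((j : ℂ) - i) • (f : Module.Dual ℂ W) (mode M.Y 𝒱.ω ((j : ℤ) + i - 1) w) := by
  have h := LinearMap.congr_fun (M.commutator_ω (i := i) hj) w
  simp only [LinearMap.sub_apply, Module.End.mul_apply, LinearMap.smul_apply] at h
  rw [dualMode_apply, dualMode_apply, dualMode_apply, dualMode_apply, ← map_sub, h, map_smul]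

/-- The commutators of the transposes of `L(-1)`, `L(0)`, `L(1)` with the fields of the
contragredient module. -/
theorem commutator_dualMode_coeffZ {v : V} {N : ℕ} (hv : 𝒱.IsQuasiprimary v N) {j : ℕ} (hj : j ≤ 2)
    (k : ℤ) :
    M.dualMode j * coeffZ M.contraY k v - coeffZ M.contraY k v * M.dualMode j =
      ((k : ℂ) + (2 - j) * N + j - 1) • coeffZ M.contraY (k + j - 1) v := by
  ext1 f
  apply M.dual_ext
  intro w
  have h := M.commutator_coeffZ hv hj (-2 * N - k) w
  rw [sub_eq_iff_eq_add] at h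
  simp only [LinearMap.sub_apply, Module.End.mul_apply, LinearMap.smul_apply,
    AddSubgroupClass.coe_sub,
    Submodule.coe_smul, dualMode_apply, coeffZ_contraY_apply, M.dagger_quasiprimary hv, map_smul,
    h, map_add, smul_add]
  have e : -2 * (N : ℤ) - k + 1 - j = -2 * N - (k + j - 1) := by ring
  rw [e, smul_comm _ ((-1 : ℂ) ^ N)]
  push_cast
  module

variable {n : ℕ} {v : Fin n → V} {wt : Fin n → ℕ}

theorem exists_locality_order (v : Fin n → V) :
    ∃ K : ℕ, ∀ i j, ∀ k : ℤ, K ≤ k → mode 𝒱.Y (v i) k (v j) = 0 := by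
  choose B hB using fun i j => exists_mode_eq_zero 𝒱.Y (v i) (v j)
  refine ⟨∑ i, ∑ j, (B i j).toNat, fun i j k hk => hB i j k ?_⟩
  have h1 : (B i j).toNat ≤ ∑ j, (B i j).toNat :=
    Finset.single_le_sum (f := fun j => (B i j).toNat) (fun _ _ => Nat.zero_le _) (Finset.mem_univ j)
  have h2 : ∑ j, (B i j).toNat ≤ ∑ i, ∑ j, (B i j).toNat :=
    Finset.single_le_sum (f := fun i => ∑ j, (B i j).toNat) (fun _ _ => Nat.zero_le _)
      (Finset.mem_univ i)
  omega

theorem isLocal_contraY (hv : ∀ i, 𝒱.IsQuasiprimary (v i) (wt i)) {K : ℕ}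
    (hK : ∀ i j, ∀ k : ℤ, K ≤ k → mode 𝒱.Y (v i) k (v j) = 0) :
    IsLocal (fun i k => coeffZ M.contraY k (v i)) K := by
  intro i j _ p q
  ext1 f
  apply M.dual_ext
  intro w
  have h := congrArg (fun x => ((-1 : ℂ) ^ (wt i) * (-1) ^ (wt j)) • (f : Module.Dual ℂ W) x)
    (M.local_modes (hK i j) (2 * wt i + p - 1) (2 * wt j + q - K - 1) w)
  simp only [map_sum, Finset.smul_sum, map_smul] at h
  have hs : ∀ (s : Finset ℕ) (c : ℕ → ℂ) (T : ℕ → Module.End ℂ M.restrictedDual),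
      (((∑ m ∈ s, c m • T m) f : M.restrictedDual) : Module.Dual ℂ W) w =
        ∑ m ∈ s, c m * (T m f : Module.Dual ℂ W) w := by
    intro s c T
    simp [LinearMap.sum_apply]
  rw [hs, hs]
  simp only [Module.End.mul_apply, coeffZ_contraY_apply, M.dagger_quasiprimary (hv _), map_smul,
    LinearMap.smul_apply]
  have e1 : ∀ m : ℕ, coeffZ M.Y (-2 * (wt i : ℤ) - (p - m)) (v i) =
      mode M.Y (v i) (2 * wt i + p - 1 - m) := fun m => by
    rw [coeffZ_eq_mode]; congr 1; ring
  have e2 : ∀ m ∈ Finset.range (K + 1), coeffZ M.Y (-2 * (wt j : ℤ) - (q - ((K - m : ℕ) : ℤ))) (v j) =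
      mode M.Y (v j) (2 * wt j + q - K - 1 + m) := fun m hm => by
    have hm' : m ≤ K := by simpa [Nat.lt_succ_iff] using hm
    rw [coeffZ_eq_mode]; congr 1; push_cast [hm']; ring
  refine Eq.trans (Finset.sum_congr rfl fun m hm => ?_) (h.symm.trans
    (Finset.sum_congr rfl fun m hm => ?_))
  · rw [e1, e2 m hm]
    simp only [smul_eq_mul]
    ring
  · rw [e1, e2 m hm]
    simp only [smul_eq_mul]
    ring

theorem exists_upper {v : V} {N : ℕ} (hv : 𝒱.IsQuasiprimary v N) (w : W) :
    ∃ B : ℤ, ∀ k, B < k → ∀ g : M.restrictedDual,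
      (coeffZ M.contraY k v g : Module.Dual ℂ W) w = 0 := by
  obtain ⟨B, hB⟩ := exists_coeffZ_eq_zero M.Y v w
  refine ⟨-2 * N - B, fun k hk g => ?_⟩
  rw [coeffZ_contraY_apply, M.dagger_quasiprimary hv, LinearMap.smul_apply, hB _ (by omega),
    smul_zero,
    map_zero]

/-- The fields of quasiprimary vectors on the contragredient module, paired with the module itself.
On both modules, `E`, `F`, `H` are `L(1)`, `L(-1)`, `L(0)`; on the contragredient module these are
the transposes of `L(-1)`, `L(1)`, `L(0)`. -/
def quasiprimaryFields (hv : ∀ i, 𝒱.IsQuasiprimary (v i) (wt i)) :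
    QuasiprimaryFields n M.restrictedDual W where
  pair := M.restrictedDual.subtype
  EU := M.dualMode 0
  FU := M.dualMode 2
  HU := M.dualMode 1
  EW := mode M.Y 𝒱.ω 2
  FW := mode M.Y 𝒱.ω 0
  HW := mode M.Y 𝒱.ω 1
  pair_E _ _ := rfl
  pair_F _ _ := rfl
  pair_H _ _ := rfl
  EFU := by
    ext1 f
    apply M.dual_ext
    intro w
    have := M.commutator_dualMode (j := 2) le_rfl f 0 w
    norm_num at this
    simpa [dualMode_apply] using this
  HEU := by
    ext1 f
    apply M.dual_ext
    intro w
    have := M.commutator_dualMode (j := 0) (by norm_num) f 1 w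
    norm_num at this
    simpa [dualMode_apply] using this
  HFU := by
    ext1 f
    apply M.dual_ext
    intro w
    have := M.commutator_dualMode (j := 2) le_rfl f 1 w
    norm_num at this
    simpa [dualMode_apply] using this
  EFW := by
    have := M.commutator_ω (j := 2) (i := 0) le_rfl
    norm_num at this
    exact this
  HEW := by
    have := M.commutator_ω (j := 1) (i := 2) (by norm_num)
    norm_num at this
    exact this
  HFW := by
    have := M.commutator_ω (j := 1) (i := 0) (by norm_num)
    norm_num at this
    exact this
  A i k := coeffZ M.contraY k (v i)
  wt := wt
  EA i k := by
    have := M.commutator_dualMode_coeffZ (hv i) (j := 0) (by norm_num) k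
    rw [this]
    congr 1
    · push_cast; ring
    · congr 2; push_cast; ring
  HA i k := by
    have := M.commutator_dualMode_coeffZ (hv i) (j := 1) (by norm_num) k
    rw [this]
    congr 1
    · push_cast; ring
    · congr 2; push_cast; ring
  FA i k := by
    have := M.commutator_dualMode_coeffZ (hv i) (j := 2) le_rfl k
    rw [this]
    congr 1
    · push_cast; ring
    · congr 2; push_cast; ring
  K := (exists_locality_order (𝒱 := 𝒱) v).choose
  locality := M.isLocal_contraY hv (exists_locality_order (𝒱 := 𝒱) v).choose_spec
  lower i g := exists_coeffZ_eq_zero M.contraY (v i) g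
  upper i w := M.exists_upper (hv i) w

theorem corr_quasiprimaryFields (hv : ∀ i, 𝒱.IsQuasiprimary (v i) (wt i)) (g : M.restrictedDual)
    (w : W) (k : Fin n → ℤ) :
    (M.quasiprimaryFields hv).corr g w k = (M.prodCoeff v k g : Module.Dual ℂ W) w := by
  rw [QuasiprimaryFields.corr, prodCoeff, List.ofFn_eq_map]
  rfl

end OrdinaryModule
end VOA

/-! ### Dual bases -/

namespace VOA

variable {V : Type*} [AddCommGroup V] [Module ℂ V] {𝒱 : VOA V}

namespace OrdinaryModule

open scoped TensorProduct

variable {W : Type*} [AddCommGroup W] [Module ℂ W] (M : 𝒱.OrdinaryModule W)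

theorem proj_of_mem {m : ℕ} {w : W} (hw : w ∈ M.gr m) : M.proj m w = ⟨w, hw⟩ := by
  simp only [proj, LinearMap.comp_apply, LinearEquiv.coe_coe, M.decompose_of_mem hw,
    DirectSum.component.lof_self]

theorem extend_apply_of_mem {m : ℕ} (φ : Module.Dual ℂ (M.gr m)) {w : W} (hw : w ∈ M.gr m) :
    (M.extend m φ : Module.Dual ℂ W) w = φ ⟨w, hw⟩ := by
  rw [← M.proj_of_mem hw]
  rfl

theorem extend_apply_of_mem_ne {m k : ℕ} (hk : k ≠ m) (φ : Module.Dual ℂ (M.gr m)) {w : W}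
    (hw : w ∈ M.gr k) : (M.extend m φ : Module.Dual ℂ W) w = 0 := by
  change φ (M.proj m w) = 0
  rw [M.proj_of_mem_ne hk hw, map_zero]

variable {m : ℕ} {ι : Type*} [Fintype ι]

theorem sum_extend_coord (b : Module.Basis ι ℂ (M.gr m)) {w : W} (hw : w ∈ M.gr m) :
    ∑ i, (M.extend m (b.coord i) : Module.Dual ℂ W) w • (b i : W) = w := by
  have h := congrArg Subtype.val (b.sum_repr ⟨w, hw⟩)
  rw [Submodule.coe_sum] at h
  simp only [extend_apply_of_mem M _ hw, Module.Basis.coord_apply]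
  exact h

theorem sum_coord_extend (b : Module.Basis ι ℂ (M.gr m)) {f : M.restrictedDual}
    (hf : ∀ k, k ≠ m → ∀ w ∈ M.gr k, (f : Module.Dual ℂ W) w = 0) :
    ∑ i, (f : Module.Dual ℂ W) (b i) • M.extend m (b.coord i) = f := by
  refine Subtype.ext (M.ext_gr fun k w hw => ?_)
  rw [Submodule.coe_sum, LinearMap.sum_apply]
  simp only [Submodule.coe_smul, LinearMap.smul_apply, smul_eq_mul]
  by_cases hk : k = m
  · subst hk
    conv_rhs => rw [← M.sum_extend_coord b hw]
    rw [map_sum]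
    refine Finset.sum_congr rfl fun i _ => ?_
    rw [map_smul, smul_eq_mul, mul_comm]
  · rw [hf k hk w hw]
    exact Finset.sum_eq_zero fun i _ => by rw [M.extend_apply_of_mem_ne hk _ hw, mul_zero]

theorem traceCoeff_eq (b : Module.Basis ι ℂ (M.gr m)) {n : ℕ} (v : Fin n → V) (k : Fin n → ℤ) :
    M.traceCoeff v m k =
      ∑ i, (M.prodCoeff v k (M.extend m (b.coord i)) : Module.Dual ℂ W) (b i) := by
  classical
  rw [traceCoeff, LinearMap.trace_eq_matrix_trace ℂ b.dualBasis, Matrix.trace]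
  refine Finset.sum_congr rfl fun i _ => ?_
  rw [Matrix.diag_apply, LinearMap.toMatrix_apply, Module.Basis.dualBasis_repr,
    Module.Basis.coe_dualBasis]
  rfl

variable {n : ℕ} {v : Fin n → V} {wt : Fin n → ℕ} (hv : ∀ i, 𝒱.IsQuasiprimary (v i) (wt i))

theorem HU_extend (φ : Module.Dual ℂ (M.gr m)) :
    (M.quasiprimaryFields hv).HU (M.extend m φ) = (M.h + m) • M.extend m φ := by
  refine Subtype.ext (M.ext_gr fun k w hw => ?_)
  have h1 : mode M.Y 𝒱.ω 1 w = (M.h + k) • w := Module.End.mem_eigenspace_iff.mp hw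
  change (M.extend m φ : Module.Dual ℂ W) (mode M.Y 𝒱.ω 1 w) =
    (M.h + m) • (M.extend m φ : Module.Dual ℂ W) w
  rw [h1, map_smul]
  by_cases hk : k = m
  · rw [hk]
  · rw [M.extend_apply_of_mem_ne hk _ hw, smul_zero, smul_zero]

theorem HW_apply {w : W} (hw : w ∈ M.gr m) :
    (M.quasiprimaryFields hv).HW w = (M.h + m) • w := Module.End.mem_eigenspace_iff.mp hw

theorem EW_pow_eq_zero {w : W} (hw : w ∈ M.gr m) :
    ((M.quasiprimaryFields hv).EW ^ (m + 1)) w = 0 := M.L1_pow_eq_zero hw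

theorem dualMode_pow_apply (j a : ℕ) (f : M.restrictedDual) (w : W) :
    ((M.dualMode j ^ a) f : Module.Dual ℂ W) w =
      (f : Module.Dual ℂ W) (((mode M.Y 𝒱.ω j) ^ a) w) := by
  induction a generalizing f with
  | zero => rfl
  | succ a ih =>
    rw [pow_succ, Module.End.mul_apply, ih, dualMode_apply, pow_succ', Module.End.mul_apply]

theorem EU_pow_eq_zero (φ : Module.Dual ℂ (M.gr m)) :
    ((M.quasiprimaryFields hv).EU ^ (m + 1)) (M.extend m φ) = 0 := by
  refine Subtype.ext (M.ext_gr fun k w hw => ?_)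
  refine (M.dualMode_pow_apply 0 (m + 1) _ w).trans ?_
  exact M.extend_apply_of_mem_ne (by omega) _ (M.Lm1_pow_mem hw (m + 1))

/-- The canonical tensors `Ω_m` of the weight spaces are related by `F Ω_m = E Ω_{m+1}`: the maps
`L(-1)` and `L(1)` between neighbouring weight spaces can be moved from one factor to the other. -/
theorem FT_canonical {ι : ℕ → Type*} [∀ m, Fintype (ι m)]
    (b : ∀ m, Module.Basis (ι m) ℂ (M.gr m)) (m : ℕ) :
    (M.quasiprimaryFields hv).FT (∑ i, M.extend m ((b m).coord i) ⊗ₜ[ℂ] (b m i : W)) =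
      (M.quasiprimaryFields hv).ET
        (∑ i, M.extend (m + 1) ((b (m + 1)).coord i) ⊗ₜ[ℂ] (b (m + 1) i : W)) := by
  set S := M.quasiprimaryFields hv
  have hE : ∀ i, ∑ j, (M.extend m ((b m).coord j) : Module.Dual ℂ W)
      (mode M.Y 𝒱.ω 2 (b (m + 1) i)) • (b m j : W) = S.EW (b (m + 1) i) := fun i =>
    M.sum_extend_coord (b m) (M.mode_mem_gr 𝒱.ω_mem_gr (b (m + 1) i).2 (by push_cast; ring))
  have hF : ∀ i, ∑ j, (M.extend (m + 1) ((b (m + 1)).coord j) : Module.Dual ℂ W)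
      (mode M.Y 𝒱.ω 0 (b m i)) • (b (m + 1) j : W) = S.FW (b m i) := fun i =>
    M.sum_extend_coord (b (m + 1)) (M.mode_mem_gr 𝒱.ω_mem_gr (b m i).2 (by push_cast; ring))
  have hFU : ∀ i, ∑ j, (M.extend m ((b m).coord i) : Module.Dual ℂ W)
      (mode M.Y 𝒱.ω 2 (b (m + 1) j)) • M.extend (m + 1) ((b (m + 1)).coord j) =
      S.FU (M.extend m ((b m).coord i)) := fun i => by
    refine M.sum_coord_extend (b (m + 1)) (f := M.dualMode 2 (M.extend m ((b m).coord i)))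
      fun k hk w hw => ?_
    rw [dualMode_apply]
    rcases k with _ | k
    · rw [M.mode_eq_zero 𝒱.ω_mem_gr hw (by norm_num), map_zero]
    · exact M.extend_apply_of_mem_ne (k := k) (by omega) _
        (M.mode_mem_gr 𝒱.ω_mem_gr hw (by push_cast; ring))
  have hEU : ∀ i, ∑ j, (M.extend (m + 1) ((b (m + 1)).coord i) : Module.Dual ℂ W)
      (mode M.Y 𝒱.ω 0 (b m j)) • M.extend m ((b m).coord j) =
      S.EU (M.extend (m + 1) ((b (m + 1)).coord i)) := fun i => by
    refine M.sum_coord_extend (b m) (f := M.dualMode 0 (M.extend (m + 1) ((b (m + 1)).coord i)))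
      fun k hk w hw => ?_
    rw [dualMode_apply]
    exact M.extend_apply_of_mem_ne (k := k + 1) (by omega) _
      (M.mode_mem_gr 𝒱.ω_mem_gr hw (by push_cast; ring))
  rw [map_sum, map_sum]
  simp only [QuasiprimaryFields.FT_tmul, QuasiprimaryFields.ET_tmul, Finset.sum_add_distrib]
  rw [add_comm]
  congr 1
  · simp only [← hF, ← hEU, TensorProduct.tmul_sum, TensorProduct.sum_tmul, TensorProduct.tmul_smul,
      TensorProduct.smul_tmul']
    exact Finset.sum_comm
  · simp only [← hFU, ← hE, TensorProduct.tmul_sum, TensorProduct.sum_tmul, TensorProduct.tmul_smul,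
      TensorProduct.smul_tmul']
    exact Finset.sum_comm

end OrdinaryModule

/-! ### The Li-Zamolodchikov metric -/

theorem adjoint_gr (𝒱 : VOA V) (n : ℕ) : 𝒱.adjoint.gr n = 𝒱.gr n := by
  rw [OrdinaryModule.gr, gr]
  change Module.End.eigenspace (mode 𝒱.Y 𝒱.ω 1) ((0 : ℂ) + n) = _
  rw [zero_add]

theorem L0_apply {n : ℕ} {w : V} (hw : w ∈ 𝒱.gr n) : mode 𝒱.Y 𝒱.ω 1 w = (n : ℂ) • w :=
  Module.End.mem_eigenspace_iff.mp hw

theorem ext_gr {T : Type*} [AddCommGroup T] [Module ℂ T] {f g : V →ₗ[ℂ] T}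
    (h : ∀ n, ∀ w ∈ 𝒱.gr n, f w = g w) : f = g :=
  𝒱.adjoint.ext_gr fun n w hw => h n w (by rwa [adjoint_gr] at hw)

theorem vac_ne_zero (hsimple : 𝒱.IsSimple) : 𝒱.vac ≠ 0 := by
  intro h
  obtain ⟨w, hw⟩ := @exists_ne V hsimple.1 0
  have := 𝒱.vacuum (-1) w
  rw [if_pos rfl, h] at this
  exact hw (this.symm.trans (by simp [mode]))

theorem dagger_ω (k : ℤ) : 𝒱.adjoint.dagger k 𝒱.ω = coeffZ 𝒱.Y (-4 - k) 𝒱.ω := by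
  rw [𝒱.adjoint.dagger_quasiprimary 𝒱.quasiprimary_ω]
  norm_num
  rfl

/-- An isomorphism with the contragredient module is an invariant bilinear form. It can be
normalised: the vacuum is orthogonal to all vectors of positive weight, hence not to itself. -/
theorem exists_isLiZMetric (hcft : 𝒱.IsStrongCFTType) (hsimple : 𝒱.IsSimple)
    (hdual : 𝒱.IsSelfDual) : ∃ B, 𝒱.IsLiZMetric B := by
  obtain ⟨e, he⟩ := hdual
  set B₀ : LinearMap.BilinForm ℂ V := 𝒱.adjoint.restrictedDual.subtype ∘ₗ e.toLinearMap
  have hB : ∀ (u v w : V) (k : ℤ),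
      B₀ (coeffZ 𝒱.Y k u v) w = B₀ v (𝒱.adjoint.dagger k u w) := by
    intro u v w k
    rw [coeffZ_eq_mode]
    change (e (mode 𝒱.Y u (-k - 1) v) : Module.Dual ℂ V) w = (e v : Module.Dual ℂ V) _
    rw [he, ← 𝒱.adjoint.coeffZ_contraY_apply, coeffZ_eq_mode]
  have h1 : B₀ 𝒱.vac 𝒱.vac ≠ 0 := by
    intro h0
    have hz : B₀ 𝒱.vac = 0 := by
      refine ext_gr (𝒱 := 𝒱) fun n w hw => ?_
      rcases n with _ | n
      · rw [hcft.1, Submodule.mem_span_singleton] at hw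
        obtain ⟨a, rfl⟩ := hw
        rw [map_smul, h0, smul_zero, LinearMap.zero_apply]
      · have h2 := hB 𝒱.ω 𝒱.vac w (-2)
        have h3 : coeffZ 𝒱.Y (-2) 𝒱.ω 𝒱.vac = 0 := by
          rw [coeffZ_eq_mode]
          exact (𝒱.creation 𝒱.ω).2 _ (by norm_num)
        have h4 : coeffZ 𝒱.Y (-4 - -2) 𝒱.ω w = ((n + 1 : ℕ) : ℂ) • w := by
          rw [coeffZ_eq_mode, ← L0_apply hw]
          norm_num
        rw [h3, map_zero, LinearMap.zero_apply, dagger_ω, h4, map_smul] at h2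
        exact (smul_eq_zero.mp h2.symm).resolve_left (Nat.cast_ne_zero.mpr n.succ_ne_zero)
    have h2 : e 𝒱.vac = 0 := Subtype.ext hz
    exact vac_ne_zero hsimple (e.map_eq_zero_iff.mp h2)
  refine ⟨(B₀ 𝒱.vac 𝒱.vac)⁻¹ • B₀, ?_, fun u v w k => ?_⟩
  · rw [LinearMap.smul_apply, LinearMap.smul_apply, smul_eq_mul, inv_mul_cancel₀ h1]
  · rw [LinearMap.smul_apply, LinearMap.smul_apply, LinearMap.smul_apply, LinearMap.smul_apply, hB]

variable {B : LinearMap.BilinForm ℂ V}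

theorem IsLiZMetric.L0_symm (hB : 𝒱.IsLiZMetric B) (v w : V) :
    B (mode 𝒱.Y 𝒱.ω 1 v) w = B v (mode 𝒱.Y 𝒱.ω 1 w) := by
  have h := hB.2 𝒱.ω v w (-2)
  rw [dagger_ω, coeffZ_eq_mode, coeffZ_eq_mode] at h
  norm_num at h
  exact h

theorem IsLiZMetric.apply_eq_zero (hB : 𝒱.IsLiZMetric B) {m n : ℕ} (hmn : m ≠ n) {v w : V}
    (hv : v ∈ 𝒱.gr m) (hw : w ∈ 𝒱.gr n) : B v w = 0 := by
  have h := hB.L0_symm v w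
  rw [L0_apply hv, L0_apply hw, map_smul, map_smul, LinearMap.smul_apply, smul_eq_mul,
    smul_eq_mul, ← sub_eq_zero, ← sub_mul] at h
  refine (mul_eq_zero.mp h).resolve_left (sub_ne_zero.mpr ?_)
  exact_mod_cast hmn

/-- The radical of an invariant form is a submodule, so the metric of a simple vertex operator
algebra is nondegenerate. -/
theorem IsLiZMetric.injective (hB : 𝒱.IsLiZMetric B) (hsimple : 𝒱.IsSimple) :
    Function.Injective B := by
  rw [← LinearMap.ker_eq_bot]
  refine (hsimple.2 (LinearMap.ker B) fun u n v hv => ?_).resolve_right fun h => ?_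
  · rw [LinearMap.mem_ker] at hv ⊢
    ext w
    have h := hB.2 u v w (-n - 1)
    rw [hv, LinearMap.zero_apply] at h
    exact h
  · have h1 : 𝒱.vac ∈ LinearMap.ker B := by rw [h]; trivial
    rw [LinearMap.mem_ker] at h1
    have := hB.1
    rw [h1] at this
    simp at this

/-- A linear form which vanishes on almost all weight spaces is represented by a vector. -/
theorem IsLiZMetric.exists_eq (hB : 𝒱.IsLiZMetric B) (hsimple : 𝒱.IsSimple) (φ : Module.Dual ℂ V)
    {N : ℕ} (hφ : ∀ n, N ≤ n → ∀ w ∈ 𝒱.gr n, φ w = 0) : ∃ a, ∀ u, B u a = φ u := by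
  have hn : ∀ n, ∃ a ∈ 𝒱.gr n, ∀ u ∈ 𝒱.gr n, B u a = φ u := by
    intro n
    have : FiniteDimensional ℂ (𝒱.gr n) := 𝒱.finite n
    set C : 𝒱.gr n →ₗ[ℂ] Module.Dual ℂ (𝒱.gr n) := B.domRestrict₁₂ (𝒱.gr n) (𝒱.gr n)
    have hrank : Module.finrank ℂ (𝒱.gr n) = Module.finrank ℂ (Module.Dual ℂ (𝒱.gr n)) :=
      Subspace.dual_finrank_eq.symm
    have hC : Function.Injective C := by
      rw [injective_iff_map_eq_zero]
      intro a ha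
      refine Subtype.ext ((injective_iff_map_eq_zero B).mp (hB.injective hsimple) a ?_)
      refine ext_gr (𝒱 := 𝒱) fun k w hw => ?_
      by_cases hk : n = k
      · subst hk
        exact LinearMap.congr_fun ha ⟨w, hw⟩
      · exact hB.apply_eq_zero hk a.2 hw
    have hC' : Function.Surjective C :=
      (LinearMap.injective_iff_surjective_of_finrank_eq_finrank hrank).mp hC
    have hF : Function.Injective C.flip := by
      rw [injective_iff_map_eq_zero]
      intro a ha
      rw [← Module.forall_dual_apply_eq_zero_iff ℂ a]
      intro ψ
      obtain ⟨u, rfl⟩ := hC' ψ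
      exact LinearMap.congr_fun ha u
    obtain ⟨a, ha⟩ := (LinearMap.injective_iff_surjective_of_finrank_eq_finrank hrank).mp hF
      (φ ∘ₗ (𝒱.gr n).subtype)
    exact ⟨a, a.2, fun u hu => LinearMap.congr_fun ha ⟨u, hu⟩⟩
  choose a ha hau using hn
  refine ⟨∑ n ∈ Finset.range N, a n, fun u => ?_⟩
  have h : LinearMap.flip B (∑ n ∈ Finset.range N, a n) = φ := by
    refine ext_gr (𝒱 := 𝒱) fun k u hu => ?_
    rw [LinearMap.flip_apply, map_sum]
    by_cases hk : k < N
    · rw [Finset.sum_eq_single k (fun n _ hn => hB.apply_eq_zero hn.symm hu (ha n))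
        (fun h => absurd (Finset.mem_range.mpr hk) h), hau k u hu]
    · rw [hφ k (not_lt.mp hk) u hu]
      refine Finset.sum_eq_zero fun n hn => hB.apply_eq_zero ?_ hu (ha n)
      rw [Finset.mem_range] at hn
      omega
  exact LinearMap.congr_fun h u

end VOA

/-! ### Coefficients of the genus zero correlation functions -/

namespace VOA

variable {V : Type*} [AddCommGroup V] [Module ℂ V] {𝒱 : VOA V}

section creative

variable {W : Type*} [AddCommGroup W] [Module ℂ W] (Y : V →ₗ[ℂ] VertexOperator ℂ W)

theorem creative_support_finite (w : W) (u : V) (k : ℤ) : (Function.support fun j : ℕ =>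
    ((-1 : ℂ) ^ (k - j) / (j.factorial : ℂ)) •
      ((mode Y 𝒱.ω 0) ^ j) (coeffZ Y (k - j) u w)).Finite := by
  obtain ⟨B, hB⟩ := exists_coeffZ_eq_zero Y u w
  refine (Set.finite_Iic (k - B).toNat).subset fun j hj => ?_
  by_contra hc
  rw [Set.mem_Iic, not_le] at hc
  refine hj ?_
  simp only [hB (k - j) (by omega), map_zero, smul_zero]

/-- The coefficient of the creative intertwiner as a linear function of the vector of `V`. -/
def creativeLin (𝒱 : VOA V) (w : W) (k : ℤ) : V →ₗ[ℂ] W where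
  toFun u := 𝒱.creative Y w u k
  map_add' u u' := by
    rw [creative, creative, creative, ← finsum_add_distrib (creative_support_finite Y w u k)
      (creative_support_finite Y w u' k)]
    simp only [map_add, LinearMap.add_apply, smul_add]
  map_smul' a u := by
    rw [creative, creative, RingHom.id_apply, smul_finsum]
    simp only [map_smul, LinearMap.smul_apply, smul_comm a]

theorem creative_vac (hvac : ∀ (k : ℤ) (w : W), coeffZ Y k 𝒱.vac w = if k = 0 then w else 0)
    (w : W) (k : ℤ) : 𝒱.creative Y w 𝒱.vac k =
      if 0 ≤ k then (k.toNat.factorial : ℂ)⁻¹ • ((mode Y 𝒱.ω 0) ^ k.toNat) w else 0 := by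
  rw [creative]
  split_ifs with hk
  · rw [finsum_eq_single _ k.toNat]
    · have e : k - (k.toNat : ℤ) = 0 := by omega
      rw [e, zpow_zero, hvac, if_pos rfl, one_div]
    · intro j hj
      rw [hvac, if_neg (by omega), map_zero, smul_zero]
  · refine finsum_eq_zero_of_forall_eq_zero fun j => ?_
    rw [hvac, if_neg (by omega), map_zero, smul_zero]

end creative

namespace OrdinaryModule

variable {W : Type*} [AddCommGroup W] [Module ℂ W] (M : 𝒱.OrdinaryModule W)

theorem coeffZ_vac (k : ℤ) (w : W) : coeffZ M.Y k 𝒱.vac w = if k = 0 then w else 0 := by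
  rw [coeffZ_eq_mode, M.vacuum]
  congr 1
  exact propext ⟨fun h => by omega, fun h => by omega⟩

theorem coeffZ_contraY_vac (k : ℤ) (f : M.restrictedDual) :
    coeffZ M.contraY k 𝒱.vac f = if k = 0 then f else 0 := by
  apply M.dual_ext
  intro w
  rw [coeffZ_contraY_apply, M.dagger_quasiprimary 𝒱.quasiprimary_vac, LinearMap.smul_apply,
    coeffZ_vac]
  by_cases hk : k = 0
  · simp [hk]
  · rw [if_neg (by simpa using hk), if_neg hk]
    simp

theorem mode_contraY_ω : mode M.contraY 𝒱.ω 0 = M.dualMode 2 := by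
  ext1 f
  apply M.dual_ext
  intro w
  rw [mode_eq_coeffZ, coeffZ_contraY_apply, M.dagger_quasiprimary 𝒱.quasiprimary_ω, dualMode_apply,
    coeffZ_eq_mode]
  norm_num

theorem coeffZ_mem_gr {u : V} {N n m : ℕ} (hu : u ∈ 𝒱.gr N) {k : ℤ} {w : W} (hw : w ∈ M.gr n)
    (e : (n : ℤ) + N + k = m) : coeffZ M.Y k u w ∈ M.gr m := by
  rw [coeffZ_eq_mode]
  exact M.mode_mem_gr hu hw (by rw [← e]; ring)

theorem coeffZ_eq_zero {u : V} {N n : ℕ} (hu : u ∈ 𝒱.gr N) {k : ℤ} {w : W} (hw : w ∈ M.gr n)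
    (e : (n : ℤ) + N + k < 0) : coeffZ M.Y k u w = 0 := by
  rw [coeffZ_eq_mode]
  exact M.mode_eq_zero hu hw (by omega)

theorem creative_mem_gr {u : V} {N n m : ℕ} (hu : u ∈ 𝒱.gr N) {k : ℤ} {w : W} (hw : w ∈ M.gr n)
    (e : (n : ℤ) + N + k = m) : 𝒱.creative M.Y w u k ∈ M.gr m := by
  refine finsum_induction (· ∈ M.gr m) (Submodule.zero_mem _)
    (fun _ _ => Submodule.add_mem _) fun j => Submodule.smul_mem _ _ ?_
  by_cases hj : j ≤ m
  · have h := M.Lm1_pow_mem (M.coeffZ_mem_gr hu hw (k := k - j) (m := m - j)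
      (by push_cast [hj]; omega)) j
    rwa [Nat.sub_add_cancel hj] at h
  · rw [M.coeffZ_eq_zero hu hw (by omega), map_zero]
    exact Submodule.zero_mem _

theorem adjointPairing_of_mem (ℓ : ℂ) {m : ℕ} {w : W} (hw : w ∈ M.gr m) (f : M.restrictedDual)
    (k : ℤ) (u : V) : M.adjointPairing ℓ w f k u =
      ∑ j ∈ Finset.range (m + 1), (Complex.exp (ℓ * (M.h + m)) / (j.factorial : ℂ)) *
        (f : Module.Dual ℂ W) (𝒱.creative M.Y (((mode M.Y 𝒱.ω 2) ^ j) w) u ((j : ℤ) - 2 * m - k)) := by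
  rw [adjointPairing, finsum_eq_single _ m]
  · rw [M.proj_of_mem hw]
  · intro n hn
    refine Finset.sum_eq_zero fun j _ => ?_
    rw [M.proj_of_mem_ne hn.symm hw]
    have h0 : 𝒱.creative M.Y (0 : W) u ((j : ℤ) - 2 * n - k) = 0 :=
      finsum_eq_zero_of_forall_eq_zero fun i => by rw [map_zero, map_zero, smul_zero]
    rw [Submodule.coe_zero, map_zero, h0, map_zero, mul_zero]

theorem isLiZMetric_liZ (hcft : 𝒱.IsStrongCFTType) (hsimple : 𝒱.IsSimple) (hdual : 𝒱.IsSelfDual) :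
    𝒱.IsLiZMetric 𝒱.liZ := Classical.epsilon_spec (exists_isLiZMetric hcft hsimple hdual)

/-- The adjoint intertwiner exists: as the metric is nondegenerate, and the adjoint pairing is a
linear form which vanishes on almost all weight spaces, the vector chosen in the definition of the
intertwiner has the required pairings. -/
theorem liZ_annihilating (hcft : 𝒱.IsStrongCFTType) (hsimple : 𝒱.IsSimple) (hdual : 𝒱.IsSelfDual)
    (ℓ : ℂ) {m : ℕ} {w : W} (hw : w ∈ M.gr m) (f : M.restrictedDual) (k : ℤ) (u : V) :
    𝒱.liZ u (M.annihilating ℓ w f k) = M.adjointPairing ℓ w f k u := by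
  set φ : Module.Dual ℂ V := ∑ j ∈ Finset.range (m + 1),
    (Complex.exp (ℓ * (M.h + m)) / (j.factorial : ℂ)) • ((f : Module.Dual ℂ W) ∘ₗ
      creativeLin M.Y 𝒱 (((mode M.Y 𝒱.ω 2) ^ j) w) ((j : ℤ) - 2 * m - k)) with hφ
  have h1 : ∀ u, φ u = M.adjointPairing ℓ w f k u := by
    intro u
    rw [M.adjointPairing_of_mem ℓ hw, hφ, LinearMap.sum_apply]
    rfl
  obtain ⟨B, hB⟩ := f.2
  have h2 : ∀ n, B + m + k.natAbs ≤ n → ∀ u ∈ 𝒱.gr n, φ u = 0 := by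
    intro n hn u hu
    rw [h1, M.adjointPairing_of_mem ℓ hw]
    refine Finset.sum_eq_zero fun j hj => ?_
    have hj' : j ≤ m := by simpa [Nat.lt_succ_iff] using hj
    rw [hB ((n : ℤ) - m - k).toNat (by omega) _ (M.creative_mem_gr hu (M.L1_pow_mem_gr hw hj')
      (by push_cast [hj']; omega)), mul_zero]
  obtain ⟨a, ha⟩ := (isLiZMetric_liZ hcft hsimple hdual).exists_eq hsimple φ h2
  have h3 : ∃ a, ∀ u, 𝒱.liZ u a = M.adjointPairing ℓ w f k u := ⟨a, fun u => by rw [ha, h1]⟩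
  exact @Classical.epsilon_spec _ _ h3 u

variable {n : ℕ} {v : Fin n → V} {wt : Fin n → ℕ} (hv : ∀ i, 𝒱.IsQuasiprimary (v i) (wt i))

/-- On the vacuum, the creative intertwiners are the exponentials of `z L(-1)`, so the
correlation function is a generating series of descendants in `y₁⁻¹` and `y₂`. -/
theorem genusZeroCoeff_eq (hcft : 𝒱.IsStrongCFTType) (hsimple : 𝒱.IsSimple) (hdual : 𝒱.IsSelfDual)
    (ℓ : ℂ) {m : ℕ} {w : W} (hw : w ∈ M.gr m) (f : M.restrictedDual) (k : Fin (n + 2) → ℤ) :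
    M.genusZeroCoeff ℓ v w f k =
      if 0 ≤ k (Fin.last (n + 1)) ∧ k 0 ≤ 0 then Complex.exp (ℓ * (M.h + m)) *
        (M.quasiprimaryFields hv).corrTY m w f ((k (Fin.last (n + 1))).toNat, (-k 0).toNat)
          (fun i => k i.castSucc.succ)
      else 0 := by
  rw [genusZeroCoeff, M.liZ_annihilating hcft hsimple hdual ℓ hw, M.adjointPairing_of_mem ℓ hw,
    creative_vac M.contraY M.coeffZ_contraY_vac, M.mode_contraY_ω]
  simp only [creative_vac M.Y M.coeffZ_vac]
  set l := k (Fin.last (n + 1))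
  by_cases hl : 0 ≤ l
  · by_cases hk : k 0 ≤ 0
    · rw [if_pos hl, if_pos ⟨hl, hk⟩, QuasiprimaryFields.corrTY, Finset.sum_apply, Finset.mul_sum]
      refine Finset.sum_congr rfl fun j hj => ?_
      have hj' : j ≤ m := by simpa [Nat.lt_succ_iff] using hj
      by_cases hp : 2 * m - j ≤ (-k 0).toNat
      · have e : ((j : ℤ) - 2 * m - k 0).toNat = (-k 0).toNat - (2 * m - j) := by omega
        rw [if_pos hp, if_pos (by omega), e, Pi.smul_apply, corr_quasiprimaryFields]
        change _ = _ * ((_ : ℂ) * (M.prodCoeff v _ (((M.dualMode 2) ^ l.toNat) f) : Module.Dual ℂ W)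
          (((mode M.Y 𝒱.ω 0) ^ ((-k 0).toNat - (2 * m - j))) (((mode M.Y 𝒱.ω 2) ^ j) w)))
        rw [map_smul, map_smul, Submodule.coe_smul, LinearMap.smul_apply, smul_eq_mul, smul_eq_mul]
        ring
      · rw [if_neg hp, if_neg (by omega), map_zero, mul_zero, Pi.zero_apply, mul_zero]
    · have hn : ¬(0 ≤ l ∧ k 0 ≤ 0) := fun h => hk h.2
      rw [if_pos hl, if_neg hn]
      refine Finset.sum_eq_zero fun j hj => ?_
      have hj' : j ≤ m := by simpa [Nat.lt_succ_iff] using hj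
      rw [if_neg (by omega), map_zero, mul_zero]
  · have hn : ¬(0 ≤ l ∧ k 0 ≤ 0) := fun h => hl h.1
    rw [if_neg hl, if_neg hn]
    refine Finset.sum_eq_zero fun j _ => ?_
    rw [map_zero, Submodule.coe_zero, LinearMap.zero_apply, mul_zero]

end OrdinaryModule
end VOA

/-! ### Rational functions as elements of localisations -/

namespace RegularRational

variable {m : ℕ} {S : Set (Fin m → ℂ)} {d : MvPolynomial (Fin m) ℂ}

/-- An element of the localisation away from a polynomial without zeros on `S`, as a fraction. -/
def ofLoc (hd : ∀ x ∈ S, MvPolynomial.aeval x d ≠ 0) (r : Localization.Away d) :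
    RegularRational S where
  num := (IsLocalization.Away.sec d r).1
  den := d ^ (IsLocalization.Away.sec d r).2
  den_ne x hx := by rw [map_pow]; exact pow_ne_zero _ (hd x hx)

variable {A : Type*} [CommRing A] [Algebra ℂ A]

/-- The evaluation of elements of the localisation at a point. -/
def locEval {x : Fin m → A} (hx : IsUnit (MvPolynomial.aeval x d)) : Localization.Away d →ₐ[ℂ] A :=
  IsLocalization.liftAlgHom (M := Submonoid.powers d) (f := MvPolynomial.aeval x) fun y => by
    obtain ⟨k, hk⟩ := y.2
    rw [← hk, map_pow]
    exact hx.pow k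

theorem locEval_algebraMap {x : Fin m → A} (hx : IsUnit (MvPolynomial.aeval x d))
    (p : MvPolynomial (Fin m) ℂ) :
    locEval hx (algebraMap _ (Localization.Away d) p) = MvPolynomial.aeval x p := by
  rw [locEval, IsLocalization.liftAlgHom_apply, IsLocalization.lift_eq]
  rfl

/-- The rational function may be evaluated in any commutative algebra in which the inverse is an
inverse of the units, such as `ℂ` or `ℂ⟦q⟧`. -/
theorem ofLoc_eval (hd : ∀ x ∈ S, MvPolynomial.aeval x d ≠ 0) (r : Localization.Away d) [Inv A]
    (hinv : ∀ y : A, IsUnit y → y * y⁻¹ = 1) {x : Fin m → A}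
    (hx : IsUnit (MvPolynomial.aeval x d)) : (ofLoc hd r).eval x = locEval hx r := by
  have h := congrArg (locEval hx) (IsLocalization.Away.sec_spec d r)
  rw [map_mul, locEval_algebraMap, locEval_algebraMap] at h
  have h2 : IsUnit (MvPolynomial.aeval x (d ^ (IsLocalization.Away.sec d r).2)) := by
    rw [map_pow]; exact hx.pow _
  rw [eval, ofLoc, ← h, mul_assoc, hinv _ h2, mul_one]

end RegularRational

namespace LaurentPoly

/-- The unit of a localisation given by a divisor of the denominator. -/
def divisorU {m : ℕ} {d p : MvPolynomial (Fin m) ℂ} (h : p ∣ d) : (Localization.Away d)ˣ :=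
  (isUnit_of_dvd_unit (map_dvd (algebraMap _ (Localization.Away d)) h)
    (IsLocalization.Away.algebraMap_isUnit d)).unit

theorem sub_dvd_discrAt {m : ℕ} {A : Type*} [CommRing A] (x : Fin m → A) {i j : Fin m}
    (h : i ≠ j) : x i - x j ∣ discrAt 1 x :=
  Dvd.dvd.trans (by
      have := Finset.dvd_prod_of_mem (fun j => (x i - x j) ^ 1)
        (Finset.mem_erase.mpr ⟨h.symm, Finset.mem_univ j⟩)
      rwa [pow_one] at this)
    (Finset.dvd_prod_of_mem (fun i => ∏ j ∈ Finset.univ.erase i, (x i - x j) ^ 1)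
      (Finset.mem_univ i))

theorem map_discrAt {m : ℕ} {A B : Type*} [CommRing A] [CommRing B] (φ : A →+* B) (K : ℕ)
    (x : Fin m → A) : φ (discrAt K x) = discrAt K fun i => φ (x i) := by
  simp [discrAt]

theorem discrAt_eq_pow {m : ℕ} {A : Type*} [CommRing A] (K : ℕ) (x : Fin m → A) :
    discrAt K x = discrAt 1 x ^ K := by
  simp only [discrAt, pow_one, ← Finset.prod_pow]

theorem discrAt_dvd {m k : ℕ} {A : Type*} [CommRing A] (x : Fin m → A) {f : Fin k → Fin m}
    (hf : Function.Injective f) : discrAt 1 (fun i => x (f i)) ∣ discrAt 1 x := by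
  classical
  have h1 : ∀ s : Finset (Fin m), ∀ t : Finset (Fin k), (∀ i ∈ t, f i ∈ s) → ∀ g : Fin m → A,
      ∏ i ∈ t, g (f i) ∣ ∏ i ∈ s, g i := by
    intro s t h g
    rw [show ∏ i ∈ t, g (f i) = ∏ i ∈ t.map ⟨f, hf⟩, g i from (Finset.prod_map t ⟨f, hf⟩ g).symm]
    refine Finset.prod_dvd_prod_of_subset _ _ _ fun a ha => ?_
    obtain ⟨i, hi, rfl⟩ := Finset.mem_map.mp ha
    exact h i hi
  refine Dvd.dvd.trans (Finset.prod_dvd_prod_of_dvd _ _ fun i _ => ?_)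
    (h1 Finset.univ Finset.univ (fun _ _ => Finset.mem_univ _)
      fun i => ∏ j ∈ Finset.univ.erase i, (x i - x j) ^ 1)
  refine h1 (Finset.univ.erase (f i)) (Finset.univ.erase i) (fun j hj => ?_) fun j => (x (f i) - x j) ^ 1
  exact Finset.mem_erase.mpr ⟨fun h => (Finset.ne_of_mem_erase hj) (hf h), Finset.mem_univ _⟩

end LaurentPoly

namespace QuasiprimaryFields

variable {n : ℕ} {U W : Type*} [AddCommGroup U] [Module ℂ U] [AddCommGroup W] [Module ℂ W]
  (S : QuasiprimaryFields n U W) {A : Type*} [CommRing A] [Algebra ℂ A]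

/-- The numerator of the genus zero correlation function, as a function of the units
`D = y₁ - y₂`, `r_i = y₁ - z_i` and `s_i = z_i - y₂`. -/
def ratVal (m : ℕ) (g : U) (w : W) (D : Aˣ) (r s : Fin n → Aˣ) : A :=
  ((D ^ (∑ i, S.lam i - 2 * m) * ∏ i, r i ^ (-2 * S.lam i) : Aˣ) : A) *
    ∑ a ∈ Finset.range (m + 1), ∑ c ∈ Finset.range (m + 1),
      ((a.factorial : ℂ)⁻¹ * (c.factorial : ℂ)⁻¹) •
        ev (fun i => s i * (r i)⁻¹) (S.poly ((S.EU ^ a) g) ((S.EW ^ c) w))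

theorem map_ratVal {B : Type*} [CommRing B] [Algebra ℂ B] (φ : A →ₐ[ℂ] B) (m : ℕ) (g : U) (w : W)
    (D : Aˣ) (r s : Fin n → Aˣ) :
    φ (S.ratVal m g w D r s) = S.ratVal m g w (Units.map (φ : A →* B) D)
      (fun i => Units.map (φ : A →* B) (r i)) fun i => Units.map (φ : A →* B) (s i) := by
  rw [ratVal, map_mul, ratVal, map_sum]
  congr 1
  · rw [← map_zpow, ← Finset.prod_congr rfl fun i _ => map_zpow (Units.map (φ : A →* B)) (r i) _,
      ← map_prod, ← map_mul]
    rfl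
  · refine Finset.sum_congr rfl fun a _ => ?_
    rw [map_sum]
    refine Finset.sum_congr rfl fun c _ => ?_
    rw [map_smul, map_ev]
    simp only [map_mul, map_inv]

/-- The denominator of the genus zero correlation functions. -/
def genusZeroDen (n : ℕ) : MvPolynomial (Fin (n + 2)) ℂ := discrAt 1 MvPolynomial.X

theorem sub_dvd_genusZeroDen {i j : Fin (n + 2)} (h : i ≠ j) :
    MvPolynomial.X i - MvPolynomial.X j ∣ genusZeroDen n := sub_dvd_discrAt MvPolynomial.X h

theorem aeval_genusZeroDen (x : Fin (n + 2) → A) :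
    MvPolynomial.aeval x (genusZeroDen n) = discrAt 1 x := by
  rw [genusZeroDen]
  exact (map_discrAt (MvPolynomial.aeval x : MvPolynomial (Fin (n + 2)) ℂ →ₐ[ℂ] A).toRingHom 1 _).trans
    (by simp)

theorem mid_injective : Function.Injective fun i : Fin n => i.castSucc.succ :=
  (Fin.succ_injective _).comp (Fin.castSucc_injective _)

theorem mid_ne_last (i : Fin n) : i.castSucc.succ ≠ Fin.last (n + 1) := by
  rw [Fin.succ_castSucc]
  exact (Fin.castSucc_lt_last _).ne

theorem discrAt_dvd_genusZeroDen :
    discrAt 1 (fun i : Fin n => (MvPolynomial.X i.castSucc.succ : MvPolynomial (Fin (n + 2)) ℂ)) ∣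
      genusZeroDen n := discrAt_dvd MvPolynomial.X mid_injective

/-- The rational function to which the genus zero correlation function converges, up to the factor
`(1 - y₂ / y₁)^(-2h)`. -/
def genusZeroRational (e : ℂ) (m : ℕ) (g : U) (w : W) :
    RegularRational {x : Fin (n + 2) → ℂ | Function.Injective x} :=
  RegularRational.ofLoc (d := genusZeroDen n)
    (fun x hx => by rw [aeval_genusZeroDen]; exact discrAt_ne_zero 1 hx)
    (e • (S.ratVal m g w
        (divisorU
          (sub_dvd_genusZeroDen (Fin.last_pos.ne : (0 : Fin (n + 2)) ≠ Fin.last _)))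
        (fun i => divisorU (sub_dvd_genusZeroDen (Fin.succ_ne_zero i.castSucc).symm))
        (fun i => divisorU (sub_dvd_genusZeroDen (mid_ne_last i))) *
      (((divisorU discrAt_dvd_genusZeroDen ^ S.K)⁻¹ :
        (Localization.Away (genusZeroDen n))ˣ) : Localization.Away (genusZeroDen n))))

theorem genusZeroRational_eval (e : ℂ) (m : ℕ) (g : U) (w : W) [Inv A]
    (hinv : ∀ y : A, IsUnit y → y * y⁻¹ = 1) {x : Fin (n + 2) → A} (hx : IsUnit (discrAt 1 x))
    {D P : Aˣ} {r s : Fin n → Aˣ} (hD : (D : A) = x 0 - x (Fin.last (n + 1)))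
    (hr : ∀ i, (r i : A) = x 0 - x i.castSucc.succ)
    (hs : ∀ i, (s i : A) = x i.castSucc.succ - x (Fin.last (n + 1)))
    (hP : (P : A) = discrAt S.K fun i => x i.castSucc.succ) :
    (S.genusZeroRational e m g w).eval x = e • (S.ratVal m g w D r s * ((P⁻¹ : Aˣ) : A)) := by
  have hx' : IsUnit (MvPolynomial.aeval x (genusZeroDen n)) := by rwa [aeval_genusZeroDen]
  rw [genusZeroRational, RegularRational.ofLoc_eval _ _ hinv hx', map_smul, map_mul, map_ratVal]
  have h1 : ∀ {p : MvPolynomial (Fin (n + 2)) ℂ} (h : p ∣ genusZeroDen n) {u : Aˣ},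
      (u : A) = MvPolynomial.aeval x p →
      Units.map (RegularRational.locEval hx' : Localization.Away (genusZeroDen n) →* A)
        (divisorU h) = u := by
    intro p h u hu
    ext1
    rw [hu]
    exact RegularRational.locEval_algebraMap hx' p
  have h2 : ∀ u : (Localization.Away (genusZeroDen n))ˣ,
      RegularRational.locEval hx' (u : Localization.Away (genusZeroDen n)) =
      ((Units.map (RegularRational.locEval hx' : Localization.Away (genusZeroDen n) →* A) u : Aˣ) : A) :=
    fun _ => rfl
  have h3 : IsUnit (discrAt 1 fun i : Fin n => x i.castSucc.succ) :=
    isUnit_of_dvd_unit (discrAt_dvd x mid_injective) hx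
  have h4 : P = h3.unit ^ S.K := by
    ext1
    rw [hP, discrAt_eq_pow, Units.val_pow_eq_pow_val, IsUnit.unit_spec]
  rw [h1 _ (u := D) (by rw [hD]; simp), h2, map_inv, map_pow, h1 _ (u := h3.unit), ← h4]
  · congr 3
    · funext i
      exact h1 _ (by rw [hr]; simp)
    · funext i
      exact h1 _ (by rw [hs]; simp)
  · rw [IsUnit.unit_spec]
    have := map_discrAt (MvPolynomial.aeval x : MvPolynomial (Fin (n + 2)) ℂ →ₐ[ℂ] A).toRingHom 1
      fun i : Fin n => MvPolynomial.X i.castSucc.succ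
    refine Eq.trans ?_ this.symm
    simp

/-- The denominator of the traces. -/
def traceDen (n : ℕ) : MvPolynomial (Fin n) ℂ := discrAt 1 MvPolynomial.X * ∏ i, MvPolynomial.X i

theorem aeval_traceDen (x : Fin n → A) :
    MvPolynomial.aeval x (traceDen n) = discrAt 1 x * ∏ i, x i := by
  rw [traceDen, map_mul]
  congr 1
  · exact (map_discrAt (MvPolynomial.aeval x : MvPolynomial (Fin n) ℂ →ₐ[ℂ] A).toRingHom 1 _).trans
      (by simp)
  · simp

theorem discrAt_dvd_traceDen : discrAt 1 MvPolynomial.X ∣ traceDen n := dvd_mul_right _ _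

theorem X_dvd_traceDen (i : Fin n) : MvPolynomial.X i ∣ traceDen n :=
  (Finset.dvd_prod_of_mem (fun i => (MvPolynomial.X i : MvPolynomial (Fin n) ℂ))
    (Finset.mem_univ i)).trans (dvd_mul_left _ _)

/-- The rational function `Q(x) / ∏ (x_i - x_j)^K` for a Laurent polynomial `Q`. -/
def traceRational (K : ℕ) (Q : LaurentPoly n) :
    RegularRational {x : Fin n → ℂ | Function.Injective x ∧ ∀ i, x i ≠ 0} :=
  RegularRational.ofLoc (d := traceDen n)
    (fun x hx => by
      rw [aeval_traceDen]
      exact mul_ne_zero (discrAt_ne_zero 1 hx.1) (Finset.prod_ne_zero_iff.mpr fun i _ => hx.2 i))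
    (ev (fun i => divisorU (X_dvd_traceDen i)) Q *
      (((divisorU discrAt_dvd_traceDen ^ K)⁻¹ :
        (Localization.Away (traceDen n))ˣ) : Localization.Away (traceDen n)))

theorem traceRational_eval (K : ℕ) (Q : LaurentPoly n) {x : Fin n → ℂ}
    (hx : Function.Injective x) {u : Fin n → ℂˣ} (hu : ∀ i, (u i : ℂ) = x i) :
    (traceRational K Q).eval x = ev u Q * (discrAt K x)⁻¹ := by
  have h0 : IsUnit (MvPolynomial.aeval x (traceDen n)) := by
    rw [aeval_traceDen]
    refine (mul_ne_zero (discrAt_ne_zero 1 hx) (Finset.prod_ne_zero_iff.mpr fun i _ => ?_)).isUnit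
    rw [← hu]
    exact (u i).ne_zero
  rw [traceRational, RegularRational.ofLoc_eval _ _ (fun y hy => mul_inv_cancel₀ hy.ne_zero) h0,
    map_mul, map_ev]
  congr 1
  · congr 2
    funext i
    ext1
    rw [hu]
    exact (RegularRational.locEval_algebraMap h0 _).trans (by simp)
  · have h1 : (Units.map (RegularRational.locEval h0 : Localization.Away (traceDen n) →* ℂ)
        (divisorU discrAt_dvd_traceDen ^ K) : ℂ) =
        discrAt K x := by
      rw [map_pow, Units.val_pow_eq_pow_val, discrAt_eq_pow K]
      congr 1
      refine (RegularRational.locEval_algebraMap h0 _).trans ?_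
      exact (map_discrAt (MvPolynomial.aeval x : MvPolynomial (Fin n) ℂ →ₐ[ℂ] ℂ).toRingHom 1 _).trans
        (by simp)
    rw [← h1, ← Units.val_inv_eq_inv_val, ← map_inv]
    rfl

end QuasiprimaryFields

/-! ### Convergence of the genus zero correlation functions and of the traces -/

namespace LaurentPoly

theorem prod_zpow_eq_zpow_sum {G ι : Type*} [CommGroup G] (s : Finset ι) (c : G) (k : ι → ℤ) :
    ∏ i ∈ s, c ^ k i = c ^ ∑ i ∈ s, k i := by
  classical
  induction s using Finset.induction_on with
  | empty => simp
  | insert i s hi ih => rw [Finset.prod_insert hi, Finset.sum_insert hi, ih, zpow_add]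

/-- The evaluation of a homogeneous Laurent polynomial at a multiple of a point. -/
theorem ev_mul_of_homogeneous {n : ℕ} {A : Type*} [CommRing A] [Algebra ℂ A] {p : LaurentPoly n}
    {d : ℤ} (hp : ∀ k, ∑ i, k i ≠ d → p.coeff k = 0) (c : Aˣ) (u : Fin n → Aˣ) :
    ev (fun i => c * u i) p = ((c ^ d : Aˣ) : A) * ev u p := by
  rw [ev_apply, ev_apply, Finset.mul_sum]
  refine Finset.sum_congr rfl fun k hk => ?_
  have hd : ∑ i, k i = d := by
    by_contra h
    exact (Finsupp.mem_support_iff.mp hk) (hp k h)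
  have : ∏ i, (c * u i) ^ k i = c ^ d * ∏ i, u i ^ k i := by
    simp only [mul_zpow, Finset.prod_mul_distrib]
    rw [← hd, prod_zpow_eq_zpow_sum]
  rw [this, Units.val_mul, mul_smul_comm]

end LaurentPoly

namespace QuasiprimaryFields

variable {n : ℕ} {U W : Type*} [AddCommGroup U] [Module ℂ U] [AddCommGroup W] [Module ℂ W]
  (S : QuasiprimaryFields n U W)

/-- The numerators with descendants are homogeneous. -/
theorem poly_homogeneous {η : ℂ} {g : U} {w : W} (hg : S.HU g = η • g) (hw : S.HW w = η • w)
    (a c : ℕ) (k : Fin n → ℤ) (hk : ∑ i, k i ≠ (a : ℤ) - c - ∑ i, S.lam i) :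
    (S.poly ((S.EU ^ a) g) ((S.EW ^ c) w)).coeff k = 0 := by
  refine S.coeff_poly_eq_zero (S.HU_EU_pow hg a) (S.HW_EW_pow hw c) fun h => hk ?_
  rw [Finset.sum_add_distrib] at h
  have : ((∑ i, k i : ℤ) : ℂ) = (((a : ℤ) - c - ∑ i, S.lam i : ℤ) : ℂ) := by
    push_cast
    linear_combination -h
  exact_mod_cast this

/-- By homogeneity, the powers of `y₁` cancel apart from the factor `(1 - y₂ / y₁)^(-2h)`. -/
theorem flowVal_eq_ratVal {h : ℂ} {m : ℕ} {g : U} {w : W} (hg : S.HU g = (h + m) • g)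
    (hw : S.HW w = (h + m) • w) {x : Fin n → ℂ} {y : ℂ} {y₁ D : ℂˣ} {r s u : Fin n → ℂˣ}
    (hD : (D : ℂ) = y₁ - y) (hr : ∀ i, (r i : ℂ) = y₁ - x i) (hs : ∀ i, (s i : ℂ) = x i - y)
    (hu : ∀ i, (u i : ℂ) = (x i - y) / (1 - x i * (y₁ : ℂ)⁻¹)) :
    S.flowVal h m w g x (y₁ : ℂ)⁻¹ y u = (1 - y / y₁) ^ (-2 * h) * S.ratVal m g w D r s := by
  have hy : (y₁ : ℂ) ≠ 0 := y₁.ne_zero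
  have h1 : ∀ i, 1 - x i * (y₁ : ℂ)⁻¹ = ((r i * y₁⁻¹ : ℂˣ) : ℂ) := fun i => by
    rw [Units.val_mul, hr, Units.val_inv_eq_inv_val]
    field_simp
  have h2 : (1 : ℂ) - (y₁ : ℂ)⁻¹ * y = ((D * y₁⁻¹ : ℂˣ) : ℂ) := by
    rw [Units.val_mul, hD, Units.val_inv_eq_inv_val]
    field_simp
  have h3 : u = fun i => y₁ * (s i * (r i)⁻¹) := by
    funext i
    ext1
    rw [hu, h1, ← hs, ← Units.val_div_eq_div_val]
    congr 1
    rw [div_eq_mul_inv, mul_inv, inv_inv, ← mul_assoc, mul_comm]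
  have h4 : (1 : ℂ) - y / y₁ = ((D * y₁⁻¹ : ℂˣ) : ℂ) := by rw [← h2]; ring
  rw [flowVal, ratVal, Finset.mul_sum, Finset.mul_sum]
  refine Finset.sum_congr rfl fun a _ => ?_
  rw [Finset.mul_sum, Finset.mul_sum]
  refine Finset.sum_congr rfl fun c hc => ?_
  have hc' : c ≤ m := by simpa [Nat.lt_succ_iff] using hc
  have e1 : (-2 * h - 2 * m + ∑ i, (S.lam i : ℂ)) =
      -2 * h + ((∑ i, S.lam i - 2 * m : ℤ) : ℂ) := by push_cast; ring
  rw [h3, ev_mul_of_homogeneous (S.poly_homogeneous hg hw a c), h2, h4, e1,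
    Complex.cpow_add _ _ (Units.ne_zero _), Complex.cpow_intCast]
  simp only [h1]
  have e2 : ((y₁ : ℂ)⁻¹) ^ (2 * m - c + a) = ((y₁ ^ (-(2 * m - c + a : ℤ)) : ℂˣ) : ℂ) := by
    rw [zpow_neg, ← inv_zpow, Units.val_zpow_eq_zpow_val, Units.val_inv_eq_inv_val,
      ← zpow_natCast]
    congr 1
    push_cast [(by omega : c ≤ 2 * m)]
    ring
  have key : y₁ ^ (-(2 * m - c + a : ℤ)) * (∏ i, (r i * y₁⁻¹) ^ (-2 * S.lam i)) *
      (D * y₁⁻¹) ^ (∑ i, S.lam i - 2 * m : ℤ) * y₁ ^ ((a : ℤ) - c - ∑ i, S.lam i) =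
      D ^ (∑ i, S.lam i - 2 * m : ℤ) * ∏ i, r i ^ (-2 * S.lam i) := by
    simp only [mul_zpow, Finset.prod_mul_distrib, inv_zpow', prod_zpow_eq_zpow_sum,
      Finset.sum_neg_distrib, ← Finset.mul_sum]
    have : y₁ ^ (-(2 * m - c + a : ℤ)) * y₁ ^ (-(-2 * ∑ i, S.lam i)) *
        y₁ ^ (-(∑ i, S.lam i - 2 * m : ℤ)) * y₁ ^ ((a : ℤ) - c - ∑ i, S.lam i) = 1 := by
      rw [← zpow_add, ← zpow_add, ← zpow_add, ← zpow_zero y₁]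
      congr 1
      ring
    calc _ = (D ^ (∑ i, S.lam i - 2 * m : ℤ) * ∏ i, r i ^ (-2 * S.lam i)) *
        (y₁ ^ (-(2 * m - c + a : ℤ)) * y₁ ^ (-(-2 * ∑ i, S.lam i)) *
        y₁ ^ (-(∑ i, S.lam i - 2 * m : ℤ)) * y₁ ^ ((a : ℤ) - c - ∑ i, S.lam i)) := by
          simp only [mul_assoc, mul_left_comm, mul_comm]
      _ = _ := by rw [this, mul_one]
  have key' := congrArg Units.val key
  rw [e2]
  simp only [Units.val_mul, Units.coe_prod, Units.val_zpow_eq_zpow_val] at key' ⊢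
  simp only [smul_eq_mul]
  rw [← key']
  ring

end QuasiprimaryFields

theorem bracketed_zero {A : Type*} {n : ℕ} (a : A) (z : Fin n → A) (b : A) :
    bracketed a z b 0 = a := rfl

theorem bracketed_mid {A : Type*} {n : ℕ} (a : A) (z : Fin n → A) (b : A) (i : Fin n) :
    bracketed a z b i.castSucc.succ = z i := by
  rw [bracketed, Fin.cons_succ, Fin.snoc_castSucc]

theorem bracketed_last {A : Type*} {n : ℕ} (a : A) (z : Fin n → A) (b : A) :
    bracketed a z b (Fin.last (n + 1)) = b := by
  rw [bracketed, ← Fin.succ_last, Fin.cons_succ, Fin.snoc_last]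

theorem eq_bracketed {A : Type*} {n : ℕ} (x : Fin (n + 2) → A) :
    x = bracketed (x 0) (fun i => x i.castSucc.succ) (x (Fin.last (n + 1))) := by
  funext i
  refine Fin.cases rfl (fun i => ?_) i
  refine Fin.lastCases ?_ (fun i => ?_) i
  · rw [Fin.succ_last, bracketed_last]
  · rw [bracketed_mid]

theorem prod_bracketed {A : Type*} [CommMonoid A] {n : ℕ} (f : Fin (n + 2) → A) :
    ∏ i, f i = f 0 * ((∏ i : Fin n, f i.castSucc.succ) * f (Fin.last (n + 1))) := by
  rw [Fin.prod_univ_succ, Fin.prod_univ_castSucc, Fin.succ_last]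

namespace VOA.OrdinaryModule

variable {V : Type*} [AddCommGroup V] [Module ℂ V] {𝒱 : VOA V}
  {W : Type*} [AddCommGroup W] [Module ℂ W] (M : 𝒱.OrdinaryModule W)
  {n : ℕ} {v : Fin n → V} {wt : Fin n → ℕ} (hv : ∀ i, 𝒱.IsQuasiprimary (v i) (wt i))

/-- The exponents of `y₁^(-p) z^k y₂^l` for `(k, (l, p))`. -/
def exponents (n : ℕ) (z : (Fin n → ℤ) × (ℕ × ℕ)) : Fin (n + 2) → ℤ :=
  bracketed (-(z.2.2 : ℤ)) z.1 z.2.1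

theorem exponents_injective (n : ℕ) : Function.Injective (exponents n) := by
  rintro ⟨k, l, p⟩ ⟨k', l', p'⟩ h
  have h0 := congrFun h 0
  have h1 := congrFun h (Fin.last (n + 1))
  have h2 : ∀ i, k i = k' i := fun i => by
    have := congrFun h i.castSucc.succ
    rwa [exponents, exponents, bracketed_mid, bracketed_mid] at this
  simp only [exponents, bracketed_zero, neg_inj, Nat.cast_inj] at h0
  simp only [exponents, bracketed_last, Nat.cast_inj] at h1
  rw [h0, h1, funext h2]

/-- The genus zero correlation functions converge to rational functions, up to the factor
`(1 - y₂ / y₁)^(-2h)`. -/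
theorem convergesTo_genusZero (hcft : 𝒱.IsStrongCFTType) (hsimple : 𝒱.IsSimple)
    (hdual : 𝒱.IsSelfDual) (ℓ : ℂ) {m : ℕ} {w : W} (hw : w ∈ M.gr m)
    (φ : Module.Dual ℂ (M.gr m)) :
    ConvergesTo {x | Function.Injective x} (M.genusZeroCoeff ℓ v w (M.extend m φ))
      (fun x => (1 - x (Fin.last (n + 1)) / x 0) ^ (-2 * M.h) *
        ((M.quasiprimaryFields hv).genusZeroRational (Complex.exp (ℓ * (M.h + m))) m
          (M.extend m φ) w).eval x) := by
  set S := M.quasiprimaryFields hv with hS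
  intro x hx hanti
  have hinj : Function.Injective x := hx
  set z : Fin n → ℂ := fun i => x i.castSucc.succ with hz
  set y := x (Fin.last (n + 1)) with hy
  have h0l : ‖y‖ < ‖x 0‖ := hanti (Fin.last_pos)
  have h0z : ∀ i, ‖z i‖ < ‖x 0‖ := fun i => hanti (Fin.succ_pos _)
  have hzl : ∀ i, ‖y‖ < ‖z i‖ := fun i => hanti (lt_of_le_of_ne (Fin.le_last _)
    (QuasiprimaryFields.mid_ne_last i))
  have hx0 : x 0 ≠ 0 := norm_pos_iff.mp ((norm_nonneg _).trans_lt h0l)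
  have hz0 : ∀ i, z i ≠ 0 := fun i => norm_pos_iff.mp ((norm_nonneg _).trans_lt (hzl i))
  have hpos : 0 < ‖x 0‖ := norm_pos_iff.mpr hx0
  have hD : x 0 - y ≠ 0 := sub_ne_zero.mpr fun h => h0l.ne (by rw [h])
  have hr : ∀ i, x 0 - z i ≠ 0 := fun i => sub_ne_zero.mpr fun h => (h0z i).ne (by rw [h])
  have hs : ∀ i, z i - y ≠ 0 := fun i => sub_ne_zero.mpr fun h => (hzl i).ne (by rw [h])
  have hden : ∀ i, 1 - z i * (x 0)⁻¹ ≠ 0 := fun i h => hr i (by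
    have : x 0 * (1 - z i * (x 0)⁻¹) = x 0 - z i := by field_simp
    rw [← this, h, mul_zero])
  have hzinj : Function.Injective z := hinj.comp QuasiprimaryFields.mid_injective
  have hP : discrAt S.K z ≠ 0 := discrAt_ne_zero _ hzinj
  have hgS : S.HU (M.extend m φ) = (M.h + m) • M.extend m φ := M.HU_extend hv φ
  have hwS : S.HW w = (M.h + m) • w := M.HW_apply hv hw
  have h1 := S.hasSum_corrTY hwS hgS (M.EW_pow_eq_zero hv hw) (M.EU_pow_eq_zero hv φ)
    (x := z) (t := (x 0)⁻¹) (y := y)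
    (fun i j hij => hanti (Fin.succ_lt_succ_iff.mpr (Fin.castSucc_lt_castSucc_iff.mpr hij))) hz0
    (fun i => by rw [norm_mul, norm_inv, ← div_eq_mul_inv]; exact (div_lt_one hpos).mpr (h0z i))
    (fun i => by
      rw [norm_mul, norm_inv, mul_comm, ← div_eq_mul_inv]
      exact (div_lt_one (norm_pos_iff.mpr (hz0 i))).mpr (hzl i))
    (by rw [norm_mul, norm_inv, mul_comm, ← div_eq_mul_inv]; exact (div_lt_one hpos).mpr h0l)
    (u := fun i => Units.mk0 _ (div_ne_zero (hs i) (hden i))) (fun i => rfl)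
  have h2 := S.flowVal_eq_ratVal hgS hwS (x := z) (y := y) (y₁ := Units.mk0 (x 0) hx0)
    (D := Units.mk0 _ hD) (r := fun i => Units.mk0 _ (hr i)) (s := fun i => Units.mk0 _ (hs i))
    rfl (fun _ => rfl) (fun _ => rfl) (u := fun i => Units.mk0 _ (div_ne_zero (hs i) (hden i)))
    (fun i => rfl)
  rw [Units.val_mk0] at h2
  rw [h2] at h1
  beta_reduce
  rw [S.genusZeroRational_eval _ m _ w (fun y hy => mul_inv_cancel₀ hy.ne_zero)
    (discrAt_ne_zero 1 hinj).isUnit (D := Units.mk0 _ hD) (P := Units.mk0 _ hP)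
    (r := fun i => Units.mk0 _ (hr i)) (s := fun i => Units.mk0 _ (hs i)) rfl (fun _ => rfl)
    (fun _ => rfl) rfl]
  rw [← (exponents_injective n).hasSum_iff]
  · refine hasSum_congr' ?_ ?_ (f := fun z' => Complex.exp (ℓ * (M.h + m)) *
      (S.corrTY m w (M.extend m φ) z'.2 z'.1 *
        ((∏ i, z i ^ z'.1 i) * (y ^ z'.2.1 * ((x 0)⁻¹) ^ z'.2.2))))
    · refine (congrArg (HasSum _) ?_).mp (h1.mul_left (Complex.exp (ℓ * (M.h + m))))
      rw [Units.val_inv_eq_inv_val, Units.val_mk0, smul_eq_mul]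
      ring
    · rintro ⟨k, l, p⟩
      rw [Function.comp_apply, M.genusZeroCoeff_eq hv hcft hsimple hdual ℓ hw, prod_bracketed]
      simp only [exponents, bracketed_zero, bracketed_last, bracketed_mid]
      rw [if_pos ⟨by omega, by omega⟩, Int.toNat_natCast, neg_neg, Int.toNat_natCast, zpow_neg,
        zpow_natCast, zpow_natCast, inv_pow]
      ring
  -- no other powers of `y₁` and `y₂` occur
  · intro k hk
    rw [M.genusZeroCoeff_eq hv hcft hsimple hdual ℓ hw]
    split_ifs with h
    · refine absurd ⟨(fun i => k i.castSucc.succ, ((k (Fin.last (n + 1))).toNat, (-k 0).toNat)), ?_⟩ hk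
      conv_rhs => rw [eq_bracketed k]
      rw [exponents, Int.toNat_of_nonneg h.1, Int.toNat_of_nonneg (by omega), neg_neg]
    · rw [zero_mul]

/-- The traces converge to rational functions. -/
theorem convergesTo_trace {m : ℕ} {ι : Type*} [Fintype ι] (b : Module.Basis ι ℂ (M.gr m)) :
    ConvergesTo {x | Function.Injective x ∧ ∀ i, x i ≠ 0} (M.traceCoeff v m)
      (fun x => (QuasiprimaryFields.traceRational (M.quasiprimaryFields hv).K
        (∑ i, (M.quasiprimaryFields hv).poly (M.extend m (b.coord i)) (b i))).eval x) := by
  intro x hx hanti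
  set S := M.quasiprimaryFields hv with hS
  beta_reduce
  rw [QuasiprimaryFields.traceRational_eval _ _ hx.1 (u := fun i => Units.mk0 _ (hx.2 i))
      fun _ => rfl,
    map_sum, Finset.sum_mul]
  refine hasSum_congr' (hasSum_sum fun i _ => S.hasSum_corr (M.extend m (b.coord i)) (b i) hanti
    (u := fun i => Units.mk0 _ (hx.2 i)) fun _ => rfl) fun k => ?_
  rw [M.traceCoeff_eq b, Finset.sum_mul]
  exact Finset.sum_congr rfl fun i _ => by rw [corr_quasiprimaryFields]

end VOA.OrdinaryModule

/-! ### The sewn genus one function -/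

namespace Sewing

/-- Constant power series, on units. -/
def constU : ℂˣ →* ℂ⟦X⟧ˣ := Units.map (C : ℂ →+* ℂ⟦X⟧).toMonoidHom

theorem coe_constU (a : ℂˣ) : (constU a : ℂ⟦X⟧) = C (a : ℂ) := rfl

/-- The inverse of `1 - q`. -/
def invOneSub : ℂ⟦X⟧ := (((oneSub (1 : ℂ))⁻¹ : ℂ⟦X⟧ˣ) : ℂ⟦X⟧)

theorem one_sub_mul_invOneSub : (1 - X) * invOneSub = 1 := by
  have := Units.mul_inv (oneSub (1 : ℂ))
  rwa [coe_oneSub, map_one, one_mul] at this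

theorem inv_one_sub_X : (1 - X : ℂ⟦X⟧)⁻¹ = invOneSub := by
  rw [PowerSeries.inv_eq_iff_mul_eq_one (by simp), mul_comm]
  exact one_sub_mul_invOneSub

theorem inv_one_sub_X_sq : ((1 - X : ℂ⟦X⟧) ^ 2)⁻¹ = invOneSub ^ 2 := by
  rw [PowerSeries.inv_eq_iff_mul_eq_one (by simp), ← mul_pow, mul_comm, one_sub_mul_invOneSub,
    one_pow]

theorem sewingPoint_eq (W W' : ℂ) : sewingPoint W W' = (C W - X * C W') * invOneSub := by
  rw [sewingPoint, inv_one_sub_X]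

theorem constantCoeff_sewingPoint (W W' : ℂ) : constantCoeff (sewingPoint W W') = W := by
  rw [sewingPoint, inv_one_sub_X, map_mul]
  have := congrArg constantCoeff one_sub_mul_invOneSub
  simp at this
  simp [this]

/-- The sewing parameter `q / (1 + q)²`. -/
def kappa : ℂ⟦X⟧ := X * (((oneSub (-1 : ℂ))⁻¹ ^ 2 : ℂ⟦X⟧ˣ) : ℂ⟦X⟧)

theorem one_add_sq_mul_kappa : (1 + X) ^ 2 * kappa = X := by
  have h := Units.mul_inv (oneSub (-1 : ℂ))
  rw [coe_oneSub, map_neg, map_one] at h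
  rw [kappa, Units.val_pow_eq_pow_val]
  linear_combination X * ((1 + X) * (((oneSub (-1 : ℂ))⁻¹ : ℂ⟦X⟧ˣ) : ℂ⟦X⟧) + 1) * h

/-- The difference `w₊ - w₋` of the sewing points, for `b = W₊ - W₋`. -/
def diffU (b : ℂˣ) : ℂ⟦X⟧ˣ := constU b * oneSub (-1) * (oneSub 1)⁻¹

theorem coe_diffU {b : ℂˣ} {Wp Wm : ℂ} (hb : (b : ℂ) = Wp - Wm) :
    (diffU b : ℂ⟦X⟧) = sewingPoint Wp Wm - sewingPoint Wm Wp := by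
  rw [sewingPoint_eq, sewingPoint_eq, diffU, Units.val_mul, Units.val_mul, ← invOneSub, coe_oneSub,
    coe_constU, hb, map_sub, map_neg, map_one]
  ring

theorem sewingRho_eq {b : ℂˣ} {Wp Wm : ℂ} (hb : (b : ℂ) = Wp - Wm) :
    sewingRho Wp Wm = -(kappa * (diffU b : ℂ⟦X⟧) ^ 2) := by
  have h := one_add_sq_mul_kappa
  rw [sewingRho, inv_one_sub_X_sq, diffU, Units.val_mul, Units.val_mul, ← invOneSub, coe_oneSub,
    coe_constU, hb]
  simp only [map_pow, map_sub, map_neg, map_one]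
  linear_combination (C Wp - C Wm) ^ 2 * invOneSub ^ 2 * h

/-- The difference `w₊ - z`, for `a = z - W₊` and `ξ = (z - W₋) / (z - W₊)`. -/
def leftU (a x : ℂˣ) : ℂ⟦X⟧ˣ := -1 * constU a * oneSub (x : ℂ) * (oneSub 1)⁻¹

theorem coe_leftU {a x : ℂˣ} {Wp Wm z : ℂ} (ha : (a : ℂ) = z - Wp) (hx : (x : ℂ) * a = z - Wm) :
    (leftU a x : ℂ⟦X⟧) = sewingPoint Wp Wm - C z := by
  have h1 := one_sub_mul_invOneSub
  have h2 := congrArg (C : ℂ →+* ℂ⟦X⟧) ha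
  have h3 := congrArg (C : ℂ →+* ℂ⟦X⟧) hx
  simp only [map_sub, map_mul] at h2 h3
  rw [sewingPoint_eq, leftU, Units.val_mul, Units.val_mul, Units.val_mul, ← invOneSub, coe_oneSub,
    coe_constU, Units.val_neg, Units.val_one]
  linear_combination X * invOneSub * h3 - invOneSub * h2 - C z * h1

/-- The difference `z - w₋`, for `a = z - W₊` and `ξ = (z - W₋) / (z - W₊)`. -/
def rightU (a x : ℂˣ) : ℂ⟦X⟧ˣ :=
  constU a * (constU x * oneSub ((x⁻¹ : ℂˣ) : ℂ)) * (oneSub 1)⁻¹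

theorem coe_rightU {a x : ℂˣ} {Wp Wm z : ℂ} (ha : (a : ℂ) = z - Wp) (hx : (x : ℂ) * a = z - Wm) :
    (rightU a x : ℂ⟦X⟧) = C z - sewingPoint Wm Wp := by
  have h1 := one_sub_mul_invOneSub
  have h2 := congrArg (C : ℂ →+* ℂ⟦X⟧) ha
  have h3 := congrArg (C : ℂ →+* ℂ⟦X⟧) hx
  have h4 := congrArg (C : ℂ →+* ℂ⟦X⟧) (Units.mul_inv x)
  simp only [map_sub, map_mul, map_one] at h2 h3 h4
  rw [sewingPoint_eq, rightU, Units.val_mul, Units.val_mul, Units.val_mul, ← invOneSub, coe_oneSub,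
    coe_constU, coe_constU]
  linear_combination invOneSub * h3 - X * invOneSub * h2 + C z * h1 - C (a : ℂ) * X * invOneSub * h4

theorem rightU_div_leftU (a x : ℂˣ) : rightU a x * (leftU a x)⁻¹ = -1 * unitS x := by
  rw [rightU, leftU, unitS, ← constU]
  simp only [mul_inv, inv_inv, inv_neg, inv_one]
  calc _ = constU a * (constU a)⁻¹ * ((oneSub 1)⁻¹ * oneSub 1) *
      (-1 * (constU x * oneSub ((x⁻¹ : ℂˣ) : ℂ) * (oneSub (x : ℂ))⁻¹)) := by
        simp only [mul_assoc, mul_left_comm, mul_comm]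
    _ = _ := by rw [mul_inv_cancel, inv_mul_cancel, one_mul, one_mul]

theorem diffU_div_leftU_sq (b a x : ℂˣ) :
    diffU b * ((leftU a x)⁻¹ * (leftU a x)⁻¹) = -1 * (constU (-b * (a⁻¹ * a⁻¹)) * jacS x) := by
  have h1 : constU (-b * (a⁻¹ * a⁻¹)) = -1 * constU b * ((constU a)⁻¹ * (constU a)⁻¹) := by
    rw [map_mul, map_mul, map_inv]
    congr 1
    ext1
    simp [coe_constU]
  rw [h1, diffU, leftU, jacS]
  simp only [mul_inv, inv_inv, inv_neg, inv_one]
  calc _ = ((oneSub 1)⁻¹ * oneSub 1) * ((-1 : ℂ⟦X⟧ˣ) * -1) * (constU b * oneSub (-1) *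
      ((constU a)⁻¹ * (constU a)⁻¹) * oneSub 1 * ((oneSub (x : ℂ))⁻¹ * (oneSub (x : ℂ))⁻¹)) := by
        simp only [mul_assoc, mul_left_comm, mul_comm]
    _ = ((-1 : ℂ⟦X⟧ˣ) * -1) * (constU b * oneSub (-1) *
      ((constU a)⁻¹ * (constU a)⁻¹) * oneSub 1 * ((oneSub (x : ℂ))⁻¹ * (oneSub (x : ℂ))⁻¹)) := by
        rw [inv_mul_cancel, one_mul]
    _ = _ := by simp only [mul_assoc, mul_left_comm, mul_comm]

/-- If the `n`-th term is divisible by `q^n`, then the coefficients of the sum are those of its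
partial sums. -/
theorem coeff_mul_mk_sum {f : ℕ → ℂ⟦X⟧} (hf : ∀ n, X ^ n ∣ f n) (g : ℂ⟦X⟧) (M : ℕ) :
    coeff M (g * PowerSeries.mk fun m => coeff m (∑ n ∈ Finset.range (m + 1), f n)) =
      coeff M (g * ∑ n ∈ Finset.range (M + 1), f n) := by
  rw [coeff_mul, coeff_mul]
  refine Finset.sum_congr rfl fun p hp => ?_
  rw [Finset.HasAntidiagonal.mem_antidiagonal] at hp
  rw [coeff_mk, map_sum, map_sum]
  congr 1
  refine Finset.sum_subset (fun n hn => ?_) fun n _ hn => ?_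
  · rw [Finset.mem_range] at hn ⊢
    omega
  · rw [Finset.mem_range] at hn
    exact X_pow_dvd_iff.mp (hf n) _ (by omega)

end Sewing

namespace QuasiprimaryFields

open Sewing

variable {n : ℕ} {U W : Type*} [AddCommGroup U] [Module ℂ U] [AddCommGroup W] [Module ℂ W]
  (S : QuasiprimaryFields n U W)

/-- The genus zero correlation function at the sewing points: in the coordinates
`ξ = (z - W₋) / (z - W₊)`, the Möbius transformation which sends `w₊` to `∞` and `w₋` to `0` is the
flow `ξ ↦ (ξ - q) / (1 - q ξ)`, up to a sign. -/
theorem ratVal_sewing {η : ℂ} {m : ℕ} {g : U} {w : W} (hg : S.HU g = η • g) (hw : S.HW w = η • w)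
    (b : ℂˣ) (a x : Fin n → ℂˣ) :
    S.ratVal m g w (diffU b) (fun i => leftU (a i) (x i)) (fun i => rightU (a i) (x i)) =
      ((diffU b ^ (-2 * m : ℤ) : ℂ⟦X⟧ˣ) : ℂ⟦X⟧) *
        (C (∏ i, ((-b * ((a i)⁻¹ * (a i)⁻¹) : ℂˣ) : ℂ) ^ S.lam i) * S.sewTerm m x g w) := by
  have he : ∀ i, diffU b * ((leftU (a i) (x i))⁻¹ * (leftU (a i) (x i))⁻¹) =
      -1 * (constU (-b * ((a i)⁻¹ * (a i)⁻¹)) * jacS (x i)) := fun i => diffU_div_leftU_sq _ _ _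
  obtain ⟨e, hee⟩ : ∃ e : Fin n → ℂˣ, ∀ i, -b * ((a i)⁻¹ * (a i)⁻¹) = e i := ⟨_, fun _ => rfl⟩
  simp only [hee] at he ⊢
  have h1 : diffU b ^ (∑ i, S.lam i - 2 * m : ℤ) * ∏ i, leftU (a i) (x i) ^ (-2 * S.lam i) =
      (-1) ^ (∑ i, S.lam i) * (diffU b ^ (-2 * m : ℤ) *
        (constU (∏ i, e i ^ S.lam i) * S.jacProd x)) := by
    have h2 : ∀ i, leftU (a i) (x i) ^ (-2 * S.lam i) =
        ((leftU (a i) (x i))⁻¹ * (leftU (a i) (x i))⁻¹) ^ S.lam i := fun i => by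
      rw [zpow_mul, ← pow_two, inv_pow, zpow_neg]
      rfl
    have h3 : (-1 : ℂ⟦X⟧ˣ) ^ (∑ i, S.lam i) * (constU (∏ i, e i ^ S.lam i) *
        S.jacProd x) = ∏ i, (diffU b * ((leftU (a i) (x i))⁻¹ * (leftU (a i) (x i))⁻¹)) ^ S.lam i := by
      simp only [he, mul_zpow _ _ (S.lam _), Finset.prod_mul_distrib, prod_zpow_eq_zpow_sum,
        jacProd,
        map_prod, map_zpow]
    rw [mul_left_comm, h3]
    simp only [h2, mul_zpow (diffU b), Finset.prod_mul_distrib, prod_zpow_eq_zpow_sum]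
    rw [← mul_assoc, ← zpow_add]
    congr 2
    ring
  -- the sign of the Möbius transformation gives the signs of `exp(-E) g ⊗ exp(-E) w`
  have h4 : ∀ p c : ℕ, (((-1 : ℂ⟦X⟧ˣ) ^ (∑ i, S.lam i) * (-1) ^ ((p : ℤ) - c - ∑ i, S.lam i) : ℂ⟦X⟧ˣ) :
      ℂ⟦X⟧) = algebraMap ℂ ℂ⟦X⟧ ((-1) ^ (p + c)) := by
    intro p c
    have : (-1 : ℂ⟦X⟧ˣ) ^ ((p : ℤ) - c) = (-1) ^ (p + c) := by
      have e : (-1 : ℂ⟦X⟧ˣ) ^ (-(c : ℤ)) = (-1) ^ c := by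
        rw [← inv_zpow', inv_neg, inv_one, zpow_natCast]
      rw [sub_eq_add_neg, zpow_add, e, zpow_natCast, pow_add]
    rw [← zpow_add, add_sub_cancel, this]
    simp
  rw [ratVal, h1, sewTerm, Units.val_mul, Units.val_mul, Units.val_mul, coe_constU]
  simp only [rightU_div_leftU]
  have h5 : (((∏ i, e i ^ S.lam i : ℂˣ)) : ℂ) =
      ∏ i, (e i : ℂ) ^ S.lam i := by
    rw [Units.coe_prod]
    exact Finset.prod_congr rfl fun i _ => Units.val_zpow_eq_zpow_val _ _
  have h6 : ∑ p ∈ Finset.range (m + 1), ∑ c ∈ Finset.range (m + 1),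
      ((-1) ^ (p + c) * ((p.factorial : ℂ)⁻¹ * (c.factorial : ℂ)⁻¹)) •
        ev (fun i => unitS (x i)) (S.poly ((S.EU ^ p) g) ((S.EW ^ c) w)) =
      (((-1 : ℂ⟦X⟧ˣ) ^ (∑ i, S.lam i) : ℂ⟦X⟧ˣ) : ℂ⟦X⟧) *
        ∑ p ∈ Finset.range (m + 1), ∑ c ∈ Finset.range (m + 1),
          ((p.factorial : ℂ)⁻¹ * (c.factorial : ℂ)⁻¹) •
            ev (fun i => -1 * unitS (x i)) (S.poly ((S.EU ^ p) g) ((S.EW ^ c) w)) := by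
    rw [Finset.mul_sum]
    refine Finset.sum_congr rfl fun p _ => ?_
    rw [Finset.mul_sum]
    refine Finset.sum_congr rfl fun c _ => ?_
    rw [ev_mul_of_homogeneous (S.poly_homogeneous hg hw p c), mul_smul, Algebra.smul_def, ← h4,
      mul_smul_comm, Units.val_mul, mul_assoc, ← mul_smul_comm]
  rw [h6, ← h5]
  ring

/-- The discriminant in the coordinates `(z - W₋) / (z - W₊)`. -/
theorem discrAt_moebius (K : ℕ) (b : ℂ) {a x z : Fin n → ℂ}
    (h : ∀ i j, x i - x j = -(b * (a i * a j) * (z i - z j))) :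
    discrAt K x = discrAt K z * (∏ i, (-(b * (a i * a i))) ^ (n - 1)) ^ K := by
  rw [discrAt_eq_pow K x, discrAt_eq_pow K z, ← mul_pow]
  congr 1
  have hc : ∀ i : Fin n, (Finset.univ.erase i).card = n - 1 := fun i => by
    rw [Finset.card_erase_of_mem (Finset.mem_univ i), Finset.card_univ, Fintype.card_fin]
  have h1 : ∏ i, ∏ j ∈ Finset.univ.erase i, a j = ∏ i, a i ^ (n - 1) := by
    rw [Finset.prod_comm' (t' := Finset.univ) (s' := fun j => Finset.univ.erase j)
      (by simp [eq_comm])]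
    refine Finset.prod_congr rfl fun i _ => ?_
    rw [Finset.prod_const, hc]
  have h2 : ∀ i j, x i - x j = -b * a i * a j * (z i - z j) := fun i j => by rw [h]; ring
  simp only [discrAt, pow_one, h2, Finset.prod_mul_distrib, Finset.prod_const, hc, h1,
    Finset.card_univ, Fintype.card_fin]
  have h3 : ∀ i : Fin n, (-(b * (a i * a i))) ^ (n - 1) =
      (-b) ^ (n - 1) * a i ^ (n - 1) * a i ^ (n - 1) := fun i => by
    rw [← mul_pow, ← mul_pow]; ring
  simp only [h3, Finset.prod_mul_distrib, Finset.prod_const, Finset.card_univ, Fintype.card_fin]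
  ring

/-- The value of the sewn genus one function: the powers of `w₊ - w₋` cancel between `ρ^m` and the
correlation functions, and the sign of `ρ^m` cancels against `exp (ℓ m) = (-1)^m`, so that the sum
becomes the one in `sewing`. -/
theorem genusOneSewn_eq {ℓ h : ℂ} (hℓ : Complex.exp ℓ = -1) {ι : ℕ → Type*} [∀ m, Fintype (ι m)]
    {g : ∀ m, ι m → U} {w : ∀ m, ι m → W}
    (hHg : ∀ m i, S.HU (g m i) = (h + m) • g m i) (hHw : ∀ m i, S.HW (w m i) = (h + m) • w m i)
    (hEg : ∀ m i, (S.EU ^ (m + 1)) (g m i) = 0) (hEw : ∀ m i, (S.EW ^ (m + 1)) (w m i) = 0)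
    (hFE : ∀ m, S.FT (∑ i, TensorProduct.tmul ℂ (g m i) (w m i)) =
      S.ET (∑ i, TensorProduct.tmul ℂ (g (m + 1) i) (w (m + 1) i)))
    {Wp Wm : ℂ} {z : Fin n → ℂ} (hz : Function.Injective z) {b : ℂˣ} {a x : Fin n → ℂˣ}
    (hb : (b : ℂ) = Wp - Wm) (ha : ∀ i, (a i : ℂ) = z i - Wp)
    (hx : ∀ i, (x i : ℂ) * a i = z i - Wm) (M : ℕ) :
    coeff M (genusOneSewn ℓ h (fun m i =>
        S.genusZeroRational (Complex.exp (ℓ * (h + m))) m (g m i) (w m i)) Wp Wm z) =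
      (discrAt S.K z)⁻¹ * (∏ i, ((-b * ((a i)⁻¹ * (a i)⁻¹) : ℂˣ) : ℂ) ^ S.lam i) *
        ∑ i, ev x (S.poly (g M i) (w M i)) := by
  set Ξ : ℂ := ∏ i, ((-b * ((a i)⁻¹ * (a i)⁻¹) : ℂˣ) : ℂ) ^ S.lam i with hΞ
  have hP : discrAt S.K z ≠ 0 := discrAt_ne_zero _ hz
  have hzp : ∀ i, z i ≠ Wp := fun i h => (a i).ne_zero (by rw [ha, h, sub_self])
  have hzm : ∀ i, z i ≠ Wm := fun i h => by
    have := hx i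
    rw [h, sub_self] at this
    exact mul_ne_zero (x i).ne_zero (a i).ne_zero this
  have hpm : Wp ≠ Wm := fun h => b.ne_zero (by rw [hb, h, sub_self])
  set X' := bracketed (sewingPoint Wp Wm) (fun k => (C (z k) : ℂ⟦X⟧)) (sewingPoint Wm Wp) with hX'
  have hunit : IsUnit (discrAt 1 X') := by
    rw [PowerSeries.isUnit_iff_constantCoeff, map_discrAt]
    refine (discrAt_ne_zero 1 ?_).isUnit
    have e : (fun i => constantCoeff (X' i)) = bracketed Wp z Wm := by
      rw [eq_bracketed fun i => constantCoeff (X' i)]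
      simp only [hX', bracketed_zero, bracketed_mid, bracketed_last, constantCoeff_sewingPoint,
        constantCoeff_C]
    rw [e, bracketed, Fin.cons_injective_iff, Fin.snoc_injective_iff]
    refine ⟨?_, hz, ?_⟩
    · rintro ⟨i, hi⟩
      revert hi
      refine Fin.lastCases ?_ (fun i => ?_) i
      · rw [Fin.snoc_last]; exact fun h => hpm h.symm
      · rw [Fin.snoc_castSucc]; exact hzp i
    · rintro ⟨i, hi⟩
      exact hzm i hi
  -- the correlation functions at the sewing points
  have hR : ∀ (m : ℕ) i, (S.genusZeroRational (Complex.exp (ℓ * (h + m))) m (g m i) (w m i)).eval X' =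
      C (Complex.exp (ℓ * (h + m)) * ((discrAt S.K z)⁻¹ * Ξ)) *
        (((diffU b ^ (-2 * m : ℤ) : ℂ⟦X⟧ˣ) : ℂ⟦X⟧) * S.sewTerm m x (g m i) (w m i)) := by
    intro m i
    rw [S.genusZeroRational_eval _ m _ _ (fun y hy => PowerSeries.mul_inv_cancel _
        ((PowerSeries.isUnit_iff_constantCoeff.mp hy).ne_zero)) hunit (D := diffU b)
      (r := fun i => leftU (a i) (x i)) (s := fun i => rightU (a i) (x i))
      (P := constU (Units.mk0 _ hP)), S.ratVal_sewing (hHg m i) (hHw m i), ← hΞ, ← map_inv,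
      coe_constU, Units.val_inv_eq_inv_val, Units.val_mk0, Algebra.smul_def,
      PowerSeries.algebraMap_apply]
    · simp only [Algebra.algebraMap_self, RingHom.id_apply, map_mul]
      ring
    · rw [coe_diffU hb, hX', bracketed_zero, bracketed_last]
    · intro i
      rw [coe_leftU (ha i) (hx i), hX', bracketed_zero, bracketed_mid]
    · intro i
      rw [coe_rightU (ha i) (hx i), hX', bracketed_mid, bracketed_last]
    · simp only [hX', bracketed_mid]
      rw [coe_constU, Units.val_mk0, map_discrAt]
  set c0 : ℂ := Complex.exp (ℓ * h) * ((discrAt S.K z)⁻¹ * Ξ) with hc0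
  have hterm : ∀ m : ℕ, sewingRho Wp Wm ^ m * ∑ i,
      (S.genusZeroRational (Complex.exp (ℓ * (h + m))) m (g m i) (w m i)).eval X' =
      C c0 * (kappa ^ m * ∑ i, S.sewTerm m x (g m i) (w m i)) := by
    intro m
    have e1 : Complex.exp (ℓ * (h + m)) = Complex.exp (ℓ * h) * (-1) ^ m := by
      rw [mul_add, Complex.exp_add, mul_comm ℓ (m : ℂ), Complex.exp_nat_mul, hℓ]
    have e2 : ((diffU b : ℂ⟦X⟧) ^ 2) ^ m * ((diffU b ^ (-2 * m : ℤ) : ℂ⟦X⟧ˣ) : ℂ⟦X⟧) = 1 := by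
      rw [← pow_mul, ← Units.val_pow_eq_pow_val, ← Units.val_mul, ← zpow_natCast, ← zpow_add]
      have : ((2 * m : ℕ) : ℤ) + -2 * m = 0 := by push_cast; ring
      rw [this, zpow_zero, Units.val_one]
    have e3 : ((-1 : ℂ⟦X⟧) ^ m) * (-1) ^ m = 1 := by rw [← mul_pow]; simp
    simp only [hR, ← Finset.mul_sum]
    rw [sewingRho_eq hb, neg_pow, mul_pow, e1, hc0]
    simp only [map_mul, map_pow, map_neg, map_one]
    linear_combination (kappa ^ m * C (Complex.exp (ℓ * h)) * C (discrAt S.K z)⁻¹ * C Ξ *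
      ∑ i, S.sewTerm m x (g m i) (w m i)) * (((-1 : ℂ⟦X⟧) ^ m) * (-1) ^ m * e2 + e3)
  have hdvd : ∀ m : ℕ, X ^ m ∣ sewingRho Wp Wm ^ m * ∑ i,
      (S.genusZeroRational (Complex.exp (ℓ * (h + m))) m (g m i) (w m i)).eval X' := by
    intro m
    rw [hterm, kappa, mul_pow, mul_assoc]
    exact (dvd_mul_right _ _).mul_left _
  rw [genusOneSewn, ← hX', coeff_mul_mk_sum hdvd]
  simp only [hterm, ← Finset.mul_sum]
  have key := S.sewing hHg hHw hEg hEw hFE x one_add_sq_mul_kappa M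
  have e : C (Complex.exp (-ℓ * h)) * PowerSeries.binomialSeries ℂ (-2 * h) *
      (C c0 * ∑ m ∈ Finset.range (M + 1), kappa ^ m * ∑ i, S.sewTerm m x (g m i) (w m i)) =
      C (Complex.exp (-ℓ * h) * c0) * (PowerSeries.binomialSeries ℂ (-2 * h) *
        ∑ m ∈ Finset.range (M + 1), kappa ^ m * ∑ i, S.sewTerm m x (g m i) (w m i)) := by
    rw [mul_mul_mul_comm, ← map_mul]
  have e4 : Complex.exp (-ℓ * h) * c0 = (discrAt S.K z)⁻¹ * Ξ := by
    rw [hc0, ← mul_assoc, ← Complex.exp_add]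
    simp
  rw [e, coeff_C_mul, key, e4]

end QuasiprimaryFields

namespace QuasiprimaryFields

variable {n : ℕ} {U W : Type*} [AddCommGroup U] [Module ℂ U] [AddCommGroup W] [Module ℂ W]
  (S : QuasiprimaryFields n U W)

/-- The powers of the Jacobian that clear the discriminant turn the conformal weights `wt` into
the effective weights `lam`. -/
theorem discrAt_inv_mul_prod_zpow_lam {b : ℂ} {a x z ξ : Fin n → ℂ} (hξ : ∀ i, ξ i ≠ 0)
    (hξa : ∀ i, ξ i = -(b * (a i * a i)))
    (h : ∀ i j, x i - x j = -(b * (a i * a j) * (z i - z j))) :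
    (discrAt S.K z)⁻¹ * ∏ i, ξ i ^ S.lam i = (discrAt S.K x)⁻¹ * ∏ i, ξ i ^ S.wt i := by
  have h1 : ∏ i, ξ i ^ S.lam i = (∏ i, ξ i ^ S.wt i) * ((∏ i, ξ i ^ (n - 1)) ^ S.K)⁻¹ := by
    rw [← Finset.prod_pow, ← Finset.prod_inv_distrib, ← Finset.prod_mul_distrib]
    refine Finset.prod_congr rfl fun i _ => ?_
    have hn : ((n - 1 : ℕ) : ℤ) = (n : ℤ) - 1 := by
      have := i.pos
      omega
    rw [lam, zpow_sub₀ (hξ i), zpow_natCast, ← hn, mul_comm (S.K : ℤ), ← Nat.cast_mul,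
      zpow_natCast, pow_mul, div_eq_mul_inv]
  rw [discrAt_moebius S.K b h, h1, mul_inv]
  simp only [hξa]
  ring

end QuasiprimaryFields

theorem mainTheorem4 {V : Type*} [AddCommGroup V] [Module ℂ V] (𝒱 : VOA V)
    (hcft : 𝒱.IsStrongCFTType) (hsimple : 𝒱.IsSimple) (hdual : 𝒱.IsSelfDual)
    {W : Type*} [AddCommGroup W] [Module ℂ W] (M : 𝒱.OrdinaryModule W) (hirr : M.IsIrreducible)
    (ℓ : ℂ) (hℓ : Complex.exp ℓ = -1)
    {n : ℕ} (v : Fin n → V) (wt : Fin n → ℕ)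
    (hwt : ∀ i, v i ∈ 𝒱.gr (wt i)) (hqp : ∀ i, 𝒱.L 1 (v i) = 0)
    {ι : ℕ → Type*} [∀ m, Fintype (ι m)] (b : ∀ m, Module.Basis (ι m) ℂ (M.gr m)) :
    ∃ (R : ∀ m, ι m → RegularRational {x : Fin (n + 2) → ℂ | Function.Injective x})
      (T : ℕ → RegularRational {x : Fin n → ℂ | Function.Injective x ∧ ∀ i, x i ≠ 0}),
      -- `R m i` is the rational extension of `(y₁ - y₂)^{2h} Z⁽⁰⁾(b,y₁; v,z; b',y₂)`
      (∀ m i, ConvergesTo {x | Function.Injective x}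
        (M.genusZeroCoeff ℓ v (b m i) (M.extend m ((b m).coord i)))
        (fun x => (1 - x (Fin.last (n + 1)) / x 0) ^ (-2 * M.h) * (R m i).eval x)) ∧
      -- `T m` is the rational extension of the coefficient of `q^{h+m}` in
      -- `tr_{W'} (Y'(v_1,x_1) ⋯ Y'(v_n,x_n) q^{L(0)})`
      (∀ m, ConvergesTo {x | Function.Injective x ∧ ∀ i, x i ≠ 0} (M.traceCoeff v m)
        (fun x => (T m).eval x)) ∧
      -- the sewn function equals the trace of `∏ Y'(e^{wt(v_i) ζ_i} v_i, e^{ζ_i}) q^{L(0)}` times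
      -- `∏ (dζ_i/dz_i)^{wt(v_i)}`, with `ζ = log ((z - W₋) / (z - W₊))`
      ∀ (Wp Wm : ℂ), Wp ≠ Wm → ∀ z : Fin n → ℂ, Function.Injective z →
        (∀ i, z i ≠ Wp ∧ z i ≠ Wm) →
        ∀ ζ : Fin n → ℂ, (∀ i, Complex.exp (ζ i) = (z i - Wm) / (z i - Wp)) →
          genusOneSewn ℓ M.h R Wp Wm z =
            PowerSeries.mk fun m =>
              (∏ i, Complex.exp (wt i * ζ i)) * (T m).eval (fun i => Complex.exp (ζ i)) *
                ∏ i, logDeriv (fun t : ℂ => (t - Wm) / (t - Wp)) (z i) ^ wt i := by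
  have hv : ∀ i, 𝒱.IsQuasiprimary (v i) (wt i) := fun i => ⟨hwt i, hqp i⟩
  refine ⟨_, _, fun m i => M.convergesTo_genusZero hv hcft hsimple hdual ℓ (b m i).2 _,
    fun m => M.convergesTo_trace hv (b m), fun Wp Wm hpm z hz hzW ζ hζ => ?_⟩
  have ha : ∀ i, z i - Wp ≠ 0 := fun i => sub_ne_zero.mpr (hzW i).1
  have hc : ∀ i, z i - Wm ≠ 0 := fun i => sub_ne_zero.mpr (hzW i).2
  have hB : Wp - Wm ≠ 0 := sub_ne_zero.mpr hpm
  set S := M.quasiprimaryFields hv with hS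
  have hdiff : ∀ i j, Complex.exp (ζ i) - Complex.exp (ζ j) =
      -((Wp - Wm) * ((z i - Wp)⁻¹ * (z j - Wp)⁻¹) * (z i - z j)) := fun i j => by
    have h1 := ha i
    have h2 := ha j
    rw [hζ, hζ]
    field_simp
    ring
  have hinj : Function.Injective fun i => Complex.exp (ζ i) := fun i j hij => by
    have h1 := hdiff i j
    rw [sub_eq_zero.mpr hij, eq_comm, neg_eq_zero] at h1
    exact hz (sub_eq_zero.mp ((mul_eq_zero.mp h1).resolve_left
      (mul_ne_zero hB (mul_ne_zero (inv_ne_zero (ha i)) (inv_ne_zero (ha j))))))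
  ext m
  refine (S.genusOneSewn_eq hℓ (b := Units.mk0 _ hB) (a := fun i => Units.mk0 _ (ha i))
    (x := fun i => Units.mk0 _ (Complex.exp_ne_zero (ζ i)))
    (g := fun m i => M.extend m ((b m).coord i)) (w := fun m i => (b m i : W))
    (fun m i => M.HU_extend hv _) (fun m i => M.HW_apply hv (b m i).2)
    (fun m i => M.EU_pow_eq_zero hv _) (fun m i => M.EW_pow_eq_zero hv (b m i).2)
    (M.FT_canonical hv b) hz rfl (fun _ => rfl)
    (fun i => by
      rw [Units.val_mk0, Units.val_mk0, hζ, div_mul_cancel₀ _ (ha i)]) m).trans ?_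
  rw [coeff_mk, QuasiprimaryFields.traceRational_eval _ _ hinj
    (u := fun i => Units.mk0 _ (Complex.exp_ne_zero (ζ i))) (fun _ => rfl), map_sum,
    S.discrAt_inv_mul_prod_zpow_lam (b := Wp - Wm) (a := fun i => (z i - Wp)⁻¹)
      (x := fun i => Complex.exp (ζ i)) (fun i => Units.ne_zero _)
      (fun i => by
        simp only [Units.val_mul, Units.val_neg, Units.val_inv_eq_inv_val, Units.val_mk0, neg_mul])
      hdiff]
  -- `e^ζ dζ/dz` is the derivative `-(W₊ - W₋) / (z - W₊)²` of the Möbius transformation `e^ζ`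
  have hjac : (∏ i, ((-Units.mk0 _ hB * ((Units.mk0 _ (ha i))⁻¹ * (Units.mk0 _ (ha i))⁻¹) : ℂˣ) : ℂ) ^
      S.wt i) = (∏ i, Complex.exp (wt i * ζ i)) *
        ∏ i, logDeriv (fun t : ℂ => (t - Wm) / (t - Wp)) (z i) ^ wt i := by
    rw [← Finset.prod_mul_distrib]
    refine Finset.prod_congr rfl fun i _ => ?_
    have h1 := ha i
    have h2 := hc i
    have hd : logDeriv (fun t : ℂ => (t - Wm) / (t - Wp)) (z i) =
        1 / (z i - Wm) - 1 / (z i - Wp) := by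
      rw [logDeriv_div (z i) h2 h1 (by fun_prop) (by fun_prop)]
      simp [logDeriv_apply]
    change _ ^ wt i = _
    rw [Complex.exp_nat_mul, ← mul_pow, hζ, hd]
    congr 1
    simp only [Units.val_mul, Units.val_neg, Units.val_inv_eq_inv_val, Units.val_mk0]
    field_simp
    ring
  rw [hjac]
  ring

end
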